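/- All graphs are finite and simple. Two vertices $u,v$ of a graph $G$ are twins if $N_G(u)\setminus\{v\}=N_G(v)\setminus\{u\}$. A set $S\subseteq V(G)$ is a twin cover of $G$ if every edge of $G$ whose endpoints are not twins has at least one endpoint in $S$, and the twin cover number $\mathrm{tc}(G)$ is the minimum size of a twin cover of $G$. The problem Maximum Common Induced Subgraph asks, given graphs $G_1,G_2$ and an integer $h\ge 0$, whether there is a graph $H$ with at least $h$ vertices such that both $G_1$ and $G_2$ contain an induced subgraph isomorphic to $H$. Theorem. Maximum Common Induced Subgraph is fixed-parameter tractable parameterized by $\mathrm{tc}(G_1)+\mathrm{tc}(G_2)$. That is, there are a deterministic algorithm (a program for a unit-cost random access machine with addition and truncated subtraction), a computable function $f\colon\mathbb{N}\to\mathbb{N}$ and a constant $c$ such that, on every instance $(G_1,G_2,h)$, given by $|V(G_1)|$, $|V(G_2)|$, $h$ and the two adjacency matrices, the algorithm decides the instance correctly within $f(\mathrm{tc}(G_1)+\mathrm{tc}(G_2))\cdot N^{c}$ steps, where $N=3+|V(G_1)|^2+|V(G_2)|^2$ is the length of the input. -/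

import Mathlib

/-! ### Twin covers -/

namespace SimpleGraph

/-- Two vertices are twins if they have the same neighborhood when the adjacency between them
is ignored: `N(u) \ {v} = N(v) \ {u}`. -/
def Twins {V : Type*} (G : SimpleGraph V) (u v : V) : Prop :=
  G.neighborSet u \ {v} = G.neighborSet v \ {u}

/-- A set of vertices is a twin cover if every edge whose endpoints are not twins has at least
one endpoint in the set. -/
def IsTwinCover {V : Type*} (G : SimpleGraph V) (S : Finset V) : Prop :=
  ∀ u v : V, G.Adj u v → ¬ G.Twins u v → u ∈ S ∨ v ∈ S

/-- The twin cover number: the minimum size of a twin cover. On a finite graph the set below is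
nonempty, as the set of all vertices is a twin cover. -/
noncomputable def twinCoverNumber {V : Type*} [Fintype V] (G : SimpleGraph V) : ℕ :=
  sInf {k : ℕ | ∃ S : Finset V, G.IsTwinCover S ∧ S.card = k}

end SimpleGraph

/-! ### A random access machine with unit cost

A program has finitely many registers and finitely many arrays of unbounded length, all of them
holding natural numbers. The arithmetic is addition and truncated subtraction only (no
multiplication), so that unit cost is polynomially related to the time of a Turing machine. -/

namespace RAM

/-- The contents of the registers, and of the cells of the arrays (array name, then index). -/
structure State where
  reg : ℕ → ℕ
  arr : ℕ → ℕ → ℕ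

/-- `s.setReg x v` is `s` with the value `v` written to register `x`. -/
def State.setReg (s : State) (x v : ℕ) : State :=
  { s with reg := Function.update s.reg x v }

/-- `s.setArr a i v` is `s` with the value `v` written to the cell `i` of the array `a`. -/
def State.setArr (s : State) (a i v : ℕ) : State :=
  { s with arr := Function.update s.arr a (Function.update (s.arr a) i v) }

/-- Programs. Registers are called `x`, `y`, `z` and arrays `a`; these names and the number `c`
are constants in the program text. -/
inductive Prog : Type
  /-- do nothing -/
  | skip : Prog
  /-- `x := c` -/
  | const (x c : ℕ) : Prog
  /-- `x := y` -/
  | copy (x y : ℕ) : Prog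
  /-- `x := y + z` -/
  | plus (x y z : ℕ) : Prog
  /-- `x := max (y - z) 0` -/
  | monus (x y z : ℕ) : Prog
  /-- `x := a[y]` -/
  | load (x a y : ℕ) : Prog
  /-- `a[x] := y` -/
  | store (a x y : ℕ) : Prog
  /-- first `p`, then `q` -/
  | seq (p q : Prog) : Prog
  /-- `if x ≠ 0 then p else q` -/
  | ite (x : ℕ) (p q : Prog) : Prog
  /-- `while x ≠ 0 do p` -/
  | loop (x : ℕ) (p : Prog) : Prog

/-- `Exec p s t s'`: the program `p`, started in the state `s`, halts after exactly `t` steps in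
the state `s'`. Every elementary instruction and every test of a conditional or a loop is one
step. -/
inductive Exec : Prog → State → ℕ → State → Prop
  | skip (s : State) : Exec .skip s 1 s
  | const (x c : ℕ) (s : State) : Exec (.const x c) s 1 (s.setReg x c)
  | copy (x y : ℕ) (s : State) : Exec (.copy x y) s 1 (s.setReg x (s.reg y))
  | plus (x y z : ℕ) (s : State) : Exec (.plus x y z) s 1 (s.setReg x (s.reg y + s.reg z))
  | monus (x y z : ℕ) (s : State) : Exec (.monus x y z) s 1 (s.setReg x (s.reg y - s.reg z))
  | load (x a y : ℕ) (s : State) : Exec (.load x a y) s 1 (s.setReg x (s.arr a (s.reg y)))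
  | store (a x y : ℕ) (s : State) : Exec (.store a x y) s 1 (s.setArr a (s.reg x) (s.reg y))
  | seq {p q : Prog} {s₀ s₁ s₂ : State} {t₁ t₂ : ℕ} :
      Exec p s₀ t₁ s₁ → Exec q s₁ t₂ s₂ → Exec (.seq p q) s₀ (t₁ + t₂) s₂
  | ite_true {x : ℕ} {p q : Prog} {s s' : State} {t : ℕ} :
      s.reg x ≠ 0 → Exec p s t s' → Exec (.ite x p q) s (1 + t) s'
  | ite_false {x : ℕ} {p q : Prog} {s s' : State} {t : ℕ} :
      s.reg x = 0 → Exec q s t s' → Exec (.ite x p q) s (1 + t) s'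
  | loop_true {x : ℕ} {p : Prog} {s₀ s₁ s₂ : State} {t₁ t₂ : ℕ} :
      s₀.reg x ≠ 0 → Exec p s₀ t₁ s₁ → Exec (.loop x p) s₁ t₂ s₂ →
        Exec (.loop x p) s₀ (1 + t₁ + t₂) s₂
  | loop_false {x : ℕ} {p : Prog} {s : State} :
      s.reg x = 0 → Exec (.loop x p) s 1 s

/-- Programs are deterministic: the running time and the final state are determined by the
program and the initial state. -/
theorem Exec.deterministic {p : Prog} {s s' : State} {t : ℕ} (h : Exec p s t s') :
    ∀ {t₁ : ℕ} {s₁ : State}, Exec p s t₁ s₁ → t = t₁ ∧ s' = s₁ := by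
  induction h with
  | seq _ _ ih₁ ih₂ =>
    intro _ _ h
    cases h with
    | seq a b =>
      obtain ⟨rfl, rfl⟩ := ih₁ a
      obtain ⟨rfl, rfl⟩ := ih₂ b
      exact ⟨rfl, rfl⟩
  | ite_true hx _ ih =>
    intro _ _ h
    cases h with
    | ite_true _ a => obtain ⟨rfl, rfl⟩ := ih a; exact ⟨rfl, rfl⟩
    | ite_false hx' _ => exact absurd hx' hx
  | ite_false hx _ ih =>
    intro _ _ h
    cases h with
    | ite_true hx' _ => exact absurd hx hx'
    | ite_false _ a => obtain ⟨rfl, rfl⟩ := ih a; exact ⟨rfl, rfl⟩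
  | loop_true hx _ _ ih₁ ih₂ =>
    intro _ _ h
    cases h with
    | loop_true _ a b =>
      obtain ⟨rfl, rfl⟩ := ih₁ a
      obtain ⟨rfl, rfl⟩ := ih₂ b
      exact ⟨rfl, rfl⟩
    | loop_false hx' => exact absurd hx' hx
  | loop_false hx =>
    intro _ _ h
    cases h with
    | loop_true hx' _ _ => exact absurd hx hx'
    | loop_false _ => exact ⟨rfl, rfl⟩
  | _ =>
    intro _ _ h
    cases h
    exact ⟨rfl, rfl⟩

/-- The initial state on a given input: the input is in array `0`, and all other array cells and
all registers are `0`. -/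
def initState (w : List ℕ) : State where
  reg := fun _ => 0
  arr := fun a i => if a = 0 then w.getD i 0 else 0

end RAM

/-- The decision problem `L` on the instances `I`, which are given to the machine through the
encoding `enc`, is fixed-parameter tractable with respect to the parameter `κ`: one program
halts on every instance `x` within `f (κ x) * |x| ^ c` steps, where `f` is a computable function,
`c` is a constant and `|x|` is the length of the encoding of `x`; its answer in register `0` is
`1` on the yes-instances and `0` on the no-instances. -/
def IsFPT {I : Type} (enc : I → List ℕ) (κ : I → ℕ) (L : I → Prop) : Prop :=
  ∃ (p : RAM.Prog) (f : ℕ → ℕ) (c : ℕ), Computable f ∧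
    ∀ x : I, ∃ (t : ℕ) (s : RAM.State),
      RAM.Exec p (RAM.initState (enc x)) t s ∧
      t ≤ f (κ x) * (enc x).length ^ c ∧
      (L x → s.reg 0 = 1) ∧ (¬ L x → s.reg 0 = 0)

/-! ### Maximum Common Induced Subgraph -/

/-- An instance of Maximum Common Induced Subgraph: two finite graphs and a number `h`. -/
structure MCISInstance where
  n₁ : ℕ
  n₂ : ℕ
  G₁ : SimpleGraph (Fin n₁)
  G₂ : SimpleGraph (Fin n₂)
  h : ℕ

namespace MCISInstance

/-- The question: is there a graph `H` with at least `h` vertices such that both graphs contain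
an induced subgraph isomorphic to `H`? -/
def IsYes (x : MCISInstance) : Prop :=
  ∃ (m : ℕ) (H : SimpleGraph (Fin m)),
    x.h ≤ m ∧ H.IsIndContained x.G₁ ∧ H.IsIndContained x.G₂

/-- The adjacency matrix of a graph, written row by row. -/
noncomputable def adjList {n : ℕ} (G : SimpleGraph (Fin n)) : List ℕ :=
  open Classical in
  (List.finRange n).flatMap fun i => (List.finRange n).map fun j => if G.Adj i j then 1 else 0

/-- An instance is given by the numbers of vertices, the number `h`, and the two adjacency
matrices. -/
noncomputable def encode (x : MCISInstance) : List ℕ :=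
  [x.n₁, x.n₂, x.h] ++ adjList x.G₁ ++ adjList x.G₂

/-- The sum of the twin cover numbers of the two graphs. -/
noncomputable def tcSum (x : MCISInstance) : ℕ :=
  x.G₁.twinCoverNumber + x.G₂.twinCoverNumber

end MCISInstance

/-!
A greedy maximal matching of the edges between non-twins gives, in polynomial time, twin covers with
at most `2 * tc` vertices. Outside its twin cover, each graph is a disjoint union of cliques of
twins. In a common induced subgraph, seen as a partial isomorphism, at most as many pairs meet a
twin cover as the covers have vertices. When these pairs are fixed, label each remaining vertex by
its neighbors among the fixed vertices and by its rank in what remains of its clique. The remaining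
cliques with given neighbors are best matched in decreasing order of size, and a largest extension
therefore has `∑ l, min a_l b_l` vertices, where `a_l` and `b_l` count the vertices with label `l`
in the two graphs.

It remains to search for the fixed pairs. All vertices of a clique that are paired with cover
vertices may be exchanged for as many vertices of an untouched clique of the same type. This does
not lower the value if the size of the clique moves in the right direction relative to a threshold,
which is determined by the sizes of the largest cliques of the other graph. Hence it is enough to
consider the first few vertices of the few cliques of each type that are closest to one of boundedly
many thresholds. The maps between the resulting pools of vertices are the digit expansions in a
fixed base, so a single loop runs through all of them.
-/

namespace RAM

/-! ### Running programs within a time bound -/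

/-- The program `p` takes the state `s` to `s'` within `T` steps. -/
def Runs (p : Prog) (s : State) (T : ℕ) (s' : State) : Prop :=
  ∃ t ≤ T, Exec p s t s'

section runs

variable {p q : Prog} {s s₀ s₁ s₂ s' : State} {T T' T₁ T₂ : ℕ}

theorem Runs.mono (h : Runs p s T s') (hT : T ≤ T') : Runs p s T' s' := by
  obtain ⟨t, ht, e⟩ := h
  exact ⟨t, ht.trans hT, e⟩

theorem Runs.seq (h₁ : Runs p s₀ T₁ s₁) (h₂ : Runs q s₁ T₂ s₂) :
    Runs (.seq p q) s₀ (T₁ + T₂) s₂ := by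
  obtain ⟨t₁, ht₁, e₁⟩ := h₁
  obtain ⟨t₂, ht₂, e₂⟩ := h₂
  exact ⟨t₁ + t₂, add_le_add ht₁ ht₂, .seq e₁ e₂⟩

theorem Runs.const (x c : ℕ) (s : State) : Runs (.const x c) s 1 (s.setReg x c) :=
  ⟨1, le_rfl, .const x c s⟩

theorem Runs.copy (x y : ℕ) (s : State) : Runs (.copy x y) s 1 (s.setReg x (s.reg y)) :=
  ⟨1, le_rfl, .copy x y s⟩

theorem Runs.plus (x y z : ℕ) (s : State) :
    Runs (.plus x y z) s 1 (s.setReg x (s.reg y + s.reg z)) :=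
  ⟨1, le_rfl, .plus x y z s⟩

theorem Runs.monus (x y z : ℕ) (s : State) :
    Runs (.monus x y z) s 1 (s.setReg x (s.reg y - s.reg z)) :=
  ⟨1, le_rfl, .monus x y z s⟩

theorem Runs.load (x a y : ℕ) (s : State) :
    Runs (.load x a y) s 1 (s.setReg x (s.arr a (s.reg y))) :=
  ⟨1, le_rfl, .load x a y s⟩

theorem Runs.store (a x y : ℕ) (s : State) :
    Runs (.store a x y) s 1 (s.setArr a (s.reg x) (s.reg y)) :=
  ⟨1, le_rfl, .store a x y s⟩

theorem Runs.ite_true {x : ℕ} (hx : s.reg x ≠ 0) (h : Runs p s T s') :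
    Runs (.ite x p q) s (T + 1) s' := by
  obtain ⟨t, ht, e⟩ := h
  exact ⟨1 + t, by omega, .ite_true hx e⟩

theorem Runs.ite_false {x : ℕ} (hx : s.reg x = 0) (h : Runs q s T s') :
    Runs (.ite x p q) s (T + 1) s' := by
  obtain ⟨t, ht, e⟩ := h
  exact ⟨1 + t, by omega, .ite_false hx e⟩

theorem Runs.loop_true {x : ℕ} (hx : s₀.reg x ≠ 0) (h₁ : Runs p s₀ T₁ s₁)
    (h₂ : Runs (.loop x p) s₁ T₂ s₂) : Runs (.loop x p) s₀ (T₁ + 1 + T₂) s₂ := by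
  obtain ⟨t₁, ht₁, e₁⟩ := h₁
  obtain ⟨t₂, ht₂, e₂⟩ := h₂
  exact ⟨1 + t₁ + t₂, by omega, .loop_true hx e₁ e₂⟩

theorem Runs.loop_false {x : ℕ} (hx : s.reg x = 0) : Runs (.loop x p) s 1 s :=
  ⟨1, le_rfl, .loop_false hx⟩

theorem Runs.countdown {x n : ℕ} (Inv : ℕ → State → Prop)
    (hx : ∀ j s, Inv j s → s.reg x = n - j)
    (hp : ∀ j s, j < n → Inv j s → ∃ s', Runs p s T s' ∧ Inv (j + 1) s') (hs : Inv 0 s) :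
    ∃ s', Runs (.loop x p) s (n * (T + 1) + 1) s' ∧ Inv n s' := by
  suffices H : ∀ m j s, j + m = n → Inv j s →
      ∃ s', Runs (.loop x p) s (m * (T + 1) + 1) s' ∧ Inv n s' from H n 0 s (by omega) hs
  intro m
  induction m with
  | zero =>
    intro j s hj hI
    obtain rfl : j = n := by omega
    exact ⟨s, (Runs.loop_false (by rw [hx _ _ hI]; omega)).mono (by omega), hI⟩
  | succ m ih =>
    intro j s hj hI
    obtain ⟨s₁, r₁, hI₁⟩ := hp j s (by omega) hI
    obtain ⟨s₂, r₂, hI₂⟩ := ih (j + 1) s₁ (by omega) hI₁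
    refine ⟨s₂, (Runs.loop_true (by rw [hx _ _ hI]; omega) r₁ r₂).mono (le_of_eq ?_), hI₂⟩
    ring

end runs

@[simp] theorem State.setReg_reg (s : State) (x v y : ℕ) :
    (s.setReg x v).reg y = if y = x then v else s.reg y := by
  simp [State.setReg, Function.update_apply]

/-! ### Memories and loops over the numbers below the stored bound -/

/-- The contents of the arrays. This is a structure rather than a function type so that
`fun_prop` does not look inside it. -/
structure Mem where
  cell : ℕ → ℕ → ℕ

/-- The bound for all loops is kept in cell `0` of array `1`. -/
def Mem.bound (A : Mem) : ℕ := A.cell 1 0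

/-- The memory `A` with the value `v` written to the cell `i` of the array `a`. -/
def Mem.set (A : Mem) (a i v : ℕ) : Mem :=
  ⟨Function.update A.cell a (Function.update (A.cell a) i v)⟩

theorem Mem.set_cell (A : Mem) (a i v b j : ℕ) :
    (A.set a i v).cell b j = if b = a ∧ j = i then v else A.cell b j := by
  by_cases h : b = a
  · subst h
    simp [Mem.set, Function.update_apply]
  · simp [Mem.set, h]

/-- The contents of the arrays in a state of the machine. -/
def State.mem (s : State) : Mem := ⟨s.arr⟩

@[simp] theorem State.setReg_mem (s : State) (x v : ℕ) : (s.setReg x v).mem = s.mem := rfl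

@[simp] theorem State.setArr_reg (s : State) (a i v : ℕ) : (s.setArr a i v).reg = s.reg := rfl

theorem State.setArr_mem (s : State) (a i v : ℕ) : (s.setArr a i v).mem = s.mem.set a i v := rfl

/-- The state `s'` has the arrays of `s`, and the registers of `s` below `n`. The registers from
`n` on are scratch space. -/
structure State.AgreesBelow (n : ℕ) (s s' : State) : Prop where
  mem : s'.mem = s.mem
  reg : ∀ x < n, s'.reg x = s.reg x

namespace State.AgreesBelow

variable {m n v : ℕ} {s s₁ s₂ : State}

theorem refl (n : ℕ) (s : State) : s.AgreesBelow n s := ⟨rfl, fun _ _ => rfl⟩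

theorem mono (h : s.AgreesBelow n s₁) (hm : m ≤ n) : s.AgreesBelow m s₁ :=
  ⟨h.mem, fun x hx => h.reg x (hx.trans_le hm)⟩

theorem trans (h₁ : s.AgreesBelow n s₁) (h₂ : s₁.AgreesBelow n s₂) : s.AgreesBelow n s₂ :=
  ⟨h₂.mem.trans h₁.mem, fun x hx => (h₂.reg x hx).trans (h₁.reg x hx)⟩

theorem setReg (h : s.AgreesBelow n s₁) {x : ℕ} (hx : n ≤ x) :
    s.AgreesBelow n (s₁.setReg x v) :=
  ⟨h.mem, fun y hy => by rw [setReg_reg, if_neg (hy.trans_le hx).ne, h.reg y hy]⟩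

end State.AgreesBelow

/-- Prepare the registers for the loop `forBelowBound`. -/
def forBelowBoundInit (z : ℕ) : Prog :=
  .seq (.seq (.seq (.seq (.const (z + 3) 0) (.load (z + 2) 1 (z + 3))) (.const z 0))
    (.const (z + 1) 0)) (.const (z + 3) 1)

/-- Run `body` once for each `i` below the bound stored in memory. The index `i` is in register
`z + 1`, the number of remaining rounds in `z + 2`, and the number `1` in `z + 3`. The register
`z` is set to `0` at the beginning and is left to the body as an accumulator. -/
def forBelowBound (z : ℕ) (body : Prog) : Prog :=
  .seq (forBelowBoundInit z)
    (.loop (z + 2)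
      (.seq (.seq body (.plus (z + 1) (z + 1) (z + 3))) (.monus (z + 2) (z + 2) (z + 3))))

theorem Runs.forBelowBoundInit (z : ℕ) (s : State) :
    ∃ s', Runs (forBelowBoundInit z) s 5 s' ∧ (s.setReg z 0).AgreesBelow (z + 1) s' ∧
      s'.reg (z + 1) = 0 ∧ s'.reg (z + 2) = s.mem.bound ∧ s'.reg (z + 3) = 1 := by
  refine ⟨_, ((((Runs.const _ _ _).seq (Runs.load _ _ _ _)).seq (Runs.const _ _ _)).seq
    (Runs.const _ _ _)).seq (Runs.const _ _ _), ⟨rfl, fun x hx => ?_⟩, by simp, ?_, by simp⟩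
  · have h₁ : x ≠ z + 1 := by omega
    have h₂ : x ≠ z + 2 := by omega
    have h₃ : x ≠ z + 3 := by omega
    simp [h₁, h₂, h₃]
  · simp [State.setReg, Mem.bound, State.mem]

theorem Runs.forBelowBound {z T : ℕ} {body : Prog} {s : State} (Inv : ℕ → State → Prop)
    (hInv : ∀ {j σ σ'}, Inv j σ → σ.AgreesBelow (z + 1) σ' → Inv j σ')
    (hzero : Inv 0 (s.setReg z 0))
    (hbody : ∀ j < s.mem.bound, ∀ σ, Inv j σ → σ.reg (z + 1) = j →
      ∃ σ', Runs body σ T σ' ∧ Inv (j + 1) σ' ∧ ∀ x, z < x → x < z + 4 → σ'.reg x = σ.reg x) :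
    ∃ s', Runs (forBelowBound z body) s (s.mem.bound * (T + 3) + 6) s' ∧
      Inv s.mem.bound s' := by
  obtain ⟨s₁, r₁, a₁, i₁, n₁, o₁⟩ := Runs.forBelowBoundInit z s
  obtain ⟨s₂, r₂, hI₂, -⟩ := Runs.countdown (n := s.mem.bound) (x := z + 2) (T := T + 1 + 1)
    (fun j σ => Inv j σ ∧ σ.reg (z + 1) = j ∧ σ.reg (z + 2) = s.mem.bound - j ∧
      σ.reg (z + 3) = 1)
    (p := .seq (.seq body (.plus (z + 1) (z + 1) (z + 3))) (.monus (z + 2) (z + 2) (z + 3)))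
    (fun j σ h => h.2.2.1)
    (by
      rintro j σ hj ⟨hI, hi, hn, ho⟩
      obtain ⟨σ', r', hI', hσ'⟩ := hbody j hj σ hI hi
      refine ⟨_, (r'.seq (Runs.plus _ _ _ _)).seq (Runs.monus _ _ _ _), ?_, ?_, ?_, ?_⟩
      · exact hInv hI' (((State.AgreesBelow.refl _ _).setReg le_rfl).setReg (by omega))
      · simp [hσ', hi, ho]
      · simp [hσ', hn, ho, Nat.sub_sub]
      · simp [hσ', ho])
    ⟨hInv hzero a₁, i₁, by simpa using n₁, o₁⟩
  exact ⟨s₂, (r₁.seq r₂).mono (le_of_eq (by ring)), hI₂⟩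

/-! ### Functions computed in time polynomial in the stored bound -/

/-- Data that the machine can hold: finitely many numbers, and possibly a reference to the
current contents of the arrays. -/
class Storable (Γ : Type) where
  /-- the number of registers used -/
  width : ℕ
  /-- the contents of the registers -/
  entry : Γ → ℕ → ℕ
  /-- the arrays of the machine are those referred to -/
  RefersTo : Γ → Mem → Prop

open Classical in
noncomputable instance : Storable Prop := ⟨1, fun P _ => if P then 1 else 0, fun _ _ => True⟩

instance : Storable ℕ := ⟨1, fun n _ => n, fun _ _ => True⟩

instance : Storable Mem := ⟨0, fun _ _ => 0, fun A B => A = B⟩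

instance {Γ Δ : Type} [Storable Γ] [Storable Δ] : Storable (Γ × Δ) :=
  ⟨Storable.width Γ + Storable.width Δ,
    fun p i => if i < Storable.width Γ then Storable.entry p.1 i
      else Storable.entry p.2 (i - Storable.width Γ),
    fun p A => Storable.RefersTo p.1 A ∧ Storable.RefersTo p.2 A⟩

/-- The state `s` holds `γ` in the registers `loc 0, loc 1, ...`. -/
structure State.Holds {Γ : Type} [Storable Γ] (s : State) (loc : ℕ → ℕ) (γ : Γ) : Prop where
  refersTo : Storable.RefersTo γ s.mem
  reg : ∀ i < Storable.width Γ, s.reg (loc i) = Storable.entry γ i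

theorem State.Holds.of_agreesBelow {Γ : Type} [Storable Γ] {s s' : State} {loc : ℕ → ℕ} {γ : Γ}
    {n : ℕ} (h : s.Holds loc γ) (hloc : ∀ i < Storable.width Γ, loc i < n)
    (hs : s.AgreesBelow n s') : s'.Holds loc γ :=
  ⟨hs.mem.symm ▸ h.refersTo, fun i hi => (hs.reg _ (hloc i hi)).trans (h.reg i hi)⟩

/-- The numbers `F γ 0, ..., F γ (j - 1)` are computed by a program from `γ`, held in arbitrary
registers `loc i`. The results are written to the registers from `out` on, and no register below
`out` is changed. The time is polynomial in the bound stored in memory. -/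
def PolyTimeTuple {Γ : Type} [Storable Γ] (j : ℕ) (F : Γ → ℕ → ℕ) : Prop :=
  ∃ C k : ℕ, ∀ (loc : ℕ → ℕ) (out : ℕ), (∀ i < Storable.width Γ, loc i < out) → ∃ p : Prog,
    ∀ (γ : Γ) (s : State), s.Holds loc γ →
      ∃ s', Runs p s (C * (s.mem.bound + 1) ^ k) s' ∧ s.AgreesBelow out s' ∧
        ∀ i < j, s'.reg (out + i) = F γ i

/-- The number `F γ` is computed by a program from `γ` in polynomial time, with the conventions
of `PolyTimeTuple`. -/
def PolyTimeNat {Γ : Type} [Storable Γ] (F : Γ → ℕ) : Prop :=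
  ∃ C k : ℕ, ∀ (loc : ℕ → ℕ) (out : ℕ), (∀ i < Storable.width Γ, loc i < out) → ∃ p : Prog,
    ∀ (γ : Γ) (s : State), s.Holds loc γ →
      ∃ s', Runs p s (C * (s.mem.bound + 1) ^ k) s' ∧ s.AgreesBelow out s' ∧ s'.reg out = F γ

/-- All parts of `f γ` are computed from `γ` in time polynomial in the bound stored in memory. -/
@[fun_prop]
def PolyTime {Γ Δ : Type} [Storable Γ] [Storable Δ] (f : Γ → Δ) : Prop :=
  (∀ γ A, Storable.RefersTo γ A → Storable.RefersTo (f γ) A) ∧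
    ∀ i < Storable.width Δ, PolyTimeNat fun γ => Storable.entry (f γ) i

theorem mul_pow_add_mul_pow_add_le (b C₁ C₂ k₁ k₂ c : ℕ) :
    C₁ * (b + 1) ^ k₁ + C₂ * (b + 1) ^ k₂ + c ≤ (C₁ + C₂ + c) * (b + 1) ^ (k₁ + k₂) := by
  have h₁ : (b + 1) ^ k₁ ≤ (b + 1) ^ (k₁ + k₂) := Nat.pow_le_pow_right (by omega) (by omega)
  have h₂ : (b + 1) ^ k₂ ≤ (b + 1) ^ (k₁ + k₂) := Nat.pow_le_pow_right (by omega) (by omega)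
  have h₃ : 1 ≤ (b + 1) ^ (k₁ + k₂) := Nat.one_le_pow _ _ (by omega)
  calc C₁ * (b + 1) ^ k₁ + C₂ * (b + 1) ^ k₂ + c
      ≤ C₁ * (b + 1) ^ (k₁ + k₂) + C₂ * (b + 1) ^ (k₁ + k₂) + c * (b + 1) ^ (k₁ + k₂) := by
        gcongr
        exact Nat.le_mul_of_pos_right c h₃
    _ = (C₁ + C₂ + c) * (b + 1) ^ (k₁ + k₂) := by ring

theorem mul_pow_add_le (b C k c : ℕ) :
    C * (b + 1) ^ k + c ≤ (C + c) * (b + 1) ^ k := by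
  simpa using mul_pow_add_mul_pow_add_le b C 0 k 0 c

theorem mul_mul_pow_add_le (b C k c : ℕ) :
    b * (C * (b + 1) ^ k + c) + c ≤ (C + c) * (b + 1) ^ (k + 1) :=
  calc b * (C * (b + 1) ^ k + c) + c
      ≤ b * (C * (b + 1) ^ k + c) + (C * (b + 1) ^ k + c) := by omega
    _ = (b + 1) * (C * (b + 1) ^ k + c) := by ring
    _ ≤ (b + 1) * ((C + c) * (b + 1) ^ k) := by gcongr; exact mul_pow_add_le b C k c
    _ = (C + c) * (b + 1) ^ (k + 1) := by ring

namespace PolyTimeNat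

variable {Γ Δ : Type} [Storable Γ] [Storable Δ]

theorem const (c : ℕ) : PolyTimeNat fun _ : Γ => c :=
  ⟨1, 0, fun _ out _ => ⟨.const out c, fun _ s _ =>
    ⟨_, Runs.const _ _ _, (State.AgreesBelow.refl _ s).setReg le_rfl, by simp⟩⟩⟩

theorem entry {i : ℕ} (hi : i < Storable.width Γ) :
    PolyTimeNat fun γ : Γ => Storable.entry γ i :=
  ⟨1, 0, fun loc out _ => ⟨.copy out (loc i), fun γ s h =>
    ⟨_, Runs.copy _ _ _, (State.AgreesBelow.refl _ s).setReg le_rfl, by simp [h.reg i hi]⟩⟩⟩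

theorem binop {F G : Γ → ℕ} (op : ℕ → ℕ → ℕ) (ins : ℕ → ℕ → ℕ → Prog)
    (hop : ∀ x y z s, Runs (ins x y z) s 1 (s.setReg x (op (s.reg y) (s.reg z))))
    (hF : PolyTimeNat F) (hG : PolyTimeNat G) : PolyTimeNat fun γ => op (F γ) (G γ) := by
  obtain ⟨C₁, k₁, hF⟩ := hF
  obtain ⟨C₂, k₂, hG⟩ := hG
  refine ⟨C₁ + C₂ + 1, k₁ + k₂, fun loc out hloc => ?_⟩
  obtain ⟨p, hp⟩ := hF loc out hloc
  obtain ⟨q, hq⟩ := hG loc (out + 1) fun i hi => (hloc i hi).trans (Nat.lt_succ_self _)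
  refine ⟨.seq (.seq p q) (ins out out (out + 1)), fun γ s hs => ?_⟩
  obtain ⟨s₁, r₁, a₁, v₁⟩ := hp γ s hs
  obtain ⟨s₂, r₂, a₂, v₂⟩ := hq γ s₁ (hs.of_agreesBelow hloc a₁)
  refine ⟨_, ((r₁.seq r₂).seq (hop _ _ _ _)).mono ?_,
    (a₁.trans (a₂.mono (Nat.le_succ out))).setReg le_rfl, ?_⟩
  · rw [a₁.mem]; exact mul_pow_add_mul_pow_add_le _ _ _ _ _ _
  · rw [State.setReg_reg, if_pos rfl, a₂.reg out (Nat.lt_succ_self _), v₁, v₂]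

theorem add {F G : Γ → ℕ} (hF : PolyTimeNat F) (hG : PolyTimeNat G) :
    PolyTimeNat fun γ => F γ + G γ :=
  binop (· + ·) .plus Runs.plus hF hG

theorem sub {F G : Γ → ℕ} (hF : PolyTimeNat F) (hG : PolyTimeNat G) :
    PolyTimeNat fun γ => F γ - G γ :=
  binop (· - ·) .monus Runs.monus hF hG

theorem ite_eq_zero {F G H : Γ → ℕ} (hF : PolyTimeNat F) (hG : PolyTimeNat G)
    (hH : PolyTimeNat H) : PolyTimeNat fun γ => if F γ = 0 then G γ else H γ := by
  obtain ⟨C₁, k₁, hF⟩ := hF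
  obtain ⟨C₂, k₂, hG⟩ := hG
  obtain ⟨C₃, k₃, hH⟩ := hH
  refine ⟨C₁ + (C₂ + C₃ + 1) + 0, k₁ + (k₂ + k₃), fun loc out hloc => ?_⟩
  obtain ⟨p, hp⟩ := hF loc out hloc
  obtain ⟨q, hq⟩ := hG loc out hloc
  obtain ⟨r, hr⟩ := hH loc out hloc
  refine ⟨.seq p (.ite out r q), fun γ s hs => ?_⟩
  obtain ⟨s₁, r₁, a₁, v₁⟩ := hp γ s hs
  have hs₁ := hs.of_agreesBelow hloc a₁
  have hb := mul_pow_add_mul_pow_add_le s.mem.bound C₁ (C₂ + C₃ + 1) k₁ (k₂ + k₃) 0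
  have hb' := mul_pow_add_mul_pow_add_le s.mem.bound C₂ C₃ k₂ k₃ 1
  by_cases h0 : F γ = 0
  · obtain ⟨s₂, r₂, a₂, v₂⟩ := hq γ s₁ hs₁
    rw [a₁.mem] at r₂
    exact ⟨s₂, (r₁.seq (r₂.ite_false (v₁.trans h0))).mono (by omega), a₁.trans a₂,
      by simp [h0, v₂]⟩
  · obtain ⟨s₂, r₂, a₂, v₂⟩ := hr γ s₁ hs₁
    rw [a₁.mem] at r₂
    exact ⟨s₂, (r₁.seq (r₂.ite_true (by rwa [v₁]))).mono (by omega), a₁.trans a₂,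
      by simp [h0, v₂]⟩

theorem cell (a : ℕ) {A : Γ → Mem} {F : Γ → ℕ} (hA : PolyTime A) (hF : PolyTimeNat F) :
    PolyTimeNat fun γ => (A γ).cell a (F γ) := by
  obtain ⟨C, k, hF⟩ := hF
  refine ⟨C + 1, k, fun loc out hloc => ?_⟩
  obtain ⟨p, hp⟩ := hF loc out hloc
  refine ⟨.seq p (.load out a out), fun γ s hs => ?_⟩
  obtain ⟨s₁, r₁, a₁, v₁⟩ := hp γ s hs
  refine ⟨_, (r₁.seq (Runs.load _ _ _ _)).mono (mul_pow_add_le _ _ _ _), a₁.setReg le_rfl, ?_⟩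
  have hmem : A γ = s₁.mem := (hA.1 γ _ hs.refersTo).trans a₁.mem.symm
  simp only [State.setReg_reg, if_true, v₁, hmem]
  rfl

theorem sum {A : Γ → Mem} {F : Γ → ℕ → ℕ} (hA : PolyTime A)
    (hF : PolyTimeNat fun p : Γ × ℕ => F p.1 p.2) :
    PolyTimeNat fun γ => ∑ i ∈ Finset.range (A γ).bound, F γ i := by
  obtain ⟨C, k, hF⟩ := hF
  refine ⟨C + 6, k + 1, fun loc out hloc => ?_⟩
  obtain ⟨p, hp⟩ := hF (fun i => if i < Storable.width Γ then loc i else out + 1) (out + 4) (by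
    intro i _
    split_ifs with h
    · exact (hloc i h).trans (by omega)
    · omega)
  refine ⟨forBelowBound out (.seq p (.plus out out (out + 4))), fun γ s hs => ?_⟩
  obtain ⟨s', r', hI⟩ := Runs.forBelowBound (z := out) (T := C * (s.mem.bound + 1) ^ k + 1)
    (body := .seq p (.plus out out (out + 4))) (s := s)
    (fun j σ => s.AgreesBelow out σ ∧ σ.reg out = ∑ i ∈ Finset.range j, F γ i)
    (fun h hσ => ⟨h.1.trans (hσ.mono (Nat.le_succ out)), by rw [hσ.reg out (by omega), h.2]⟩)
    ⟨(State.AgreesBelow.refl _ s).setReg le_rfl, by simp⟩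
    (by
      rintro j - σ ⟨hσ, hsum⟩ hj
      obtain ⟨σ', r', a', v'⟩ := hp (γ, j) σ ⟨⟨hσ.mem.symm ▸ hs.refersTo, trivial⟩, by
        intro i _
        dsimp only [Storable.entry]
        split_ifs with h
        · exact (hs.of_agreesBelow hloc hσ).reg i h
        · exact hj⟩
      rw [hσ.mem] at r'
      refine ⟨_, r'.seq (Runs.plus _ _ _ _), ⟨?_, ?_⟩, fun x hx hx' => ?_⟩
      · exact (hσ.trans (a'.mono (by omega))).setReg le_rfl
      · simp [Finset.sum_range_succ, v', a'.reg out (by omega), hsum]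
      · rw [State.setReg_reg, if_neg hx.ne', a'.reg x hx'])
  have hbound : (A γ).bound = s.mem.bound := congrArg Mem.bound (hA.1 γ _ hs.refersTo)
  refine ⟨s', r'.mono ?_, hI.1, by simp only [hI.2, hbound]⟩
  have := mul_mul_pow_add_le s.mem.bound C k 6
  nlinarith

theorem tuple {F : Γ → ℕ → ℕ} :
    ∀ {j : ℕ}, (∀ i < j, PolyTimeNat fun γ => F γ i) → PolyTimeTuple j F
  | 0, _ => ⟨1, 0, fun _ _ _ => ⟨.skip, fun _ s _ =>
      ⟨s, ⟨1, by simp, .skip s⟩, .refl _ s, fun _ hi => absurd hi (Nat.not_lt_zero _)⟩⟩⟩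
  | j + 1, h => by
    obtain ⟨C₁, k₁, h₁⟩ := tuple (j := j) fun i hi => h i (hi.trans (Nat.lt_succ_self j))
    obtain ⟨C₂, k₂, h₂⟩ := h j (Nat.lt_succ_self j)
    refine ⟨C₁ + C₂ + 0, k₁ + k₂, fun loc out hloc => ?_⟩
    obtain ⟨p, hp⟩ := h₁ loc out hloc
    obtain ⟨q, hq⟩ := h₂ loc (out + j) fun i hi => (hloc i hi).trans_le (by omega)
    refine ⟨.seq p q, fun γ s hs => ?_⟩
    obtain ⟨s₁, r₁, a₁, v₁⟩ := hp γ s hs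
    obtain ⟨s₂, r₂, a₂, v₂⟩ := hq γ s₁ (hs.of_agreesBelow hloc a₁)
    refine ⟨s₂, (r₁.seq r₂).mono ?_, a₁.trans (a₂.mono (by omega)), fun i hi => ?_⟩
    · rw [a₁.mem]; exact mul_pow_add_mul_pow_add_le _ _ _ _ _ 0
    · rcases Nat.lt_succ_iff_lt_or_eq.1 hi with h | rfl
      · rw [a₂.reg _ (by omega), v₁ i h]
      · exact v₂

theorem comp {F : Δ → ℕ} {σ : Γ → Δ} (hF : PolyTimeNat F) (hσ : PolyTime σ) :
    PolyTimeNat fun γ => F (σ γ) := by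
  obtain ⟨C₁, k₁, h₁⟩ := tuple hσ.2
  obtain ⟨C₂, k₂, h₂⟩ := hF
  refine ⟨C₁ + C₂ + 1, k₁ + k₂, fun loc out hloc => ?_⟩
  obtain ⟨p, hp⟩ := h₁ loc out hloc
  obtain ⟨q, hq⟩ := h₂ (fun i => out + i) (out + Storable.width Δ) fun i hi => by omega
  refine ⟨.seq (.seq p q) (.copy out (out + Storable.width Δ)), fun γ s hs => ?_⟩
  obtain ⟨s₁, r₁, a₁, v₁⟩ := hp γ s hs
  obtain ⟨s₂, r₂, a₂, v₂⟩ := hq (σ γ) s₁ ⟨by rw [a₁.mem]; exact hσ.1 _ _ hs.refersTo, v₁⟩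
  refine ⟨_, ((r₁.seq r₂).seq (Runs.copy _ _ _)).mono ?_,
    (a₁.trans (a₂.mono (by omega))).setReg le_rfl, by simp [v₂]⟩
  rw [a₁.mem]
  exact mul_pow_add_mul_pow_add_le _ _ _ _ _ _

end PolyTimeNat

/-- All numbers below `N` have the property `P`. Bounded quantifiers are definitions so that
`fun_prop` can recognize them. -/
def AllBelow (N : ℕ) (P : ℕ → Prop) : Prop := ∀ i < N, P i

/-- Some number below `N` has the property `P`. -/
def SomeBelow (N : ℕ) (P : ℕ → Prop) : Prop := ∃ i < N, P i

open Classical in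
/-- The number of `i < N` with the property `P`. -/
noncomputable def countBelow (N : ℕ) (P : ℕ → Prop) : ℕ := ((Finset.range N).filter P).card

namespace PolyTime

variable {Γ Δ Θ : Type} [Storable Γ] [Storable Δ] [Storable Θ]

theorem nat_iff {f : Γ → ℕ} : PolyTime f ↔ PolyTimeNat f :=
  ⟨fun h => h.2 0 Nat.zero_lt_one, fun h => ⟨fun _ _ _ => trivial, fun _ _ => h⟩⟩

open Classical in
theorem prop_iff {f : Γ → Prop} : PolyTime f ↔ PolyTimeNat fun γ => if f γ then 1 else 0 :=
  ⟨fun h => h.2 0 Nat.zero_lt_one, fun h => ⟨fun _ _ _ => trivial, fun _ _ => h⟩⟩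

@[fun_prop]
theorem id : PolyTime fun x : Γ => x := ⟨fun _ _ h => h, fun _ hi => PolyTimeNat.entry hi⟩

@[fun_prop]
theorem const (c : ℕ) : PolyTime fun _ : Γ => c := nat_iff.2 (PolyTimeNat.const c)

@[fun_prop]
theorem comp {f : Δ → Θ} {σ : Γ → Δ} (hf : PolyTime f) (hσ : PolyTime σ) :
    PolyTime fun x => f (σ x) :=
  ⟨fun _ _ h => hf.1 _ _ (hσ.1 _ _ h), fun i hi => PolyTimeNat.comp (hf.2 i hi) hσ⟩

@[fun_prop]
theorem fst {f : Γ → Δ × Θ} (hf : PolyTime f) : PolyTime fun x => (f x).1 := by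
  refine ⟨fun γ a h => (hf.1 _ _ h).1, fun i hi => ?_⟩
  have := hf.2 i (Nat.lt_add_right _ hi)
  dsimp only [Storable.entry] at this
  simpa only [hi, if_true] using this

@[fun_prop]
theorem snd {f : Γ → Δ × Θ} (hf : PolyTime f) : PolyTime fun x => (f x).2 := by
  refine ⟨fun γ a h => (hf.1 _ _ h).2, fun i hi => ?_⟩
  have := hf.2 (Storable.width Δ + i) (Nat.add_lt_add_left hi _)
  dsimp only [Storable.entry] at this
  simpa using this

theorem congr {f g : Γ → Δ} (hf : PolyTime f) (h : ∀ γ, g γ = f γ) : PolyTime g := by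
  rwa [show g = f from funext h]

theorem congr_iff {P Q : Γ → Prop} (hP : PolyTime P) (h : ∀ γ, Q γ ↔ P γ) : PolyTime Q :=
  hP.congr fun γ => propext (h γ)

@[fun_prop]
theorem add {f g : Γ → ℕ} (hf : PolyTime f) (hg : PolyTime g) : PolyTime fun x => f x + g x :=
  nat_iff.2 ((nat_iff.1 hf).add (nat_iff.1 hg))

@[fun_prop]
theorem sub {f g : Γ → ℕ} (hf : PolyTime f) (hg : PolyTime g) : PolyTime fun x => f x - g x :=
  nat_iff.2 ((nat_iff.1 hf).sub (nat_iff.1 hg))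

@[fun_prop]
theorem cell (a : ℕ) {A : Γ → Mem} {f : Γ → ℕ} (hA : PolyTime A) (hf : PolyTime f) :
    PolyTime fun x => (A x).cell a (f x) :=
  nat_iff.2 (PolyTimeNat.cell a hA (nat_iff.1 hf))

@[fun_prop]
theorem bound {A : Γ → Mem} (hA : PolyTime A) : PolyTime fun x => (A x).bound :=
  hA.cell 1 (const 0)

theorem eq_zero {f : Γ → ℕ} (hf : PolyTime f) : PolyTime fun x => f x = 0 :=
  prop_iff.2 (by
    convert (nat_iff.1 hf).ite_eq_zero (PolyTimeNat.const 1) (PolyTimeNat.const 0) using 3)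

open Classical in
theorem indicator {P : Γ → Prop} (hP : PolyTime P) : PolyTime fun x => if P x then 1 else 0 :=
  nat_iff.2 (prop_iff.1 hP)

@[fun_prop]
theorem le {f g : Γ → ℕ} (hf : PolyTime f) (hg : PolyTime g) : PolyTime fun x => f x ≤ g x :=
  (hf.sub hg).eq_zero.congr_iff fun γ => by omega

@[fun_prop]
theorem not {P : Γ → Prop} (hP : PolyTime P) : PolyTime fun x => ¬ P x :=
  hP.indicator.eq_zero.congr_iff fun γ => by simp

@[fun_prop]
theorem lt {f g : Γ → ℕ} (hf : PolyTime f) (hg : PolyTime g) : PolyTime fun x => f x < g x :=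
  (hg.le hf).not.congr_iff fun γ => by simp

@[fun_prop]
theorem and {P Q : Γ → Prop} (hP : PolyTime P) (hQ : PolyTime Q) :
    PolyTime fun x => P x ∧ Q x :=
  (hP.not.indicator.add hQ.not.indicator).eq_zero.congr_iff fun γ => by simp

@[fun_prop]
theorem or {P Q : Γ → Prop} (hP : PolyTime P) (hQ : PolyTime Q) : PolyTime fun x => P x ∨ Q x :=
  (hP.not.and hQ.not).not.congr_iff fun γ => by tauto

theorem imp {P Q : Γ → Prop} (hP : PolyTime P) (hQ : PolyTime Q) : PolyTime fun x => P x → Q x :=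
  (hP.not.or hQ).congr_iff fun γ => by tauto

@[fun_prop]
theorem iff {P Q : Γ → Prop} (hP : PolyTime P) (hQ : PolyTime Q) :
    PolyTime fun x => P x ↔ Q x :=
  ((hP.imp hQ).and (hQ.imp hP)).congr_iff fun γ => by tauto

@[fun_prop]
theorem eq {f g : Γ → ℕ} (hf : PolyTime f) (hg : PolyTime g) : PolyTime fun x => f x = g x :=
  ((hf.le hg).and (hg.le hf)).congr_iff fun γ => by omega

@[fun_prop]
theorem ite {P : Γ → Prop} [∀ x, Decidable (P x)] {f g : Γ → ℕ} (hP : PolyTime P)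
    (hf : PolyTime f) (hg : PolyTime g) : PolyTime fun x => if P x then f x else g x := by
  refine nat_iff.2 ?_
  convert (prop_iff.1 hP).ite_eq_zero (nat_iff.1 hg) (nat_iff.1 hf) using 2 with γ
  by_cases h : P γ <;> simp [h]

theorem sum {A : Γ → Mem} {f : Γ → ℕ → ℕ} (hA : PolyTime A)
    (hf : PolyTime fun p : Γ × ℕ => f p.1 p.2) :
    PolyTime fun x => ∑ i ∈ Finset.range (A x).bound, f x i :=
  nat_iff.2 (PolyTimeNat.sum hA (nat_iff.1 hf))

@[fun_prop]
theorem countBelow {A : Γ → Mem} {P : Γ → ℕ → Prop} (hA : PolyTime A)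
    (hP : PolyTime fun p : Γ × ℕ => P p.1 p.2) :
    PolyTime fun x => countBelow (A x).bound (P x) := by
  classical
  exact (sum (f := fun x i => if P x i then 1 else 0) hA hP.indicator).congr fun γ => by
    rw [RAM.countBelow, Finset.card_filter]

@[fun_prop]
theorem allBelow {A : Γ → Mem} {P : Γ → ℕ → Prop} (hA : PolyTime A)
    (hP : PolyTime fun p : Γ × ℕ => P p.1 p.2) : PolyTime fun x => AllBelow (A x).bound (P x) :=
  (countBelow (P := fun x i => ¬ P x i) hA hP.not).eq_zero.congr_iff fun γ => by
    simp [RAM.countBelow, AllBelow, Finset.filter_eq_empty_iff]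

@[fun_prop]
theorem someBelow {A : Γ → Mem} {P : Γ → ℕ → Prop} (hA : PolyTime A)
    (hP : PolyTime fun p : Γ × ℕ => P p.1 p.2) :
    PolyTime fun x => SomeBelow (A x).bound (P x) :=
  (allBelow (P := fun x i => ¬ P x i) hA hP.not).not.congr_iff fun γ => by
    simp [SomeBelow, AllBelow]

end PolyTime

/-! ### Transformations of the memory -/

/-- A transformation of the memory that does not lower the loop bound and is carried out by a
program in time polynomial in the final bound. -/
def PolyTimeTransform (T : Mem → Mem) : Prop :=
  (∀ A, A.bound ≤ (T A).bound) ∧ ∃ (C k : ℕ) (p : Prog), ∀ s : State, ∃ s',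
    Runs p s (C * ((T s.mem).bound + 1) ^ k) s' ∧ s'.mem = T s.mem

/-- Raise the loop bound. -/
def raiseBound (F : Mem → ℕ) (A : Mem) : Mem := A.set 1 0 (A.bound + F A)

theorem raiseBound_bound (F : Mem → ℕ) (A : Mem) : (raiseBound F A).bound = A.bound + F A := by
  rw [Mem.bound, raiseBound, Mem.set_cell, if_pos ⟨rfl, rfl⟩]

theorem raiseBound_cell_of_ne {b : ℕ} (h : b ≠ 1) (F : Mem → ℕ) (A : Mem) :
    (raiseBound F A).cell b = A.cell b := by
  funext j
  rw [raiseBound, Mem.set_cell, if_neg fun h' => h h'.1]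

/-- Write `F (A, i)` to the cell `i` of the array `a`, for `i = 0, ..., n - 1` in this order,
where `A` is the current memory, so that `F` sees the cells written before. -/
def fillTo (a : ℕ) (F : Mem × ℕ → ℕ) (A : Mem) : ℕ → Mem
  | 0 => A
  | i + 1 => (fillTo a F A i).set a i (F (fillTo a F A i, i))

/-- Fill the array `a` up to the loop bound. -/
def fill (a : ℕ) (F : Mem × ℕ → ℕ) (A : Mem) : Mem := fillTo a F A A.bound

section fill

variable {a b n m j : ℕ} {F : Mem × ℕ → ℕ} {A : Mem}

theorem fillTo_cell_of_ne (h : b ≠ a) : (fillTo a F A n).cell b = A.cell b := by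
  induction n with
  | zero => rfl
  | succ n ih => funext j; rw [fillTo, Mem.set_cell, if_neg (fun h' => h h'.1), ih]

theorem fillTo_cell_of_le (h : n ≤ j) : (fillTo a F A n).cell a j = A.cell a j := by
  induction n with
  | zero => rfl
  | succ n ih => rw [fillTo, Mem.set_cell, if_neg (fun h' => by omega), ih (by omega)]

theorem fillTo_cell_of_lt_of_le (hj : j < n) (h : n ≤ m) :
    (fillTo a F A m).cell a j = (fillTo a F A n).cell a j := by
  induction m, h using Nat.le_induction with
  | base => rfl
  | succ m h ih => rw [fillTo, Mem.set_cell, if_neg (fun h' => by omega), ih]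

theorem fillTo_cell (hj : j < n) : (fillTo a F A n).cell a j = F (fillTo a F A j, j) := by
  rw [fillTo_cell_of_lt_of_le (Nat.lt_succ_self j) hj, fillTo, Mem.set_cell, if_pos ⟨rfl, rfl⟩]

theorem fillTo_bound (ha : a ≠ 1) : (fillTo a F A n).bound = A.bound :=
  congrFun (fillTo_cell_of_ne ha.symm) 0

theorem fill_cell_of_ne (h : b ≠ a) : (fill a F A).cell b = A.cell b := fillTo_cell_of_ne h

theorem fill_bound (ha : a ≠ 1) : (fill a F A).bound = A.bound := fillTo_bound ha

end fill

namespace PolyTimeTransform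

theorem comp {T U : Mem → Mem} (hU : PolyTimeTransform U) (hT : PolyTimeTransform T) :
    PolyTimeTransform fun A => U (T A) := by
  obtain ⟨bT, C₁, k₁, p, hp⟩ := hT
  obtain ⟨bU, C₂, k₂, q, hq⟩ := hU
  refine ⟨fun A => (bT A).trans (bU _), C₁ + C₂ + 0, k₁ + k₂, .seq p q, fun s => ?_⟩
  obtain ⟨s₁, r₁, a₁⟩ := hp s
  obtain ⟨s₂, r₂, a₂⟩ := hq s₁
  rw [a₁] at r₂ a₂
  refine ⟨s₂, (r₁.seq r₂).mono ?_, a₂⟩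
  calc C₁ * ((T s.mem).bound + 1) ^ k₁ + C₂ * ((U (T s.mem)).bound + 1) ^ k₂
      ≤ C₁ * ((U (T s.mem)).bound + 1) ^ k₁ + C₂ * ((U (T s.mem)).bound + 1) ^ k₂ := by
        gcongr
        exact bU _
    _ ≤ _ := mul_pow_add_mul_pow_add_le _ _ _ _ _ 0

theorem raiseBound {F : Mem → ℕ} (hF : PolyTime F) : PolyTimeTransform (raiseBound F) := by
  have hF' : PolyTime fun A : Mem => A.bound + F A := by fun_prop
  obtain ⟨C, k, h⟩ := PolyTime.nat_iff.1 hF'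
  obtain ⟨p, hp⟩ := h (fun _ => 0) 0 fun i hi => absurd hi (Nat.not_lt_zero i)
  have hb (A : Mem) : A.bound ≤ (RAM.raiseBound F A).bound := by
    rw [raiseBound_bound]
    exact Nat.le_add_right _ _
  refine ⟨hb, C + 2, k, .seq p (.seq (.const 1 0) (.store 1 1 0)), fun s => ?_⟩
  obtain ⟨s₁, r₁, a₁, v₁⟩ := hp s.mem s ⟨rfl, fun i hi => absurd hi (Nat.not_lt_zero i)⟩
  refine ⟨_, (r₁.seq ((Runs.const _ _ _).seq (Runs.store _ _ _ _))).mono ?_, ?_⟩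
  · calc C * (s.mem.bound + 1) ^ k + 2 ≤ (C + 2) * (s.mem.bound + 1) ^ k :=
          mul_pow_add_le _ _ _ _
      _ ≤ _ := by gcongr; exact hb _
  · simp [RAM.raiseBound, State.setArr_mem, v₁, a₁.mem]

theorem fill {a : ℕ} (ha : a ≠ 1) {F : Mem × ℕ → ℕ} (hF : PolyTime F) :
    PolyTimeTransform (fill a F) := by
  obtain ⟨C, k, h⟩ := PolyTime.nat_iff.1 hF
  obtain ⟨p, hp⟩ := h (fun _ => 1) 4 fun i _ => by omega
  refine ⟨fun A => (fill_bound ha).ge, C + 6, k + 1, forBelowBound 0 (.seq p (.store a 1 4)),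
    fun s => ?_⟩
  obtain ⟨s', r', hI⟩ := Runs.forBelowBound (z := 0) (T := C * (s.mem.bound + 1) ^ k + 1)
    (body := .seq p (.store a 1 4)) (s := s) (fun j σ => σ.mem = fillTo a F s.mem j)
    (fun h hσ => hσ.mem.trans h) rfl
    (by
      intro j _ σ hσ hj
      obtain ⟨σ', r', a', v'⟩ := hp (fillTo a F s.mem j, j) σ
        ⟨⟨hσ.symm, trivial⟩, fun i _ => by simpa [Storable.entry, Storable.width] using hj⟩
      rw [hσ, fillTo_bound ha] at r'
      refine ⟨_, r'.seq (Runs.store _ _ _ _), ?_, fun x _ hx => by simp [a'.reg x hx]⟩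
      rw [State.setArr_mem, v', a'.reg 1 (by omega), hj, a'.mem, hσ, fillTo])
  refine ⟨s', r'.mono ?_, hI⟩
  rw [fill_bound ha]
  have := mul_mul_pow_add_le s.mem.bound C k 6
  nlinarith

theorem exists_decider {T : Mem → Mem} {P : Mem → Prop} (hT : PolyTimeTransform T)
    (hP : PolyTime P) :
    ∃ (C k : ℕ) (p : Prog), ∀ s : State, ∃ s',
      Runs p s (C * ((T s.mem).bound + 1) ^ k) s' ∧ (P (T s.mem) → s'.reg 0 = 1) ∧
        (¬ P (T s.mem) → s'.reg 0 = 0) := by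
  obtain ⟨-, C₁, k₁, q, hq⟩ := hT
  obtain ⟨C, k, h⟩ := PolyTime.prop_iff.1 hP
  obtain ⟨p, hp⟩ := h (fun _ => 0) 0 fun i hi => absurd hi (Nat.not_lt_zero i)
  refine ⟨C₁ + C + 0, k₁ + k, .seq q p, fun s => ?_⟩
  obtain ⟨s₁, r₁, a₁⟩ := hq s
  obtain ⟨s₂, r₂, -, v₂⟩ := hp (T s.mem) s₁
    ⟨a₁.symm, fun i hi => absurd hi (Nat.not_lt_zero i)⟩
  rw [a₁] at r₂
  exact ⟨s₂, (r₁.seq r₂).mono (mul_pow_add_mul_pow_add_le _ _ _ _ _ 0),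
    fun h => by simp [v₂, h], fun h => by simp [v₂, h]⟩

end PolyTimeTransform

end RAM
open RAM Finset

/-! ### Positions in a finite linear order -/

section position

variable {α β : Type*} [LinearOrder β]

open Classical in
/-- The number of elements of `X` with a smaller key. -/
noncomputable def keyPos (X : Finset α) (key : α → β) (x : α) : ℕ :=
  #{w ∈ X | key w < key x}

theorem keyPos_lt_keyPos {X : Finset α} {key : α → β} {x y : α} (hx : x ∈ X)
    (h : key x < key y) : keyPos X key x < keyPos X key y := by
  classical
  refine card_lt_card ⟨fun w hw => ?_, fun hsub => ?_⟩
  · simp only [mem_filter] at hw ⊢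
    exact ⟨hw.1, hw.2.trans h⟩
  · have := hsub (mem_filter.2 ⟨hx, h⟩)
    simp at this

theorem keyPos_injOn {X : Finset α} {key : α → β} (hk : Set.InjOn key X) :
    Set.InjOn (keyPos X key) X := by
  intro x hx y hy h
  rcases lt_trichotomy (key x) (key y) with h' | h' | h'
  · exact absurd h (keyPos_lt_keyPos hx h').ne
  · exact hk hx hy h'
  · exact absurd h (keyPos_lt_keyPos hy h').ne'

theorem keyPos_lt_card {X : Finset α} {key : α → β} {x : α} (hx : x ∈ X) :
    keyPos X key x < #X := by
  classical
  refine card_lt_card ⟨filter_subset _ _, fun hsub => ?_⟩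
  have := hsub hx
  simp at this

theorem exists_keyPos_eq {X : Finset α} {key : α → β} (hk : Set.InjOn key X) {t : ℕ}
    (ht : t < #X) : ∃ x ∈ X, keyPos X key x = t := by
  classical
  have h : X.image (keyPos X key) = range #X := by
    refine eq_of_subset_of_card_le (fun i hi => ?_) ?_
    · obtain ⟨x, hx, rfl⟩ := mem_image.1 hi
      exact mem_range.2 (keyPos_lt_card hx)
    · rw [card_image_of_injOn (keyPos_injOn hk), card_range]
  have := h ▸ mem_range.2 ht
  simpa using this

open Classical in
theorem card_keyPos_lt {X : Finset α} {key : α → β} (hk : Set.InjOn key X) (k : ℕ) :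
    #{x ∈ X | keyPos X key x < k} = min #X k := by
  have h : ({x ∈ X | keyPos X key x < k}).image (keyPos X key) = range (min #X k) := by
    ext i
    simp only [mem_image, mem_filter, mem_range, lt_min_iff]
    constructor
    · rintro ⟨x, ⟨hx, hk'⟩, rfl⟩
      exact ⟨keyPos_lt_card hx, hk'⟩
    · rintro ⟨hi, hk'⟩
      obtain ⟨x, hx, rfl⟩ := exists_keyPos_eq hk hi
      exact ⟨x, ⟨hx, hk'⟩, rfl⟩
  rw [← card_range (min #X k), ← h, card_image_of_injOn]
  exact (keyPos_injOn hk).mono fun x hx => (mem_filter.1 hx).1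

end position

theorem countBelow_lt_countBelow {N : ℕ} {P Q : ℕ → Prop} {w : ℕ} (hPQ : ∀ v, P v → Q v)
    (hw : w < N) (hQ : Q w) (hP : ¬ P w) : countBelow N P < countBelow N Q := by
  classical
  refine card_lt_card ⟨fun v hv => ?_, fun hsub => ?_⟩
  · obtain ⟨h₁, h₂⟩ := mem_filter.1 hv
    exact mem_filter.2 ⟨h₁, hPQ v h₂⟩
  · exact hP (mem_filter.1 (hsub (mem_filter.2 ⟨mem_range.2 hw, hQ⟩))).2

/-! ### Graphs on initial segments of the natural numbers with a twin cover -/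

/-- A graph on the vertices `0, ..., n - 1` together with a set of vertices, without any laws. Such
graphs are read off the memory of the machine. -/
structure CoverGraph where
  n : ℕ
  Adj : ℕ → ℕ → Prop
  cover : ℕ → Prop

namespace CoverGraph

/-- The adjacency relation is that of a simple graph and `cover` is a twin cover of it. -/
structure IsTwinCovered (G : CoverGraph) : Prop where
  symm : ∀ {u v}, G.Adj u v → G.Adj v u
  irrefl : ∀ u, ¬ G.Adj u u
  lt : ∀ {u v}, G.Adj u v → u < G.n
  cover_lt : ∀ {u}, G.cover u → u < G.n
  twin : ∀ {u v w}, ¬ G.cover u → ¬ G.cover v → G.Adj u v → w ≠ u → w ≠ v → (G.Adj u w ↔ G.Adj v w)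

/-- `u` and `v` are in the same clique outside the twin cover. -/
def SameClique (G : CoverGraph) (u v : ℕ) : Prop :=
  u < G.n ∧ v < G.n ∧ ¬ G.cover u ∧ ¬ G.cover v ∧ (u = v ∨ G.Adj u v)

variable {G : CoverGraph}

theorem sameClique_refl {u : ℕ} (h : u < G.n) (hS : ¬ G.cover u) : G.SameClique u u :=
  ⟨h, h, hS, hS, .inl rfl⟩

theorem SameClique.symm (hG : G.IsTwinCovered) {u v : ℕ} (h : G.SameClique u v) :
    G.SameClique v u :=
  ⟨h.2.1, h.1, h.2.2.2.1, h.2.2.1, h.2.2.2.2.imp Eq.symm hG.symm⟩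

theorem SameClique.trans (hG : G.IsTwinCovered) {u v w : ℕ} (h : G.SameClique u v)
    (h' : G.SameClique v w) : G.SameClique u w := by
  obtain ⟨hu, hv, su, sv, rfl | huv⟩ := h
  · exact h'
  obtain ⟨-, hw, -, sw, rfl | hvw⟩ := h'
  · exact ⟨hu, hv, su, sv, .inr huv⟩
  refine ⟨hu, hw, su, sw, ?_⟩
  by_cases e : u = w
  · exact .inl e
  refine .inr ((hG.twin su sv huv (Ne.symm e) ?_).2 hvw)
  rintro rfl
  exact hG.irrefl _ hvw

theorem SameClique.adj_iff (hG : G.IsTwinCovered) {u v w : ℕ} (h : G.SameClique u v) (hu : w ≠ u)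
    (hv : w ≠ v) : G.Adj u w ↔ G.Adj v w := by
  obtain ⟨-, -, su, sv, rfl | huv⟩ := h
  · rfl
  · exact hG.twin su sv huv hu hv

theorem adj_of_sameClique {u v : ℕ} (h : G.SameClique u v) (hne : u ≠ v) : G.Adj u v :=
  h.2.2.2.2.resolve_left hne

theorem sameClique_of_adj (hG : G.IsTwinCovered) {u v : ℕ} (h : G.Adj u v) (hu : ¬ G.cover u)
    (hv : ¬ G.cover v) : G.SameClique u v := ⟨hG.lt h, hG.lt (hG.symm h), hu, hv, .inr h⟩

/-! ### One side of a partial isomorphism -/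

section side

variable (G : CoverGraph) (I : Finset ℕ) (e : ℕ → ℕ)

open Classical in
/-- The remaining vertices outside the twin cover, when the vertices `e x` with `x ∈ I` are taken
out of the graph. -/
noncomputable def residual : Finset ℕ := {u ∈ range G.n | ¬ G.cover u ∧ u ∉ I.image e}

open Classical in
/-- The indices of the neighbours of `u` among the vertices taken out. -/
noncomputable def profile (u : ℕ) : Finset ℕ := {x ∈ I | G.Adj u (e x)}

open Classical in
/-- The remaining part of the clique of `u`. -/
noncomputable def residualClique (u : ℕ) : Finset ℕ := {v ∈ G.residual I e | G.SameClique u v}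

open Classical in
/-- The position of `u` in the remaining part of its clique. -/
noncomputable def residualRank (u : ℕ) : ℕ := keyPos (G.residualClique I e u) id u

/-- The label of a vertex consists of its profile and its rank in its clique; an optimal extension
of a partial isomorphism matches vertices with equal labels. -/
noncomputable def label (u : ℕ) : Finset ℕ × ℕ := (G.profile I e u, G.residualRank I e u)

open Classical in
/-- The remaining vertices with the label `l`. -/
noncomputable def labelClass (l : Finset ℕ × ℕ) : Finset ℕ :=
  {u ∈ G.residual I e | G.label I e u = l}

variable {G I e}

theorem mem_residual {u : ℕ} : u ∈ G.residual I e ↔ u < G.n ∧ ¬ G.cover u ∧ ∀ x ∈ I, e x ≠ u := by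
  simp [residual]

theorem mem_profile {u x : ℕ} : x ∈ G.profile I e u ↔ x ∈ I ∧ G.Adj u (e x) := by
  simp [profile]

theorem mem_residualClique {u v : ℕ} :
    v ∈ G.residualClique I e u ↔ v ∈ G.residual I e ∧ G.SameClique u v := by
  simp [residualClique]

theorem mem_labelClass {u : ℕ} {l : Finset ℕ × ℕ} :
    u ∈ G.labelClass I e l ↔ u ∈ G.residual I e ∧ G.label I e u = l := by
  simp [labelClass]

theorem sameClique_self_of_mem_residual {u : ℕ} (h : u ∈ G.residual I e) : G.SameClique u u :=
  sameClique_refl (mem_residual.1 h).1 (mem_residual.1 h).2.1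

theorem mem_residualClique_self {u : ℕ} (h : u ∈ G.residual I e) : u ∈ G.residualClique I e u :=
  mem_residualClique.2 ⟨h, sameClique_self_of_mem_residual h⟩

theorem profile_eq_of_sameClique (hG : G.IsTwinCovered) {u v : ℕ} (hu : u ∈ G.residual I e)
    (hv : v ∈ G.residual I e) (h : G.SameClique u v) : G.profile I e u = G.profile I e v := by
  ext x
  simp only [mem_profile]
  refine and_congr_right fun hx => ?_
  exact h.adj_iff hG ((mem_residual.1 hu).2.2 x hx) ((mem_residual.1 hv).2.2 x hx)

theorem residualClique_eq_of_sameClique (hG : G.IsTwinCovered) {u v : ℕ} (h : G.SameClique u v) :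
    G.residualClique I e u = G.residualClique I e v := by
  ext x
  simp only [mem_residualClique]
  exact and_congr_right fun _ => ⟨fun h' => (h.symm hG).trans hG h', fun h' => h.trans hG h'⟩

theorem card_residualClique_le (u : ℕ) : #(G.residualClique I e u) ≤ G.n := by
  conv_rhs => rw [← card_range G.n]
  exact card_le_card fun v hv => mem_range.2 (mem_residual.1 (mem_residualClique.1 hv).1).1

theorem residualRank_lt {u : ℕ} (h : u ∈ G.residual I e) :
    G.residualRank I e u < #(G.residualClique I e u) :=
  keyPos_lt_card (mem_residualClique_self h)

theorem residualRank_lt_n {u : ℕ} (h : u ∈ G.residual I e) : G.residualRank I e u < G.n :=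
  (residualRank_lt h).trans_le (card_residualClique_le u)

theorem residualRank_inj (hG : G.IsTwinCovered) {u v : ℕ} (hu : u ∈ G.residual I e)
    (hv : v ∈ G.residual I e) (h : G.SameClique u v)
    (hr : G.residualRank I e u = G.residualRank I e v) : u = v := by
  refine keyPos_injOn (X := G.residualClique I e u) (key := id) Function.injective_id.injOn
    (mem_residualClique_self hu) (mem_residualClique.2 ⟨hv, h⟩) ?_
  rw [residualRank, residualRank, ← residualClique_eq_of_sameClique hG h] at hr
  exact hr

theorem exists_residualRank_eq (hG : G.IsTwinCovered) {u t : ℕ}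
    (ht : t < #(G.residualClique I e u)) :
    ∃ v ∈ G.residual I e, G.SameClique u v ∧ G.residualRank I e v = t := by
  obtain ⟨v, hv, h⟩ := exists_keyPos_eq (X := G.residualClique I e u) (key := id)
    Function.injective_id.injOn ht
  obtain ⟨hr, hs⟩ := mem_residualClique.1 hv
  exact ⟨v, hr, hs, by rw [residualRank, ← residualClique_eq_of_sameClique hG hs, h]⟩

/-- The key by which the cliques are ordered by decreasing remaining size, with ties broken by the
least vertex. -/
noncomputable def cliqueKey (G : CoverGraph) (I : Finset ℕ) (e : ℕ → ℕ) (u : ℕ) : ℕ ×ₗ ℕ :=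
  toLex (G.n - #(G.residualClique I e u), sInf {v | v ∈ G.residualClique I e u})

theorem cliqueKey_eq_of_sameClique (hG : G.IsTwinCovered) {u v : ℕ} (h : G.SameClique u v) :
    G.cliqueKey I e u = G.cliqueKey I e v := by
  rw [cliqueKey, cliqueKey, residualClique_eq_of_sameClique hG h]

theorem sameClique_of_cliqueKey_eq (hG : G.IsTwinCovered) {u v : ℕ} (hu : u ∈ G.residual I e)
    (hv : v ∈ G.residual I e) (h : G.cliqueKey I e u = G.cliqueKey I e v) : G.SameClique u v := by
  have h₂ : sInf {w | w ∈ G.residualClique I e u} = sInf {w | w ∈ G.residualClique I e v} := by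
    have := congrArg (fun x => (ofLex x).2) h
    exact this
  have hu' := Nat.sInf_mem (s := {w | w ∈ G.residualClique I e u}) ⟨u, mem_residualClique_self hu⟩
  have hv' := Nat.sInf_mem (s := {w | w ∈ G.residualClique I e v}) ⟨v, mem_residualClique_self hv⟩
  rw [← h₂] at hv'
  exact (mem_residualClique.1 hu').2.trans hG ((mem_residualClique.1 hv').2.symm hG)

theorem card_residualClique_le_of_cliqueKey_lt {u v : ℕ}
    (h : G.cliqueKey I e u < G.cliqueKey I e v) :
    #(G.residualClique I e v) ≤ #(G.residualClique I e u) := by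
  have h₁ := card_residualClique_le (G := G) (I := I) (e := e) u
  have h₂ := card_residualClique_le (G := G) (I := I) (e := e) v
  rcases Prod.Lex.toLex_lt_toLex.1 h with h | h
  · simp only at h; omega
  · simp only at h; omega

theorem cliqueKey_injOn (hG : G.IsTwinCovered) (l : Finset ℕ × ℕ) :
    Set.InjOn (G.cliqueKey I e) (G.labelClass I e l) := by
  intro u hu v hv h
  obtain ⟨hu, hl⟩ := mem_labelClass.1 (mem_coe.1 hu)
  obtain ⟨hv, hl'⟩ := mem_labelClass.1 (mem_coe.1 hv)
  exact residualRank_inj hG hu hv (sameClique_of_cliqueKey_eq hG hu hv h)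
    (congrArg Prod.snd (hl.trans hl'.symm))

/-- The position of `u` among the vertices with the same label. -/
noncomputable def labelPos (G : CoverGraph) (I : Finset ℕ) (e : ℕ → ℕ) (u : ℕ) : ℕ :=
  keyPos (G.labelClass I e (G.label I e u)) (G.cliqueKey I e) u

theorem labelPos_le_of_sameClique (hG : G.IsTwinCovered) {u v : ℕ} (hu : u ∈ G.residual I e)
    (hv : v ∈ G.residual I e) (h : G.SameClique u v) : G.labelPos I e u ≤ G.labelPos I e v := by
  classical
  have key : ∀ w ∈ ({w ∈ G.labelClass I e (G.label I e u) | G.cliqueKey I e w < G.cliqueKey I e u}),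
      ∃ w' ∈ G.residual I e, G.SameClique w w' ∧ G.residualRank I e w' = G.residualRank I e v := by
    intro w hw
    obtain ⟨-, hk⟩ := mem_filter.1 hw
    refine exists_residualRank_eq hG ((residualRank_lt hv).trans_le ?_)
    rw [← residualClique_eq_of_sameClique hG h]
    exact card_residualClique_le_of_cliqueKey_lt hk
  choose! m hm hs hr using key
  rw [labelPos, labelPos, keyPos, keyPos]
  refine card_le_card_of_injOn m (fun w hw => ?_) fun w hw w' hw' hww => ?_
  · have hw := mem_coe.1 hw
    obtain ⟨hl, hk⟩ := mem_filter.1 hw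
    obtain ⟨hwr, hl⟩ := mem_labelClass.1 hl
    refine mem_coe.2 (mem_filter.2 ⟨mem_labelClass.2 ⟨hm w hw, ?_⟩, ?_⟩)
    · refine Prod.ext ?_ (hr w hw)
      change G.profile I e (m w) = G.profile I e v
      rw [← profile_eq_of_sameClique hG hwr (hm w hw) (hs w hw),
        ← profile_eq_of_sameClique hG hu hv h]
      exact congrArg Prod.fst hl
    · rwa [← cliqueKey_eq_of_sameClique hG (hs w hw), ← cliqueKey_eq_of_sameClique hG h]
  · have hw := mem_coe.1 hw
    have hw' := mem_coe.1 hw'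
    have h₁ := mem_labelClass.1 (mem_filter.1 hw).1
    have h₂ := mem_labelClass.1 (mem_filter.1 hw').1
    refine residualRank_inj hG h₁.1 h₂.1 ?_ (congrArg Prod.snd (h₁.2.trans h₂.2.symm))
    exact (hs w hw).trans hG (hww ▸ (hs w' hw').symm hG)

theorem labelPos_eq_of_sameClique (hG : G.IsTwinCovered) {u v : ℕ} (hu : u ∈ G.residual I e)
    (hv : v ∈ G.residual I e) (h : G.SameClique u v) : G.labelPos I e u = G.labelPos I e v :=
  (labelPos_le_of_sameClique hG hu hv h).antisymm (labelPos_le_of_sameClique hG hv hu (h.symm hG))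

theorem labelPos_inj (hG : G.IsTwinCovered) {u v : ℕ} (hu : u ∈ G.residual I e)
    (hv : v ∈ G.residual I e) (hl : G.label I e u = G.label I e v)
    (h : G.labelPos I e u = G.labelPos I e v) : u = v := by
  rw [labelPos, labelPos, ← hl] at h
  exact keyPos_injOn (cliqueKey_injOn hG _) (mem_labelClass.2 ⟨hu, rfl⟩)
    (mem_labelClass.2 ⟨hv, hl.symm⟩) h

theorem sameClique_of_profile_eq_of_labelPos_eq (hG : G.IsTwinCovered) {u v : ℕ}
    (hu : u ∈ G.residual I e) (hv : v ∈ G.residual I e) (hp : G.profile I e u = G.profile I e v)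
    (h : G.labelPos I e u = G.labelPos I e v) : G.SameClique u v := by
  suffices H : ∀ {u v : ℕ}, u ∈ G.residual I e → v ∈ G.residual I e →
      G.profile I e u = G.profile I e v → G.labelPos I e u = G.labelPos I e v →
      G.residualRank I e u ≤ G.residualRank I e v → G.SameClique u v by
    rcases le_total (G.residualRank I e u) (G.residualRank I e v) with h' | h'
    · exact H hu hv hp h h'
    · exact (H hv hu hp.symm h.symm h').symm hG
  intro u v hu hv hp h hle
  obtain ⟨w, hw, hs, hr⟩ := exists_residualRank_eq hG (hle.trans_lt (residualRank_lt hv))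
  obtain rfl : u = w := by
    refine labelPos_inj hG hu hw (Prod.ext ?_ hr.symm) ?_
    · exact hp.trans (profile_eq_of_sameClique hG hv hw hs)
    · exact h.trans (labelPos_eq_of_sameClique hG hv hw hs)
  exact hs.symm hG

end side

/-! ### Partial isomorphisms -/

section partialIso

/-- A partial isomorphism between the two graphs: a common induced subgraph. -/
def IsPartialIso (G H : CoverGraph) (φ : Finset (ℕ × ℕ)) : Prop :=
  (∀ p ∈ φ, p.1 < G.n ∧ p.2 < H.n) ∧
    ∀ p ∈ φ, ∀ q ∈ φ, (p.1 = q.1 ↔ p.2 = q.2) ∧ (G.Adj p.1 q.1 ↔ H.Adj p.2 q.2)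

/-- The partial function `f` on `I` as a set of pairs. -/
def mapGraph (I : Finset ℕ) (f : ℕ → ℕ) : Finset (ℕ × ℕ) := I.image fun x => (x, f x)

theorem mem_mapGraph {I : Finset ℕ} {f : ℕ → ℕ} {p : ℕ × ℕ} :
    p ∈ mapGraph I f ↔ p.1 ∈ I ∧ p.2 = f p.1 := by
  simp only [mapGraph, mem_image]
  constructor
  · rintro ⟨x, hx, rfl⟩
    exact ⟨hx, rfl⟩
  · rintro ⟨hx, h⟩
    exact ⟨p.1, hx, Prod.ext rfl h.symm⟩

theorem card_mapGraph (I : Finset ℕ) (f : ℕ → ℕ) : #(mapGraph I f) = #I :=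
  card_image_of_injective _ fun _ _ h => congrArg Prod.fst h

/-- The maximum size of an extension by vertices outside the twin covers. -/
noncomputable def extensionValue (G H : CoverGraph) (I : Finset ℕ) (f : ℕ → ℕ) : ℕ :=
  ∑ l ∈ I.powerset ×ˢ range G.n, min #(G.labelClass I id l) #(H.labelClass I f l)

variable {G H : CoverGraph} {I : Finset ℕ} {f : ℕ → ℕ}

theorem label_mem {u : ℕ} (hu : u ∈ G.residual I f) : G.label I f u ∈ I.powerset ×ˢ range G.n := by
  simp only [mem_product, mem_powerset, mem_range, label]
  exact ⟨fun x hx => (mem_profile.1 hx).1, residualRank_lt_n hu⟩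

theorem adj_of_label_eq_of_labelPos_eq (hG : G.IsTwinCovered) (hH : H.IsTwinCovered)
    {e : ℕ → ℕ} {u v u' v' : ℕ} (hu : u ∈ G.residual I e) (hv : v ∈ G.residual I e)
    (hu' : u' ∈ H.residual I f)
    (hv' : v' ∈ H.residual I f) (hul : G.label I e u = H.label I f u')
    (hvl : G.label I e v = H.label I f v') (hup : G.labelPos I e u = H.labelPos I f u')
    (hvp : G.labelPos I e v = H.labelPos I f v') (h : G.Adj u v) : H.Adj u' v' := by
  have hs := sameClique_of_adj hG h (mem_residual.1 hu).2.1 (mem_residual.1 hv).2.1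
  have hprofile : H.profile I f u' = H.profile I f v' :=
    (congrArg Prod.fst hul).symm.trans
      ((profile_eq_of_sameClique hG hu hv hs).trans (congrArg Prod.fst hvl))
  have hpos : H.labelPos I f u' = H.labelPos I f v' := by
    rw [← hup, ← hvp, labelPos_eq_of_sameClique hG hu hv hs]
  refine adj_of_sameClique (sameClique_of_profile_eq_of_labelPos_eq hH hu' hv' hprofile hpos) ?_
  rintro rfl
  obtain rfl : u = v := labelPos_inj hG hu hv (hul.trans hvl.symm) (hup.trans hvp.symm)
  exact hG.irrefl _ h

open Classical in
/-- The matching of the remaining vertices of the two graphs with equal labels and equal positions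
among the vertices with that label. It is an optimal extension of `mapGraph I f`. -/
noncomputable def labelMatching (G H : CoverGraph) (I : Finset ℕ) (f : ℕ → ℕ) : Finset (ℕ × ℕ) :=
  {p ∈ G.residual I id ×ˢ H.residual I f |
    G.label I id p.1 = H.label I f p.2 ∧ G.labelPos I id p.1 = H.labelPos I f p.2}

theorem mem_labelMatching {p : ℕ × ℕ} : p ∈ labelMatching G H I f ↔
    p.1 ∈ G.residual I id ∧ p.2 ∈ H.residual I f ∧
      G.label I id p.1 = H.label I f p.2 ∧ G.labelPos I id p.1 = H.labelPos I f p.2 := by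
  simp [labelMatching, and_assoc]

theorem labelMatching_compatible (hG : G.IsTwinCovered) (hH : H.IsTwinCovered) {p q : ℕ × ℕ}
    (hp : p ∈ labelMatching G H I f) (hq : q ∈ labelMatching G H I f) :
    (p.1 = q.1 ↔ p.2 = q.2) ∧ (G.Adj p.1 q.1 ↔ H.Adj p.2 q.2) := by
  obtain ⟨p₁, p₂, pl, pp⟩ := mem_labelMatching.1 hp
  obtain ⟨q₁, q₂, ql, qp⟩ := mem_labelMatching.1 hq
  refine ⟨⟨fun h => ?_, fun h => ?_⟩,
    adj_of_label_eq_of_labelPos_eq hG hH p₁ q₁ p₂ q₂ pl ql pp qp,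
    adj_of_label_eq_of_labelPos_eq hH hG p₂ q₂ p₁ q₁ pl.symm ql.symm pp.symm qp.symm⟩
  · exact labelPos_inj hH p₂ q₂ (by rw [← pl, ← ql, h]) (by rw [← pp, ← qp, h])
  · exact labelPos_inj hG p₁ q₁ (by rw [pl, ql, h]) (by rw [pp, qp, h])

theorem mapGraph_labelMatching_compatible (hG : G.IsTwinCovered) (hH : H.IsTwinCovered)
    {p q : ℕ × ℕ} (hp : p ∈ mapGraph I f) (hq : q ∈ labelMatching G H I f) :
    p.1 ≠ q.1 ∧ p.2 ≠ q.2 ∧ (G.Adj p.1 q.1 ↔ H.Adj p.2 q.2) := by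
  obtain ⟨hx, hy⟩ := mem_mapGraph.1 hp
  obtain ⟨h₁, h₂, hl, -⟩ := mem_labelMatching.1 hq
  refine ⟨(mem_residual.1 h₁).2.2 _ hx, hy ▸ (mem_residual.1 h₂).2.2 _ hx, ?_⟩
  have hprofile : G.profile I id q.1 = H.profile I f q.2 := congrArg Prod.fst hl
  have hmem : p.1 ∈ G.profile I id q.1 ↔ p.1 ∈ H.profile I f q.2 := by rw [hprofile]
  simp only [mem_profile, hx, true_and, id] at hmem
  rw [hy]
  exact ⟨fun h => hH.symm (hmem.1 (hG.symm h)), fun h => hG.symm (hmem.2 (hH.symm h))⟩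

theorem isPartialIso_mapGraph_union_labelMatching (hG : G.IsTwinCovered) (hH : H.IsTwinCovered)
    (hI : IsPartialIso G H (mapGraph I f)) :
    IsPartialIso G H (mapGraph I f ∪ labelMatching G H I f) := by
  refine ⟨fun p hp => ?_, fun p hp q hq => ?_⟩
  · rcases mem_union.1 hp with hp | hp
    · exact hI.1 p hp
    · obtain ⟨h₁, h₂, -⟩ := mem_labelMatching.1 hp
      exact ⟨(mem_residual.1 h₁).1, (mem_residual.1 h₂).1⟩
  · rcases mem_union.1 hp with hp | hp <;> rcases mem_union.1 hq with hq | hq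
    · exact hI.2 p hp q hq
    · obtain ⟨h₁, h₂, h₃⟩ := mapGraph_labelMatching_compatible hG hH hp hq
      exact ⟨iff_of_false h₁ h₂, h₃⟩
    · obtain ⟨h₁, h₂, h₃⟩ := mapGraph_labelMatching_compatible hG hH hq hp
      refine ⟨iff_of_false h₁.symm h₂.symm, ?_⟩
      exact ⟨fun h => hH.symm (h₃.1 (hG.symm h)), fun h => hG.symm (h₃.2 (hH.symm h))⟩
    · exact labelMatching_compatible hG hH hp hq

theorem extensionValue_le_card_labelMatching (hG : G.IsTwinCovered) (hH : H.IsTwinCovered) :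
    extensionValue G H I f ≤ #(labelMatching G H I f) := by
  classical
  rw [card_eq_sum_card_fiberwise (f := fun p => G.label I id p.1) (t := I.powerset ×ˢ range G.n)
    fun p hp => mem_coe.2 (label_mem (mem_labelMatching.1 hp).1)]
  refine sum_le_sum fun l _ => ?_
  have ha : ∀ t ∈ range (min #(G.labelClass I id l) #(H.labelClass I f l)),
      ∃ u ∈ G.labelClass I id l, keyPos (G.labelClass I id l) (G.cliqueKey I id) u = t :=
    fun t ht => exists_keyPos_eq (cliqueKey_injOn hG l)
      ((mem_range.1 ht).trans_le (min_le_left _ _))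
  have hb : ∀ t ∈ range (min #(G.labelClass I id l) #(H.labelClass I f l)),
      ∃ u ∈ H.labelClass I f l, keyPos (H.labelClass I f l) (H.cliqueKey I f) u = t :=
    fun t ht => exists_keyPos_eq (cliqueKey_injOn hH l)
      ((mem_range.1 ht).trans_le (min_le_right _ _))
  choose! a ha ha' using ha
  choose! b hb hb' using hb
  rw [← card_range (min #(G.labelClass I id l) #(H.labelClass I f l))]
  refine card_le_card_of_injOn (fun t => (a t, b t)) (fun t ht => ?_) fun t ht t' ht' h => ?_
  · have ht := mem_coe.1 ht
    obtain ⟨a₁, a₂⟩ := mem_labelClass.1 (ha t ht)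
    obtain ⟨b₁, b₂⟩ := mem_labelClass.1 (hb t ht)
    refine mem_coe.2 (mem_filter.2 ⟨mem_labelMatching.2 ⟨a₁, b₁, a₂.trans b₂.symm, ?_⟩, a₂⟩)
    simp only [labelPos, a₂, b₂, ha' t ht, hb' t ht]
  · rw [← ha' t (mem_coe.1 ht), ← ha' t' (mem_coe.1 ht'), show a t = a t' from congrArg Prod.fst h]

theorem exists_extension (hG : G.IsTwinCovered) (hH : H.IsTwinCovered)
    (hI : IsPartialIso G H (mapGraph I f)) : ∃ ψ : Finset (ℕ × ℕ),
      (∀ p ∈ ψ, p.1 ∈ G.residual I id ∧ p.2 ∈ H.residual I f) ∧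
      IsPartialIso G H (mapGraph I f ∪ ψ) ∧
      #I + extensionValue G H I f ≤ #(mapGraph I f ∪ ψ) := by
  have hdisjoint : Disjoint (mapGraph I f) (labelMatching G H I f) :=
    disjoint_left.2 fun p hp hp' => (mapGraph_labelMatching_compatible hG hH hp hp').1 rfl
  refine ⟨labelMatching G H I f, fun p hp => ?_,
    isPartialIso_mapGraph_union_labelMatching hG hH hI, ?_⟩
  · obtain ⟨h₁, h₂, -⟩ := mem_labelMatching.1 hp
    exact ⟨h₁, h₂⟩
  · rw [card_union_of_disjoint hdisjoint, card_mapGraph]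
    exact Nat.add_le_add_left (extensionValue_le_card_labelMatching hG hH) _

theorem card_profile_keyPos_le_card_labelClass (hG : G.IsTwinCovered) {ι : Type*} {ψ : Finset ι}
    {π key : ι → ℕ} {X : ι → Finset ι} {e : ℕ → ℕ} (hres : ∀ p ∈ ψ, π p ∈ G.residual I e)
    (hπ : Set.InjOn π ψ) (hkey : Set.InjOn key ψ)
    (hX : ∀ p ∈ ψ, ∀ q, q ∈ X p ↔ q ∈ ψ ∧ G.SameClique (π p) (π q)) (l : Finset ℕ × ℕ) :
    #{p ∈ ψ | (G.profile I e (π p), keyPos (X p) key p) = l} ≤ #(G.labelClass I e l) := by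
  have hself : ∀ p ∈ ψ, p ∈ X p := fun p hp =>
    (hX p hp p).2 ⟨hp, sameClique_self_of_mem_residual (hres p hp)⟩
  have hcard : ∀ p ∈ ψ, #(X p) ≤ #(G.residualClique I e (π p)) := fun p hp =>
    card_le_card_of_injOn π (fun q hq => by
        obtain ⟨hq, hs⟩ := (hX p hp q).1 hq
        exact mem_residualClique.2 ⟨hres q hq, hs⟩)
      (hπ.mono fun q hq => ((hX p hp q).1 hq).1)
  have hex : ∀ p ∈ ψ, ∃ v ∈ G.residual I e, G.SameClique (π p) v ∧
      G.residualRank I e v = keyPos (X p) key p := fun p hp =>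
    exists_residualRank_eq hG ((keyPos_lt_card (hself p hp)).trans_le (hcard p hp))
  choose! a hmem hsame hrank using hex
  refine card_le_card_of_injOn a (fun p hp => ?_) fun p hp q hq h => ?_
  · obtain ⟨hp, hl⟩ := mem_filter.1 (mem_coe.1 hp)
    refine mem_coe.2 (mem_labelClass.2 ⟨hmem p hp, ?_⟩)
    rw [label, hrank p hp, ← profile_eq_of_sameClique hG (hres p hp) (hmem p hp) (hsame p hp), hl]
  · obtain ⟨hp, hl⟩ := mem_filter.1 (mem_coe.1 hp)
    obtain ⟨hq, hl'⟩ := mem_filter.1 (mem_coe.1 hq)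
    have hpq : G.SameClique (π p) (π q) :=
      (hsame p hp).trans hG (h ▸ (hsame q hq).symm hG)
    have hXpq : X p = X q := by
      ext w
      rw [hX p hp, hX q hq]
      exact and_congr_right fun _ => ⟨(hpq.symm hG).trans hG, hpq.trans hG⟩
    refine keyPos_injOn (hkey.mono fun w hw => ((hX p hp w).1 hw).1) (hself p hp)
      ((hX p hp q).2 ⟨hq, hpq⟩) ?_
    exact (congrArg Prod.snd (hl.trans hl'.symm)).trans (by rw [hXpq])

theorem IsPartialIso.mono {φ ψ : Finset (ℕ × ℕ)} (h : IsPartialIso G H ψ) (hs : φ ⊆ ψ) :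
    IsPartialIso G H φ :=
  ⟨fun p hp => h.1 p (hs hp), fun p hp q hq => h.2 p (hs hp) q (hs hq)⟩

theorem IsPartialIso.injOn_fst {φ : Finset (ℕ × ℕ)} (h : IsPartialIso G H φ) :
    Set.InjOn Prod.fst (φ : Set (ℕ × ℕ)) :=
  fun p hp q hq e => Prod.ext e ((h.2 p hp q hq).1.1 e)

theorem IsPartialIso.injOn_snd {φ : Finset (ℕ × ℕ)} (h : IsPartialIso G H φ) :
    Set.InjOn Prod.snd (φ : Set (ℕ × ℕ)) :=
  fun p hp q hq e => Prod.ext ((h.2 p hp q hq).1.2 e) e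

theorem IsPartialIso.sameClique_iff {φ : Finset (ℕ × ℕ)} (h : IsPartialIso G H φ)
    {p q : ℕ × ℕ} (hp : p ∈ φ) (hq : q ∈ φ) (hp₁ : p.1 ∈ G.residual I id)
    (hp₂ : p.2 ∈ H.residual I f) (hq₁ : q.1 ∈ G.residual I id) (hq₂ : q.2 ∈ H.residual I f) :
    G.SameClique p.1 q.1 ↔ H.SameClique p.2 q.2 := by
  obtain ⟨heq, hadj⟩ := h.2 p hp q hq
  rw [mem_residual] at hp₁ hp₂ hq₁ hq₂
  simp only [SameClique, heq, hadj, hp₁, hp₂, hq₁, hq₂, true_and, not_false_eq_true]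

theorem IsPartialIso.profile_eq {φ : Finset (ℕ × ℕ)} (h : IsPartialIso G H φ)
    (hI : mapGraph I f ⊆ φ) {p : ℕ × ℕ} (hp : p ∈ φ) :
    G.profile I id p.1 = H.profile I f p.2 := by
  ext x
  simp only [mem_profile, id]
  exact and_congr_right fun hx => (h.2 p hp (x, f x) (hI (mem_mapGraph.2 ⟨hx, rfl⟩))).2

theorem card_extension_le (hG : G.IsTwinCovered) (hH : H.IsTwinCovered) {ψ : Finset (ℕ × ℕ)}
    (hψ : ∀ p ∈ ψ, p.1 ∈ G.residual I id ∧ p.2 ∈ H.residual I f)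
    (hpi : IsPartialIso G H (mapGraph I f ∪ ψ)) : #ψ ≤ extensionValue G H I f := by
  classical
  have hfst := (hpi.mono subset_union_right).injOn_fst
  have hsnd := (hpi.mono subset_union_right).injOn_snd
  let X : ℕ × ℕ → Finset (ℕ × ℕ) := fun p => {q ∈ ψ | G.SameClique p.1 q.1}
  have hXG : ∀ p ∈ ψ, ∀ q, q ∈ X p ↔ q ∈ ψ ∧ G.SameClique p.1 q.1 := fun p _ q => mem_filter
  have hXH : ∀ p ∈ ψ, ∀ q, q ∈ X p ↔ q ∈ ψ ∧ H.SameClique p.2 q.2 := fun p hp q =>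
    (hXG p hp q).trans (and_congr_right fun hq =>
      (hpi.mono subset_union_right).sameClique_iff hp hq (hψ p hp).1 (hψ p hp).2 (hψ q hq).1
        (hψ q hq).2)
  have hG_le := card_profile_keyPos_le_card_labelClass hG (fun p hp => (hψ p hp).1) hfst hfst hXG
  have hH_le := card_profile_keyPos_le_card_labelClass hH (fun p hp => (hψ p hp).2) hsnd hfst hXH
  rw [card_eq_sum_card_fiberwise (f := fun p => (G.profile I id p.1, keyPos (X p) Prod.fst p))
    (t := I.powerset ×ˢ range G.n)]
  · refine sum_le_sum fun l _ => le_min (hG_le l) ((card_le_card fun p hp => ?_).trans (hH_le l))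
    obtain ⟨hp, hl⟩ := mem_filter.1 hp
    exact mem_filter.2 ⟨hp, by
      rw [← hpi.profile_eq subset_union_left (mem_union_right _ hp), hl]⟩
  · intro p hp
    have hp := mem_coe.1 hp
    refine mem_coe.2 (mem_product.2 ⟨mem_powerset.2 fun x hx => (mem_profile.1 hx).1, ?_⟩)
    refine mem_range.2 ((keyPos_lt_card ((hXG p hp p).2
      ⟨hp, sameClique_self_of_mem_residual (hψ p hp).1⟩)).trans_le ?_)
    rw [← card_range G.n]
    exact card_le_card_of_injOn Prod.fst
      (fun q hq => mem_coe.2 (mem_range.2 ((hXG p hp q).1 hq).2.2.1))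
      (hfst.mono fun q hq => ((hXG p hp q).1 hq).1)

end partialIso

/-! ### Sizes and types of cliques, candidates -/

section cliques

section defs

variable (G : CoverGraph) (N K : ℕ)

/-- The size of the clique of `u`. Here and below, `N` is a bound on the vertices, which the machine
uses as the bound of its loops. -/
noncomputable def cliqueSize (u : ℕ) : ℕ := countBelow N fun v => G.SameClique u v

/-- The position of `u` in its clique. -/
noncomputable def cliqueRank (u : ℕ) : ℕ := countBelow N fun v => G.SameClique u v ∧ v < u

/-- `u` is the least vertex of its clique. Leaders represent the cliques. -/
def IsLeader (u : ℕ) : Prop :=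
  G.SameClique u u ∧ AllBelow N fun v => ¬ (G.SameClique u v ∧ v < u)

/-- `u` and `v` have the same neighbors in the twin cover. -/
def SameType (u v : ℕ) : Prop := AllBelow N fun s => G.cover s → (G.Adj u s ↔ G.Adj v s)

/-- The order of the cliques by size, with ties broken by the vertices given. -/
def SizeBefore (u v : ℕ) : Prop :=
  G.cliqueSize N u < G.cliqueSize N v ∨ (G.cliqueSize N u = G.cliqueSize N v ∧ u < v)

/-- Fewer than `K` cliques of the same type are larger. -/
def IsTop (u : ℕ) : Prop :=
  G.IsLeader N u ∧
    countBelow N (fun v => G.IsLeader N v ∧ G.SameType N u v ∧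
      G.cliqueSize N u < G.cliqueSize N v) < K

/-- The clique of `u` has size at least `θ`, and fewer than `K` such cliques of the same type come
before it. -/
def NearAbove (θ u : ℕ) : Prop :=
  θ ≤ G.cliqueSize N u ∧
    countBelow N (fun v => G.IsLeader N v ∧ G.SameType N u v ∧ θ ≤ G.cliqueSize N v ∧
      G.SizeBefore N v u) < K

/-- The clique of `u` has size at most `θ`, and fewer than `K` such cliques of the same type come
after it. -/
def NearBelow (θ u : ℕ) : Prop :=
  G.cliqueSize N u ≤ θ ∧
    countBelow N (fun v => G.IsLeader N v ∧ G.SameType N u v ∧ G.cliqueSize N v ≤ θ ∧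
      G.SizeBefore N u v) < K

/-- The size of the clique of `u` is one of the closest to the threshold `θ`. -/
def Near (θ u : ℕ) : Prop := G.NearAbove N K θ u ∨ G.NearBelow N K θ u

/-- The cliques that are considered as images of vertices in the twin cover of the other graph
`H`. When `a` vertices of the clique are taken out, its size should move towards `d + a`, where `d`
is the size of the largest remaining clique of `H` that can be matched to the rest. If nothing in
`H` can be matched to an untouched clique of the same type, its size should move towards `N`. -/
def IsCandidateLeader (H : CoverGraph) (u : ℕ) : Prop :=
  G.IsLeader N u ∧ (G.Near N K N u ∨ (SomeBelow N fun a => a < K ∧ G.Near N K a u) ∨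
    SomeBelow N fun d => SomeBelow N fun a => H.IsTop N K d ∧ a < K ∧
      G.Near N K (H.cliqueSize N d + a) u)

/-- The vertices outside the twin cover that are considered as images of vertices in the twin
cover of the other graph `H`. -/
def IsCandidate (H : CoverGraph) (v : ℕ) : Prop :=
  G.cliqueRank N v < K ∧ SomeBelow N fun u => G.SameClique u v ∧ G.IsCandidateLeader N K H u

/-- The vertices considered as partners of vertices in the two twin covers. -/
def InPool (H : CoverGraph) (v : ℕ) : Prop := G.cover v ∨ G.IsCandidate N K H v

end defs

variable {G H : CoverGraph} {N K : ℕ} {I : Finset ℕ} {e f : ℕ → ℕ}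

theorem IsLeader.eq_of_sameClique (hG : G.IsTwinCovered) (hN : G.n ≤ N) {u v : ℕ}
    (hu : G.IsLeader N u) (hv : G.IsLeader N v) (h : G.SameClique u v) : u = v := by
  rcases lt_trichotomy u v with h' | h' | h'
  · exact absurd ⟨h.symm hG, h'⟩ (hv.2 u (h.1.trans_le hN))
  · exact h'
  · exact absurd ⟨h, h'⟩ (hu.2 v (h.2.1.trans_le hN))

theorem exists_isLeader (hG : G.IsTwinCovered) {u : ℕ} (h : G.SameClique u u) :
    ∃ v, G.IsLeader N v ∧ G.SameClique v u := by
  classical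
  have hex : ∃ v, G.SameClique v u := ⟨u, h⟩
  refine ⟨Nat.find hex, ⟨?_, fun w _ hw => ?_⟩, Nat.find_spec hex⟩
  · exact (Nat.find_spec hex).trans hG ((Nat.find_spec hex).symm hG)
  · exact Nat.find_min hex hw.2 ((hw.1.symm hG).trans hG (Nat.find_spec hex))

theorem SameType.iff {u v s : ℕ} (hG : G.IsTwinCovered) (hN : G.n ≤ N) (h : G.SameType N u v)
    (hs : G.cover s) : G.Adj u s ↔ G.Adj v s := h s ((hG.cover_lt hs).trans_le hN) hs

theorem SameType.trans {u v w : ℕ} (h : G.SameType N u v) (h' : G.SameType N v w) :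
    G.SameType N u w :=
  fun s hs hS => (h s hs hS).trans (h' s hs hS)

theorem sameType_refl (u : ℕ) : G.SameType N u u := fun _ _ _ => Iff.rfl

theorem adj_cover_iff_of_sameClique (hG : G.IsTwinCovered) {u v s : ℕ} (h : G.SameClique u v)
    (hs : G.cover s) : G.Adj u s ↔ G.Adj v s :=
  h.adj_iff hG (fun h' => h.2.2.1 (h' ▸ hs)) fun h' => h.2.2.2.1 (h' ▸ hs)

theorem countBelow_touched_le (hG : G.IsTwinCovered) (hN : G.n ≤ N) {P : ℕ → Prop}
    (hP : ∀ w, P w → G.IsLeader N w ∧ ∃ x ∈ I, G.SameClique w (e x)) : countBelow N P ≤ #I := by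
  classical
  have : ∀ w, P w → ∃ x ∈ I, G.SameClique w (e x) := fun w hw => (hP w hw).2
  choose! m hm hs using this
  refine card_le_card_of_injOn m (fun w hw => ?_) fun w hw w' hw' h => ?_
  · exact mem_coe.2 (hm w (mem_filter.1 (mem_coe.1 hw)).2)
  · have h₁ := (mem_filter.1 (mem_coe.1 hw)).2
    have h₂ := (mem_filter.1 (mem_coe.1 hw')).2
    exact (hP w h₁).1.eq_of_sameClique hG hN (hP w' h₂).1
      ((hs w h₁).trans hG (h ▸ (hs w' h₂).symm hG))

open Classical in
theorem card_residualClique_add (hN : G.n ≤ N) (he : Set.InjOn e I) (u : ℕ) :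
    #(G.residualClique I e u) + #{x ∈ I | G.SameClique u (e x)} = G.cliqueSize N u := by
  rw [← card_image_of_injOn (f := e) (he.mono fun x hx => (mem_filter.1 (mem_coe.1 hx)).1),
    ← card_union_of_disjoint]
  · rw [cliqueSize, countBelow]
    congr 1
    ext v
    simp only [mem_union, mem_residualClique, mem_residual, mem_image, mem_filter, mem_range]
    constructor
    · rintro (⟨-, h⟩ | ⟨x, ⟨-, h⟩, rfl⟩)
      · exact ⟨h.2.1.trans_le hN, h⟩
      · exact ⟨h.2.1.trans_le hN, h⟩
    · rintro ⟨-, h⟩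
      by_cases hx : ∃ x ∈ I, e x = v
      · obtain ⟨x, hx, rfl⟩ := hx
        exact .inr ⟨x, ⟨hx, h⟩, rfl⟩
      · push Not at hx
        exact .inl ⟨⟨h.2.1, h.2.2.2.1, hx⟩, h⟩
  · refine disjoint_left.2 fun v hv hv' => ?_
    obtain ⟨x, hx, rfl⟩ := mem_image.1 hv'
    exact (mem_residual.1 (mem_residualClique.1 hv).1).2.2 x (mem_filter.1 hx).1 rfl

theorem cliqueSize_le (hN : G.n ≤ N) (u : ℕ) : G.cliqueSize N u ≤ G.n := by
  classical
  have := card_residualClique_add (I := ∅) (e := id) hN (by simp) u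
  rw [← this]
  simpa using card_residualClique_le u

theorem sizeBefore_iff {u v : ℕ} :
    G.SizeBefore N u v ↔ toLex (G.cliqueSize N u, u) < toLex (G.cliqueSize N v, v) := by
  rw [SizeBefore, Prod.Lex.toLex_lt_toLex]

theorem cliqueSize_le_of_toLex_le {u v : ℕ}
    (h : toLex (G.cliqueSize N u, u) ≤ toLex (G.cliqueSize N v, v)) :
    G.cliqueSize N u ≤ G.cliqueSize N v :=
  (Prod.Lex.toLex_le_toLex.1 h).elim le_of_lt fun h => h.1.le

open Classical in
/-- The leaders of the cliques of the type of `c` that contain no vertex taken out, together with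
`c`. The vertices taken out from the clique of `c` can be exchanged for vertices of any of them. -/
noncomputable def exchangeLeaders (G : CoverGraph) (N : ℕ) (I : Finset ℕ) (e : ℕ → ℕ) (c : ℕ) :
    Finset ℕ :=
  {v ∈ range N | G.IsLeader N v ∧ G.SameType N c v ∧ (v = c ∨ ∀ x ∈ I, ¬ G.SameClique v (e x))}

theorem mem_exchangeLeaders (hN : G.n ≤ N) {c v : ℕ} : v ∈ G.exchangeLeaders N I e c ↔
    G.IsLeader N v ∧ G.SameType N c v ∧ (v = c ∨ ∀ x ∈ I, ¬ G.SameClique v (e x)) := by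
  simp only [exchangeLeaders, mem_filter, mem_range, and_iff_right_iff_imp]
  exact fun h => h.1.1.1.trans_le hN

theorem countBelow_notMem_exchangeLeaders_lt (hG : G.IsTwinCovered) (hN : G.n ≤ N) (hK : #I < K)
    {c : ℕ} {P : ℕ → Prop}
    (hP : ∀ w, P w → G.IsLeader N w ∧ G.SameType N c w ∧ w ∉ G.exchangeLeaders N I e c) :
    countBelow N P < K := by
  refine (countBelow_touched_le (e := e) hG hN fun w hw => ?_).trans_lt hK
  obtain ⟨hw, hs, hwX⟩ := hP w hw
  refine ⟨hw, ?_⟩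
  by_contra! hcon
  exact hwX ((mem_exchangeLeaders hN).2 ⟨hw, hs, .inr hcon⟩)

theorem exists_near (hG : G.IsTwinCovered) (hN : G.n ≤ N) (hK : #I < K) {c : ℕ}
    (hc : G.IsLeader N c) (θ : ℕ) :
    ∃ c', G.IsLeader N c' ∧ G.SameType N c c' ∧ (c' = c ∨ ∀ x ∈ I, ¬ G.SameClique c' (e x)) ∧
      G.Near N K θ c' ∧
      (θ ≤ G.cliqueSize N c' ∧ G.cliqueSize N c' ≤ G.cliqueSize N c ∨
        G.cliqueSize N c ≤ G.cliqueSize N c' ∧ G.cliqueSize N c' ≤ θ) := by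
  classical
  let key : ℕ → ℕ ×ₗ ℕ := fun v => toLex (G.cliqueSize N v, v)
  have hcX : c ∈ G.exchangeLeaders N I e c :=
    (mem_exchangeLeaders hN).2 ⟨hc, sameType_refl c, .inl rfl⟩
  rcases le_total θ (G.cliqueSize N c) with hθ | hθ
  · obtain ⟨c', hc', hmin⟩ := exists_min_image
      {v ∈ G.exchangeLeaders N I e c | θ ≤ G.cliqueSize N v} key ⟨c, mem_filter.2 ⟨hcX, hθ⟩⟩
    obtain ⟨hc', hθ'⟩ := mem_filter.1 hc'
    obtain ⟨hlead, htype, hfree⟩ := (mem_exchangeLeaders hN).1 hc'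
    refine ⟨c', hlead, htype, hfree, .inl ⟨hθ', ?_⟩,
      .inl ⟨hθ', cliqueSize_le_of_toLex_le (hmin c (mem_filter.2 ⟨hcX, hθ⟩))⟩⟩
    refine countBelow_notMem_exchangeLeaders_lt (e := e) hG hN hK fun w hw =>
      ⟨hw.1, htype.trans hw.2.1, fun hwX => ?_⟩
    exact (sizeBefore_iff.1 hw.2.2.2).not_ge (hmin w (mem_filter.2 ⟨hwX, hw.2.2.1⟩))
  · obtain ⟨c', hc', hmax⟩ := exists_max_image
      {v ∈ G.exchangeLeaders N I e c | G.cliqueSize N v ≤ θ} key ⟨c, mem_filter.2 ⟨hcX, hθ⟩⟩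
    obtain ⟨hc', hθ'⟩ := mem_filter.1 hc'
    obtain ⟨hlead, htype, hfree⟩ := (mem_exchangeLeaders hN).1 hc'
    refine ⟨c', hlead, htype, hfree, .inr ⟨hθ', ?_⟩,
      .inr ⟨cliqueSize_le_of_toLex_le (hmax c (mem_filter.2 ⟨hcX, hθ⟩)), hθ'⟩⟩
    refine countBelow_notMem_exchangeLeaders_lt (e := e) hG hN hK fun w hw =>
      ⟨hw.1, htype.trans hw.2.1, fun hwX => ?_⟩
    exact (sizeBefore_iff.1 hw.2.2.2).not_ge (hmax w (mem_filter.2 ⟨hwX, hw.2.2.1⟩))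

/-! ### Counting labels in a clique -/

open Classical in
/-- The vertices taken out that are in the twin cover and adjacent to `c`. -/
noncomputable def baseProfile (G : CoverGraph) (I : Finset ℕ) (e : ℕ → ℕ) (c : ℕ) : Finset ℕ :=
  {x ∈ I | G.cover (e x) ∧ G.Adj c (e x)}

open Classical in
/-- The vertices taken out that are in the clique of `c`. -/
noncomputable def touched (G : CoverGraph) (I : Finset ℕ) (e : ℕ → ℕ) (c : ℕ) : Finset ℕ :=
  {x ∈ I | G.SameClique c (e x)}

theorem mem_touched {c x : ℕ} : x ∈ G.touched I e c ↔ x ∈ I ∧ G.SameClique c (e x) := by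
  simp [touched]

theorem mem_baseProfile {c x : ℕ} :
    x ∈ G.baseProfile I e c ↔ x ∈ I ∧ G.cover (e x) ∧ G.Adj c (e x) := by simp [baseProfile]

theorem profile_eq_of_mem_residualClique (hG : G.IsTwinCovered) {c v : ℕ}
    (hv : v ∈ G.residualClique I e c) :
    G.profile I e v = G.baseProfile I e c ∪ G.touched I e c := by
  obtain ⟨hr, hs⟩ := mem_residualClique.1 hv
  ext x
  simp only [mem_profile, mem_union, mem_baseProfile, mem_touched]
  rw [← and_or_left]
  refine and_congr_right fun hx => ?_
  by_cases hS : G.cover (e x)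
  · rw [← adj_cover_iff_of_sameClique hG hs hS]
    simp only [hS, true_and]
    exact ⟨.inl, fun h => h.resolve_right fun h => h.2.2.2.1 hS⟩
  · simp only [hS, false_and, false_or]
    have hne : v ≠ e x := fun h => (mem_residual.1 hr).2.2 x hx h.symm
    constructor
    · intro h
      exact hs.trans hG (sameClique_of_adj hG h hs.2.2.2.1 hS)
    · intro h
      exact adj_of_sameClique ((hs.symm hG).trans hG h) hne

open Classical in
theorem card_labelClass_sameClique (hG : G.IsTwinCovered) (c : ℕ) (l : Finset ℕ × ℕ) :
    #{v ∈ G.labelClass I e l | G.SameClique c v} =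
      if l.1 = G.baseProfile I e c ∪ G.touched I e c ∧ l.2 < #(G.residualClique I e c)
        then 1 else 0 := by
  split_ifs with h
  · obtain ⟨v, hv, hs, hr⟩ := exists_residualRank_eq hG h.2
    rw [card_eq_one]
    refine ⟨v, ?_⟩
    ext w
    simp only [mem_filter, mem_labelClass, mem_singleton]
    constructor
    · rintro ⟨⟨hw, hl⟩, hs'⟩
      refine residualRank_inj hG hw hv ((hs'.symm hG).trans hG hs) ?_
      rw [hr]
      exact congrArg Prod.snd hl
    · rintro rfl
      refine ⟨⟨hv, Prod.ext ?_ hr⟩, hs⟩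
      rw [h.1]
      exact profile_eq_of_mem_residualClique hG (mem_residualClique.2 ⟨hv, hs⟩)
  · rw [card_eq_zero, filter_eq_empty_iff]
    intro v hv hs
    obtain ⟨hr, rfl⟩ := mem_labelClass.1 hv
    have hcl := mem_residualClique.2 ⟨hr, hs⟩
    refine h ⟨profile_eq_of_mem_residualClique hG hcl, ?_⟩
    rw [residualClique_eq_of_sameClique hG hs]
    exact residualRank_lt hr

open Classical in
/-- The vertices with label `l` outside the cliques of `c` and `c'`. -/
noncomputable def restClass (G : CoverGraph) (I : Finset ℕ) (e : ℕ → ℕ) (c c' : ℕ)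
    (l : Finset ℕ × ℕ) : Finset ℕ :=
  {v ∈ G.labelClass I e l | ¬ G.SameClique c v ∧ ¬ G.SameClique c' v}

open Classical in
theorem card_labelClass_eq (hG : G.IsTwinCovered) {c c' : ℕ} (hcc : G.SameClique c c' → c = c')
    (l : Finset ℕ × ℕ) :
    #(G.labelClass I e l) = #(G.restClass I e c c' l) +
      (if l.1 = G.baseProfile I e c ∪ G.touched I e c ∧ l.2 < #(G.residualClique I e c)
        then 1 else 0) +
      (if c = c' then 0
        else if l.1 = G.baseProfile I e c' ∪ G.touched I e c' ∧ l.2 < #(G.residualClique I e c')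
          then 1 else 0) := by
  rw [← card_labelClass_sameClique hG c, ← card_labelClass_sameClique hG c']
  have h₁ := card_filter_add_card_filter_not (s := G.labelClass I e l) (fun v => G.SameClique c v)
  have h₂ := card_filter_add_card_filter_not
    (s := {v ∈ G.labelClass I e l | ¬ G.SameClique c v}) (fun v => G.SameClique c' v)
  rw [filter_filter, filter_filter] at h₂
  have h₃ : #(G.restClass I e c c' l) =
      #{v ∈ G.labelClass I e l | ¬ G.SameClique c v ∧ ¬ G.SameClique c' v} := rfl
  have h₄ : #{v ∈ G.labelClass I e l | ¬ G.SameClique c v ∧ G.SameClique c' v} =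
      if c = c' then 0 else #{v ∈ G.labelClass I e l | G.SameClique c' v} := by
    split_ifs with h
    · subst h
      rw [card_eq_zero, filter_eq_empty_iff]
      exact fun v _ hv => hv.1 hv.2
    · congr 1
      ext v
      simp only [mem_filter]
      refine and_congr_right fun _ => ⟨And.right, fun hv => ⟨fun hv' => h (hcc ?_), hv⟩⟩
      exact hv'.trans hG (hv.symm hG)
  omega

end cliques

/-! ### Moving the images of vertices to another clique -/

/-- `f'` arises from `f` by moving all images in the clique of `c` to the clique of `c'`, which is
of the same type and contains no other images. -/
structure Move (H : CoverGraph) (N : ℕ) (I : Finset ℕ) (f f' : ℕ → ℕ) (c c' : ℕ) : Prop where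
  leader : H.IsLeader N c
  leader' : H.IsLeader N c'
  sameType : H.SameType N c c'
  untouched : c' = c ∨ ∀ x ∈ I, ¬ H.SameClique c' (f x)
  eq : ∀ x ∈ I, ¬ H.SameClique c (f x) → f' x = f x
  sameClique : ∀ x ∈ I, H.SameClique c (f x) → H.SameClique c' (f' x)

namespace Move

variable {G H : CoverGraph} {N : ℕ} {I : Finset ℕ} {f f' : ℕ → ℕ} {c c' : ℕ}

theorem sameClique_iff (h : Move H N I f f' c c') {x : ℕ} (hx : x ∈ I) :
    H.SameClique c' (f' x) ↔ H.SameClique c (f x) := by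
  refine ⟨fun hs => ?_, h.sameClique x hx⟩
  by_contra hn
  rw [h.eq x hx hn] at hs
  rcases h.untouched with rfl | hu
  · exact hn hs
  · exact hu x hx hs

theorem touched_target_eq (h : Move H N I f f' c c') : H.touched I f' c' = H.touched I f c := by
  ext x
  simp only [mem_touched]
  exact and_congr_right fun hx => h.sameClique_iff hx

theorem touched_source (hH : H.IsTwinCovered) (hN : H.n ≤ N) (h : Move H N I f f' c c')
    (hne : c ≠ c') : H.touched I f' c = ∅ := by
  refine eq_empty_of_forall_notMem fun x hx => ?_
  obtain ⟨hx, hs⟩ := mem_touched.1 hx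
  by_cases hf : H.SameClique c (f x)
  · exact hne (h.leader.eq_of_sameClique hH hN h.leader'
      (hs.trans hH ((h.sameClique x hx hf).symm hH)))
  · rw [h.eq x hx hf] at hs
    exact hf hs

theorem touched_target (h : Move H N I f f' c c') (hne : c ≠ c') : H.touched I f c' = ∅ := by
  refine eq_empty_of_forall_notMem fun x hx => ?_
  obtain ⟨hx, hs⟩ := mem_touched.1 hx
  exact h.untouched.resolve_left (fun h' => hne h'.symm) x hx hs

theorem baseProfile_eq (h : Move H N I f f' c c') (w : ℕ) :
    H.baseProfile I f' w = H.baseProfile I f w := by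
  ext x
  simp only [mem_baseProfile]
  refine and_congr_right fun hx => ?_
  by_cases hs : H.SameClique c (f x)
  · have h₁ := hs.2.2.2.1
    have h₂ := (h.sameClique x hx hs).2.2.2.1
    simp [h₁, h₂]
  · rw [h.eq x hx hs]

theorem baseProfile_target_eq (hH : H.IsTwinCovered) (hN : H.n ≤ N)
    (h : Move H N I f f' c c') : H.baseProfile I f c' = H.baseProfile I f c := by
  ext x
  simp only [mem_baseProfile]
  refine and_congr_right fun _ => and_congr_right fun hS => ?_
  exact (h.sameType.iff hH hN hS).symm

theorem mem_residual_iff (h : Move H N I f f' c c') {v : ℕ} (h₁ : ¬ H.SameClique c v)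
    (h₂ : ¬ H.SameClique c' v) : v ∈ H.residual I f' ↔ v ∈ H.residual I f := by
  simp only [mem_residual]
  refine and_congr_right fun _ => and_congr_right fun _ => forall₂_congr fun x hx => ?_
  by_cases hs : H.SameClique c (f x)
  · refine iff_of_true ?_ ?_
    · rintro rfl
      exact h₂ (h.sameClique x hx hs)
    · rintro rfl
      exact h₁ hs
  · rw [h.eq x hx hs]

theorem profile_eq (hH : H.IsTwinCovered) (h : Move H N I f f' c c') {v : ℕ} (hv : ¬ H.cover v)
    (h₁ : ¬ H.SameClique c v) (h₂ : ¬ H.SameClique c' v) :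
    H.profile I f' v = H.profile I f v := by
  ext x
  simp only [mem_profile]
  refine and_congr_right fun hx => ?_
  by_cases hs : H.SameClique c (f x)
  · have hs' := h.sameClique x hx hs
    refine iff_of_false (fun hE => ?_) fun hE => ?_
    · exact h₂ (hs'.trans hH ((sameClique_of_adj hH hE hv hs'.2.2.2.1).symm hH))
    · exact h₁ (hs.trans hH ((sameClique_of_adj hH hE hv hs.2.2.2.1).symm hH))
  · rw [h.eq x hx hs]

theorem residualClique_eq (hH : H.IsTwinCovered) (h : Move H N I f f' c c') {v : ℕ}
    (h₁ : ¬ H.SameClique c v) (h₂ : ¬ H.SameClique c' v) :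
    H.residualClique I f' v = H.residualClique I f v := by
  ext w
  simp only [mem_residualClique]
  rw [and_comm, and_comm (b := H.SameClique v w)]
  refine and_congr_right fun hs => ?_
  exact h.mem_residual_iff (fun h' => h₁ (h'.trans hH (hs.symm hH)))
    fun h' => h₂ (h'.trans hH (hs.symm hH))

theorem restClass_eq (hH : H.IsTwinCovered) (h : Move H N I f f' c c') (l : Finset ℕ × ℕ) :
    H.restClass I f' c c' l = H.restClass I f c c' l := by
  ext v
  by_cases hout : ¬ H.SameClique c v ∧ ¬ H.SameClique c' v
  · simp only [restClass, mem_filter, mem_labelClass, hout, not_false_eq_true, and_true]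
    rw [h.mem_residual_iff hout.1 hout.2]
    refine and_congr_right fun hv => ?_
    rw [label, label, residualRank, residualRank, h.residualClique_eq hH hout.1 hout.2,
      h.profile_eq hH (mem_residual.1 hv).2.1 hout.1 hout.2]
  · simp only [restClass, mem_filter, hout, and_false]

theorem compatible_of_not_sameClique (hH : H.IsTwinCovered) (hN : H.n ≤ N)
    (h : Move H N I f f' c c') {x y : ℕ} (hx : x ∈ I) (hy : y ∈ I) (hs : H.SameClique c (f x))
    (hn : ¬ H.SameClique c (f y)) :
    f' x ≠ f' y ∧ (H.Adj (f' x) (f' y) ↔ H.Adj (f x) (f y)) := by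
  have hs' := h.sameClique x hx hs
  have hn' : ¬ H.SameClique c' (f' y) := fun h' => hn ((h.sameClique_iff hy).1 h')
  rw [h.eq y hy hn] at hn' ⊢
  refine ⟨fun he => hn' (he ▸ hs'), ?_⟩
  by_cases hS : H.cover (f y)
  · rw [← adj_cover_iff_of_sameClique hH hs' hS, ← adj_cover_iff_of_sameClique hH hs hS,
      h.sameType.iff hH hN hS]
  · refine iff_of_false (fun hE => ?_) fun hE => ?_
    · exact hn' (hs'.trans hH (sameClique_of_adj hH hE hs'.2.2.2.1 hS))
    · exact hn (hs.trans hH (sameClique_of_adj hH hE hs.2.2.2.1 hS))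

theorem compatible (hG : G.IsTwinCovered) (hH : H.IsTwinCovered) (hN : H.n ≤ N)
    (h : Move H N I f f' c c') (hinj : Set.InjOn f' (H.touched I f c)) {x y : ℕ} (hx : x ∈ I)
    (hy : y ∈ I) (heq : x = y ↔ f x = f y) (hadj : G.Adj x y ↔ H.Adj (f x) (f y)) :
    (x = y ↔ f' x = f' y) ∧ (G.Adj x y ↔ H.Adj (f' x) (f' y)) := by
  by_cases hsx : H.SameClique c (f x) <;> by_cases hsy : H.SameClique c (f y)
  · have heq' : x = y ↔ f' x = f' y :=
      ⟨congrArg f', hinj (mem_coe.2 (mem_touched.2 ⟨hx, hsx⟩))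
        (mem_coe.2 (mem_touched.2 ⟨hy, hsy⟩))⟩
    refine ⟨heq', ?_⟩
    by_cases he : x = y
    · subst he
      exact iff_of_false (hG.irrefl _) (hH.irrefl _)
    · rw [hadj]
      exact iff_of_true (adj_of_sameClique ((hsx.symm hH).trans hH hsy) fun h' => he (heq.2 h'))
        (adj_of_sameClique (((h.sameClique x hx hsx).symm hH).trans hH (h.sameClique y hy hsy))
          fun h' => he (heq'.2 h'))
  · obtain ⟨h₁, h₂⟩ := h.compatible_of_not_sameClique hH hN hx hy hsx hsy
    refine ⟨iff_of_false ?_ h₁, hadj.trans h₂.symm⟩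
    rintro rfl
    exact hsy hsx
  · obtain ⟨h₁, h₂⟩ := h.compatible_of_not_sameClique hH hN hy hx hsy hsx
    refine ⟨iff_of_false ?_ h₁.symm, ?_⟩
    · rintro rfl
      exact hsx hsy
    · rw [hadj]
      exact ⟨fun h => hH.symm (h₂.2 (hH.symm h)), fun h => hH.symm (h₂.1 (hH.symm h))⟩
  · rw [h.eq x hx hsx, h.eq y hy hsy]
    exact ⟨heq, hadj⟩

theorem isPartialIso (hG : G.IsTwinCovered) (hH : H.IsTwinCovered) (hN : H.n ≤ N)
    (h : Move H N I f f' c c') (hinj : Set.InjOn f' (H.touched I f c))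
    (hI : IsPartialIso G H (mapGraph I f)) : IsPartialIso G H (mapGraph I f') := by
  have hgraph : ∀ {x}, x ∈ I → (x, f x) ∈ mapGraph I f := fun hx => mem_mapGraph.2 ⟨hx, rfl⟩
  refine ⟨fun p hp => ?_, fun p hp q hq => ?_⟩
  · obtain ⟨hx, hy⟩ := mem_mapGraph.1 hp
    refine ⟨(hI.1 _ (hgraph hx)).1, ?_⟩
    rw [hy]
    by_cases hs : H.SameClique c (f p.1)
    · exact (h.sameClique _ hx hs).2.1
    · rw [h.eq _ hx hs]
      exact (hI.1 _ (hgraph hx)).2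
  · obtain ⟨hx, hy⟩ := mem_mapGraph.1 hp
    obtain ⟨hx', hy'⟩ := mem_mapGraph.1 hq
    obtain ⟨heq, hadj⟩ := hI.2 _ (hgraph hx) _ (hgraph hx')
    rw [hy, hy']
    exact h.compatible hG hH hN hinj hx hx' heq hadj

theorem card_labelClass_old (hH : H.IsTwinCovered) (hN : H.n ≤ N) (h : Move H N I f f' c c')
    (hf : Set.InjOn f I) (hne : c ≠ c') (l : Finset ℕ × ℕ) :
    #(H.labelClass I f l) = #(H.restClass I f c c' l) +
      (if l.1 = H.baseProfile I f c ∪ H.touched I f c ∧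
        l.2 < H.cliqueSize N c - #(H.touched I f c) then 1 else 0) +
      (if l.1 = H.baseProfile I f c ∧ l.2 < H.cliqueSize N c' then 1 else 0) := by
  have hsource : #(H.residualClique I f c) + #(H.touched I f c) = H.cliqueSize N c :=
    card_residualClique_add hN hf c
  have htarget : #(H.residualClique I f c') + #(H.touched I f c') = H.cliqueSize N c' :=
    card_residualClique_add hN hf c'
  rw [h.touched_target hne, card_empty, add_zero] at htarget
  rw [card_labelClass_eq hH (h.leader.eq_of_sameClique hH hN h.leader') l, if_neg hne,
    h.baseProfile_target_eq hH hN, h.touched_target hne, union_empty, htarget,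
    Nat.eq_sub_of_add_eq hsource]

theorem card_labelClass_new (hH : H.IsTwinCovered) (hN : H.n ≤ N) (h : Move H N I f f' c c')
    (hf' : Set.InjOn f' I) (hne : c ≠ c') (l : Finset ℕ × ℕ) :
    #(H.labelClass I f' l) = #(H.restClass I f c c' l) +
      (if l.1 = H.baseProfile I f c ∧ l.2 < H.cliqueSize N c then 1 else 0) +
      (if l.1 = H.baseProfile I f c ∪ H.touched I f c ∧
        l.2 < H.cliqueSize N c' - #(H.touched I f c) then 1 else 0) := by
  have hsource : #(H.residualClique I f' c) + #(H.touched I f' c) = H.cliqueSize N c :=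
    card_residualClique_add hN hf' c
  have htarget : #(H.residualClique I f' c') + #(H.touched I f' c') = H.cliqueSize N c' :=
    card_residualClique_add hN hf' c'
  rw [h.touched_source hH hN hne, card_empty, add_zero] at hsource
  rw [h.touched_target_eq] at htarget
  rw [card_labelClass_eq hH (h.leader.eq_of_sameClique hH hN h.leader') l, if_neg hne,
    h.baseProfile_eq c, h.baseProfile_eq c', h.baseProfile_target_eq hH hN,
    h.touched_source hH hN hne, union_empty, hsource, h.restClass_eq hH, h.touched_target_eq,
    Nat.eq_sub_of_add_eq htarget]

end Move

theorem sum_ite_lt_eq {n d : ℕ} (h : d ≤ n) : (∑ t ∈ range n, if t < d then 1 else 0) = d := by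
  rw [← card_filter]
  have : ({t ∈ range n | t < d} : Finset ℕ) = range d := by
    ext t
    simp only [mem_filter, mem_range]
    omega
  rw [this, card_range]

/-- The two sums are over the ranks of the vertices with the two profiles that are affected when `a`
images move from a clique of size `c` to one of size `c'`. -/
theorem move_sum_le {n a c c' d : ℕ} {p q r : ℕ → ℕ} (hp : ∀ t, p t = 0 ↔ d ≤ t) (hd : d ≤ n)
    (hac : a ≤ c) (hac' : a ≤ c')
    (h : d + a ≤ c' ∧ c' ≤ c ∨ c ≤ c' ∧ c' ≤ d + a ∨ c ≤ c' ∧ ∀ t, q t = 0) :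
    (∑ t ∈ range n, min (p t) (if t < c - a then 1 else 0)) +
        ∑ t ∈ range n, min (q t) (r t + if t < c' then 1 else 0) ≤
      (∑ t ∈ range n, min (p t) (if t < c' - a then 1 else 0)) +
        ∑ t ∈ range n, min (q t) (r t + if t < c then 1 else 0) := by
  rcases h with ⟨h₁, h₂⟩ | ⟨h₁, h₂⟩ | ⟨h₁, h₂⟩
  · refine add_le_add (sum_le_sum fun t _ => ?_) (sum_le_sum fun t _ => ?_)
    · have := hp t
      split_ifs <;> omega
    · split_ifs <;> omega
  · have e : ∀ x ≤ d, (∑ t ∈ range n, min (p t) (if t < x then 1 else 0)) = x := by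
      intro x hx
      refine Eq.trans (sum_congr rfl fun t _ => ?_) (sum_ite_lt_eq (hx.trans hd))
      have := hp t
      split_ifs <;> omega
    rw [e (c - a) (by omega), e (c' - a) (by omega)]
    have h₃ : ∑ t ∈ range n, min (q t) (r t + if t < c' then 1 else 0) ≤
        ∑ t ∈ range n, (min (q t) (r t + if t < c then 1 else 0) +
          if t ∈ Ico c c' then 1 else 0) := by
      refine sum_le_sum fun t _ => ?_
      simp only [mem_Ico]
      split_ifs <;> omega
    rw [sum_add_distrib, ← card_filter (fun t => t ∈ Ico c c')] at h₃
    have h₄ : #{t ∈ range n | t ∈ Ico c c'} ≤ c' - c := by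
      rw [← Nat.card_Ico]
      exact card_le_card fun t ht => (mem_filter.1 ht).2
    omega
  · refine add_le_add (sum_le_sum fun t _ => ?_) (sum_le_sum fun t _ => ?_)
    · have := hp t
      split_ifs <;> omega
    · have := h₂ t
      omega

theorem sum_le_sum_of_two {α : Type*} {s : Finset α} {g g' : α → ℕ} {a b : α}
    (ha : a ∈ s) (hb : b ∈ s) (hab : a ≠ b) (h : g a + g b ≤ g' a + g' b)
    (ho : ∀ x, x ≠ a → x ≠ b → g x = g' x) : ∑ x ∈ s, g x ≤ ∑ x ∈ s, g' x := by
  classical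
  have hb' : b ∈ s.erase a := mem_erase.2 ⟨hab.symm, hb⟩
  rw [← add_sum_erase s g ha, ← add_sum_erase s g' ha, ← add_sum_erase _ g hb',
    ← add_sum_erase _ g' hb']
  have : ∑ x ∈ (s.erase a).erase b, g x = ∑ x ∈ (s.erase a).erase b, g' x :=
    sum_congr rfl fun x hx => ho x (mem_erase.1 (mem_erase.1 hx).2).1 (mem_erase.1 hx).1
  omega

section move

variable {G H : CoverGraph} {N : ℕ} {I : Finset ℕ} {f f' : ℕ → ℕ} {c c' : ℕ}

theorem restClass_eq_empty (hH : H.IsTwinCovered) (hA : (H.touched I f c).Nonempty) (t : ℕ) :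
    H.restClass I f c c' (H.baseProfile I f c ∪ H.touched I f c, t) = ∅ := by
  classical
  refine eq_empty_of_forall_notMem fun v hv => ?_
  simp only [restClass, mem_filter] at hv
  obtain ⟨hv, hn, -⟩ := hv
  obtain ⟨hr, hl⟩ := mem_labelClass.1 hv
  obtain ⟨x, hx⟩ := hA
  have hxv : x ∈ H.profile I f v := by
    rw [show H.profile I f v = H.baseProfile I f c ∪ H.touched I f c from congrArg Prod.fst hl]
    exact mem_union_right _ hx
  have hs := (mem_touched.1 hx).2
  have hs' := sameClique_of_adj hH (mem_profile.1 hxv).2 (mem_residual.1 hr).2.1 hs.2.2.2.1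
  exact hn (hs.trans hH (hs'.symm hH))

theorem baseProfile_union_touched_ne (hA : (H.touched I f c).Nonempty) :
    H.baseProfile I f c ∪ H.touched I f c ≠ H.baseProfile I f c := by
  obtain ⟨x, hx⟩ := hA
  intro he
  have hx' : x ∈ H.baseProfile I f c := he ▸ mem_union_right _ hx
  exact (mem_touched.1 hx).2.2.2.2.1 (mem_baseProfile.1 hx').2.1

theorem Move.extensionValue_le (hH : H.IsTwinCovered) (hN : H.n ≤ N) (h : Move H N I f f' c c')
    (hf : Set.InjOn f I) (hf' : Set.InjOn f' I) {d : ℕ} (hA : (H.touched I f c).Nonempty)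
    (hd : ∀ t, (G.labelClass I id (H.baseProfile I f c ∪ H.touched I f c, t)).Nonempty ↔ t < d)
    (hdn : d ≤ G.n) (hac' : #(H.touched I f c) ≤ H.cliqueSize N c')
    (hc : d + #(H.touched I f c) ≤ H.cliqueSize N c' ∧ H.cliqueSize N c' ≤ H.cliqueSize N c ∨
      H.cliqueSize N c ≤ H.cliqueSize N c' ∧ H.cliqueSize N c' ≤ d + #(H.touched I f c) ∨
      H.cliqueSize N c ≤ H.cliqueSize N c' ∧ ∀ t, G.labelClass I id (H.baseProfile I f c, t) = ∅) :
    extensionValue G H I f ≤ extensionValue G H I f' := by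
  classical
  have hsource : #(H.residualClique I f c) + #(H.touched I f c) = H.cliqueSize N c :=
    card_residualClique_add hN hf c
  by_cases hne : c = c'
  · subst hne
    have htarget : #(H.residualClique I f' c) + #(H.touched I f' c) = H.cliqueSize N c :=
      card_residualClique_add hN hf' c
    rw [h.touched_target_eq] at htarget
    refine sum_le_sum fun l _ => ?_
    rw [card_labelClass_eq (c' := c) hH (fun _ => rfl) l,
      card_labelClass_eq (c' := c) (e := f') hH (fun _ => rfl) l, h.restClass_eq hH,
      h.touched_target_eq, h.baseProfile_eq, Nat.add_right_cancel (hsource.trans htarget.symm)]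
  · have hne' := baseProfile_union_touched_ne hA
    have hbase : H.baseProfile I f c ⊆ I := fun x hx => (mem_baseProfile.1 hx).1
    have htouched : H.touched I f c ⊆ I := fun x hx => (mem_touched.1 hx).1
    rw [extensionValue, extensionValue, sum_product, sum_product]
    refine sum_le_sum_of_two (mem_powerset.2 (union_subset hbase htouched))
      (mem_powerset.2 hbase) hne' ?_ fun T h₁ h₂ => ?_
    · simp only [h.card_labelClass_old hH hN hf hne, h.card_labelClass_new hH hN hf' hne,
        restClass_eq_empty hH hA, card_empty, hne', hne'.symm, true_and, false_and, if_false,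
        zero_add, add_zero]
      refine move_sum_le (d := d) (fun t => ?_) hdn (by omega) hac' ?_
      · rw [card_eq_zero, ← not_nonempty_iff_eq_empty, hd t, not_lt]
      · simpa only [card_eq_zero] using hc
    · simp only [h.card_labelClass_old hH hN hf hne, h.card_labelClass_new hH hN hf' hne, h₁, h₂,
        false_and, if_false]

end move

/-! ### All special pairs can be taken from the pools -/

section pools

variable {G H : CoverGraph} {N K : ℕ} {I : Finset ℕ} {f : ℕ → ℕ}

theorem exists_labelClass_nonempty_iff_lt (hG : G.IsTwinCovered) (e : ℕ → ℕ) (T : Finset ℕ) :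
    ∃ d ≤ G.n, ∀ t, (G.labelClass I e (T, t)).Nonempty ↔ t < d := by
  classical
  have hbd : ∀ t, (G.labelClass I e (T, t)).Nonempty → t < G.n := by
    rintro t ⟨u, hu⟩
    obtain ⟨hu, hl⟩ := mem_labelClass.1 hu
    have := residualRank_lt_n hu
    rwa [show G.residualRank I e u = t from congrArg Prod.snd hl] at this
  have hdown : ∀ s t, s ≤ t → (G.labelClass I e (T, t)).Nonempty →
      (G.labelClass I e (T, s)).Nonempty := by
    rintro s t hst ⟨u, hu⟩
    obtain ⟨hu, hl⟩ := mem_labelClass.1 hu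
    have h₁ := residualRank_lt hu
    rw [show G.residualRank I e u = t from congrArg Prod.snd hl] at h₁
    obtain ⟨v, hv, hs, hr⟩ := exists_residualRank_eq hG (hst.trans_lt h₁)
    refine ⟨v, mem_labelClass.2 ⟨hv, Prod.ext ?_ hr⟩⟩
    exact (profile_eq_of_sameClique hG hu hv hs).symm.trans (congrArg Prod.fst hl)
  have hex : ∃ t, ¬ (G.labelClass I e (T, t)).Nonempty := ⟨G.n, fun h => (hbd _ h).false⟩
  refine ⟨Nat.find hex, Nat.find_min' hex fun h => (hbd _ h).false, fun t => ⟨fun h => ?_, ?_⟩⟩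
  · by_contra hlt
    exact Nat.find_spec hex (hdown _ _ (not_lt.1 hlt) h)
  · exact fun h => not_not.1 (Nat.find_min hex h)

open Classical in
theorem cliqueRank_eq_keyPos (hG : G.IsTwinCovered) (hN : G.n ≤ N) {c v : ℕ}
    (hv : G.SameClique c v) :
    G.cliqueRank N v = keyPos {w ∈ range G.n | G.SameClique c w} id v := by
  rw [cliqueRank, countBelow, keyPos, filter_filter]
  congr 1
  ext w
  simp only [mem_filter, mem_range, id]
  constructor
  · rintro ⟨-, h, hlt⟩
    exact ⟨h.2.1, hv.trans hG h, hlt⟩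
  · rintro ⟨h, hs, hlt⟩
    exact ⟨h.trans_le hN, (hv.symm hG).trans hG hs, hlt⟩

open Classical in
theorem cliqueSize_eq_card (hN : G.n ≤ N) (c : ℕ) :
    G.cliqueSize N c = #{w ∈ range G.n | G.SameClique c w} := by
  rw [cliqueSize, countBelow]
  congr 1
  ext w
  simp only [mem_filter, mem_range]
  exact ⟨fun h => ⟨h.2.2.1, h.2⟩, fun h => ⟨h.1.trans_le hN, h.2⟩⟩

theorem exists_first_vertices (hG : G.IsTwinCovered) (hN : G.n ≤ N) {A : Finset ℕ} {c : ℕ}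
    (h : #A ≤ G.cliqueSize N c) :
    ∃ m : ℕ → ℕ, Set.InjOn m A ∧ ∀ x ∈ A, G.SameClique c (m x) ∧ G.cliqueRank N (m x) < #A := by
  classical
  have key : ∀ x ∈ A, ∃ v ∈ ({w ∈ range G.n | G.SameClique c w} : Finset ℕ),
      keyPos {w ∈ range G.n | G.SameClique c w} id v = keyPos A id x := by
    intro x hx
    refine exists_keyPos_eq Function.injective_id.injOn ((keyPos_lt_card hx).trans_le ?_)
    rwa [← cliqueSize_eq_card hN]
  choose! m hm hk using key
  refine ⟨m, fun x hx y hy h => ?_, fun x hx => ?_⟩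
  · refine keyPos_injOn (X := A) (key := id) Function.injective_id.injOn hx hy ?_
    rw [← hk x (mem_coe.1 hx), ← hk y (mem_coe.1 hy), h]
  · have hs := (mem_filter.1 (hm x hx)).2
    refine ⟨hs, ?_⟩
    rw [cliqueRank_eq_keyPos hG hN hs, hk x hx]
    exact keyPos_lt_card hx

theorem injOn_of_isPartialIso (hI : IsPartialIso G H (mapGraph I f)) : Set.InjOn f I :=
  fun x hx y hy h =>
  (hI.2 (x, f x) (mem_mapGraph.2 ⟨hx, rfl⟩) (y, f y) (mem_mapGraph.2 ⟨hy, rfl⟩)).1.2 h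

theorem profile_eq_of_sameType (hG : G.IsTwinCovered) (hN : G.n ≤ N) {u v : ℕ}
    (hu : u ∈ G.residual I id) (hv : v ∈ G.residual I id) (hsty : G.SameType N u v)
    (htu : ∀ x ∈ I, ¬ G.SameClique u x) (htv : ∀ x ∈ I, ¬ G.SameClique v x) :
    G.profile I id u = G.profile I id v := by
  ext x
  simp only [mem_profile, id]
  refine and_congr_right fun hx => ?_
  by_cases hS : G.cover x
  · exact hsty.iff hG hN hS
  · exact iff_of_false (fun h => htu x hx (sameClique_of_adj hG h (mem_residual.1 hu).2.1 hS))
      fun h => htv x hx (sameClique_of_adj hG h (mem_residual.1 hv).2.1 hS)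

theorem card_residualClique_eq_cliqueSize (hN : G.n ≤ N) {u : ℕ}
    (hu : ∀ x ∈ I, ¬ G.SameClique u x) : #(G.residualClique I id u) = G.cliqueSize N u := by
  classical
  have h := card_residualClique_add (e := id) hN (Function.injective_id.injOn (s := (I : Set ℕ))) u
  rwa [filter_false_of_mem (p := fun x => G.SameClique u (id x)) (fun x hx => hu x hx),
    card_empty, add_zero] at h

theorem card_residualClique_eq_of_residualRank_add_one (hG : G.IsTwinCovered) {e : ℕ → ℕ}
    {T : Finset ℕ} {d u : ℕ} (hd : ∀ t, (G.labelClass I e (T, t)).Nonempty ↔ t < d)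
    (hu : u ∈ G.residual I e) (hT : G.profile I e u = T) (hr : G.residualRank I e u + 1 = d) :
    #(G.residualClique I e u) = d := by
  have hlt := residualRank_lt hu
  by_contra hne
  obtain ⟨v, hv, hs, hv'⟩ := exists_residualRank_eq hG (u := u) (I := I) (e := e) (t := d)
    (by omega)
  have hl : G.label I e v = (T, d) :=
    Prod.ext ((profile_eq_of_sameClique hG hu hv hs).symm.trans hT) hv'
  exact lt_irrefl d ((hd d).1 ⟨v, mem_labelClass.2 ⟨hv, hl⟩⟩)

theorem exists_isTop (hG : G.IsTwinCovered) (hN : G.n ≤ N) (hK : #I < K) {T : Finset ℕ} {d : ℕ}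
    (hd : ∀ t, (G.labelClass I id (T, t)).Nonempty ↔ t < d) (hpos : 0 < d)
    (hun : ∀ u ∈ G.residual I id, G.profile I id u = T → ∀ x ∈ I, ¬ G.SameClique u x) :
    ∃ w, G.IsTop N K w ∧ G.cliqueSize N w = d := by
  obtain ⟨u, hu⟩ := (hd (d - 1)).2 (by omega)
  obtain ⟨hu, hl⟩ := mem_labelClass.1 hu
  have hpu : G.profile I id u = T := congrArg Prod.fst hl
  have hru : G.residualRank I id u = d - 1 := congrArg Prod.snd hl
  have huu := hun u hu hpu
  have hcl := card_residualClique_eq_of_residualRank_add_one hG hd hu hpu (by omega)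
  obtain ⟨w, hw, hwu⟩ := exists_isLeader (N := N) hG (sameClique_self_of_mem_residual hu)
  have hww : ∀ x ∈ I, ¬ G.SameClique w x := fun x hx h => huu x hx ((hwu.symm hG).trans hG h)
  have hsw : G.cliqueSize N w = d := by
    rw [← card_residualClique_eq_cliqueSize hN hww, residualClique_eq_of_sameClique hG hwu, hcl]
  refine ⟨w, ⟨hw, lt_of_le_of_lt ?_ hK⟩, hsw⟩
  refine countBelow_touched_le (e := id) hG hN fun w' hw' => ⟨hw'.1, ?_⟩
  by_contra! hcon
  have h₂ := hw'.2.2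
  rw [hsw, ← card_residualClique_eq_cliqueSize hN hcon] at h₂
  obtain ⟨v, hv, hs, hr⟩ := exists_residualRank_eq hG h₂
  have hvu : G.SameType N u v := fun s _ hS => by
    rw [← adj_cover_iff_of_sameClique hG hwu hS, ← adj_cover_iff_of_sameClique hG hs hS,
      hw'.2.1.iff hG hN hS]
  have hpv : G.profile I id v = T := by
    rw [← profile_eq_of_sameType hG hN hu hv hvu huu fun x hx h => hcon x hx (hs.trans hG h), hpu]
  exact absurd ((hd d).1 ⟨v, mem_labelClass.2 ⟨hv, Prod.ext hpv hr⟩⟩) (lt_irrefl d)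

/-- A pair with a vertex in one of the twin covers. -/
def Special (G H : CoverGraph) (p : ℕ × ℕ) : Prop := G.cover p.1 ∨ H.cover p.2

theorem labelClass_baseProfile_eq_empty (hG : G.IsTwinCovered) {c u x : ℕ}
    (hA : (H.touched I f c).Nonempty) (hcover : ∀ x ∈ H.touched I f c, G.cover x)
    (hu : u ∈ G.residual I id)
    (hpu : G.profile I id u = H.baseProfile I f c ∪ H.touched I f c)
    (hx : x ∈ I) (hux : G.SameClique u x) (t : ℕ) :
    G.labelClass I id (H.baseProfile I f c, t) = ∅ := by
  obtain ⟨x₀, hx₀⟩ := hA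
  have hSx : ¬ G.cover x := hux.2.2.2.1
  have hadj : G.Adj u x := adj_of_sameClique hux fun h => (mem_residual.1 hu).2.2 x hx h.symm
  have hxp : x ∈ H.baseProfile I f c := by
    have hmem : x ∈ G.profile I id u := mem_profile.2 ⟨hx, hadj⟩
    rw [hpu] at hmem
    exact (mem_union.1 hmem).resolve_right fun h => hSx (hcover x h)
  refine eq_empty_of_forall_notMem fun v hv => ?_
  obtain ⟨hv, hl⟩ := mem_labelClass.1 hv
  have hpv : G.profile I id v = H.baseProfile I f c := congrArg Prod.fst hl
  have hvx : G.Adj v x := (mem_profile.1 (hpv ▸ hxp)).2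
  have hvu : G.SameClique v u :=
    (sameClique_of_adj hG hvx (mem_residual.1 hv).2.1 hSx).trans hG (hux.symm hG)
  have hx₀' : x₀ ∈ H.baseProfile I f c := by
    rw [← hpv, profile_eq_of_sameClique hG hv hu hvu, hpu]
    exact mem_union_right _ hx₀
  exact (mem_touched.1 hx₀).2.2.2.2.1 (mem_baseProfile.1 hx₀').2.1

theorem exists_threshold (hG : G.IsTwinCovered) (hN : G.n < N) (hK : #I < K) {c d : ℕ}
    (hA : (H.touched I f c).Nonempty) (hAN : #(H.touched I f c) < N)
    (hcover : ∀ x ∈ H.touched I f c, G.cover x)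
    (hd : ∀ t, (G.labelClass I id (H.baseProfile I f c ∪ H.touched I f c, t)).Nonempty ↔ t < d) :
    ∃ θ, (∀ u, H.IsLeader N u → H.Near N K θ u → H.IsCandidateLeader N K G u) ∧
      (θ = d + #(H.touched I f c) ∨
        θ = N ∧ ∀ t, G.labelClass I id (H.baseProfile I f c, t) = ∅) := by
  have hAK : #(H.touched I f c) < K :=
    (card_le_card fun x hx => (mem_touched.1 hx).1).trans_lt hK
  by_cases hB : ∃ u ∈ G.residual I id, G.profile I id u = H.baseProfile I f c ∪ H.touched I f c ∧
      ∃ x ∈ I, G.SameClique u x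
  · obtain ⟨u, hu, hpu, x, hx, hux⟩ := hB
    exact ⟨N, fun _ h₁ h₂ => ⟨h₁, .inl h₂⟩,
      .inr ⟨rfl, labelClass_baseProfile_eq_empty hG hA hcover hu hpu hx hux⟩⟩
  · push Not at hB
    refine ⟨d + #(H.touched I f c), fun u h₁ h₂ => ⟨h₁, .inr ?_⟩, .inl rfl⟩
    rcases Nat.eq_zero_or_pos d with rfl | hpos
    · rw [zero_add] at h₂
      exact .inl ⟨_, hAN, hAK, h₂⟩
    · obtain ⟨w, hw, hsw⟩ := exists_isTop hG hN.le hK hd hpos hB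
      exact .inr ⟨w, hw.1.1.1.trans hN, _, hAN, hw, hAK, hsw ▸ h₂⟩

theorem exists_isCandidateLeader (hG : G.IsTwinCovered) (hH : H.IsTwinCovered) (hGN : G.n < N)
    (hHN : H.n < N) (hK : #I < K) {c d : ℕ} (hc : H.IsLeader N c)
    (hA : (H.touched I f c).Nonempty) (hAc : #(H.touched I f c) ≤ H.cliqueSize N c)
    (hcover : ∀ x ∈ H.touched I f c, G.cover x)
    (hd : ∀ t, (G.labelClass I id (H.baseProfile I f c ∪ H.touched I f c, t)).Nonempty ↔ t < d) :
    ∃ c', H.IsCandidateLeader N K G c' ∧ H.SameType N c c' ∧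
      (c' = c ∨ ∀ x ∈ I, ¬ H.SameClique c' (f x)) ∧
      (d + #(H.touched I f c) ≤ H.cliqueSize N c' ∧ H.cliqueSize N c' ≤ H.cliqueSize N c ∨
        H.cliqueSize N c ≤ H.cliqueSize N c' ∧ H.cliqueSize N c' ≤ d + #(H.touched I f c) ∨
        H.cliqueSize N c ≤ H.cliqueSize N c' ∧
          ∀ t, G.labelClass I id (H.baseProfile I f c, t) = ∅) := by
  have hsize : ∀ w, H.cliqueSize N w < N := fun w => (cliqueSize_le hHN.le w).trans_lt hHN
  obtain ⟨θ, hcand, hθ⟩ := exists_threshold hG hGN hK hA (hAc.trans_lt (hsize c)) hcover hd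
  obtain ⟨c', hc', htype, hfree, hnear, hside⟩ := exists_near (e := f) hH hHN.le hK hc θ
  refine ⟨c', hcand c' hc' hnear, htype, hfree, ?_⟩
  rcases hθ with rfl | ⟨rfl, hempty⟩
  · exact hside.imp_right .inl
  · have := hsize c'
    exact .inr (.inr ⟨by omega, hempty⟩)

theorem exists_move (hH : H.IsTwinCovered) (hN : H.n ≤ N) {c c' : ℕ} (hc : H.IsLeader N c)
    (hc' : H.IsLeader N c') (htype : H.SameType N c c')
    (hfree : c' = c ∨ ∀ x ∈ I, ¬ H.SameClique c' (f x))
    (hA : #(H.touched I f c) ≤ H.cliqueSize N c') :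
    ∃ f', Move H N I f f' c c' ∧ Set.InjOn f' (H.touched I f c) ∧
      ∀ x ∈ H.touched I f c, H.cliqueRank N (f' x) < #(H.touched I f c) := by
  classical
  obtain ⟨m, hinj, hm⟩ := exists_first_vertices hH hN hA
  have heq : Set.EqOn (fun x => if x ∈ H.touched I f c then m x else f x) m (H.touched I f c) :=
    fun x hx => if_pos hx
  refine ⟨fun x => if x ∈ H.touched I f c then m x else f x,
    ⟨hc, hc', htype, hfree, fun x _ hn => if_neg fun h => hn (mem_touched.1 h).2,
      fun x hx hs => ?_⟩, heq.injOn_iff.2 hinj, fun x hx => ?_⟩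
  · have hxA := mem_touched.2 ⟨hx, hs⟩
    simpa only [if_pos hxA] using (hm x hxA).1
  · simpa only [if_pos hx] using (hm x hx).2

theorem exists_improvement (hG : G.IsTwinCovered) (hH : H.IsTwinCovered) (hGN : G.n < N)
    (hHN : H.n < N) (hK : #I < K) (hI : IsPartialIso G H (mapGraph I f))
    (hsp : ∀ x ∈ I, Special G H (x, f x)) {x₀ : ℕ} (hx₀ : x₀ ∈ I)
    (hbad : ¬ H.InPool N K G (f x₀)) : ∃ f', IsPartialIso G H (mapGraph I f') ∧
      (∀ x ∈ I, Special G H (x, f' x)) ∧ extensionValue G H I f ≤ extensionValue G H I f' ∧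
      (∀ x ∈ I, H.InPool N K G (f x) → H.InPool N K G (f' x)) ∧ H.InPool N K G (f' x₀) := by
  classical
  obtain ⟨c, hc, hcx⟩ := exists_isLeader (N := N) hH (sameClique_refl
    (hI.1 (x₀, f x₀) (mem_mapGraph.2 ⟨hx₀, rfl⟩)).2 fun h => hbad (.inl h))
  have hx₀A : x₀ ∈ H.touched I f c := mem_touched.2 ⟨hx₀, hcx⟩
  have hcover : ∀ x ∈ H.touched I f c, G.cover x := fun x hx =>
    (hsp x (mem_touched.1 hx).1).resolve_right (mem_touched.1 hx).2.2.2.2.1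
  have hAK : #(H.touched I f c) < K :=
    (card_le_card fun x hx => (mem_touched.1 hx).1).trans_lt hK
  have hinj := injOn_of_isPartialIso hI
  have hAc : #(H.touched I f c) ≤ H.cliqueSize N c :=
    (Nat.le_add_left _ _).trans (card_residualClique_add hHN.le hinj c).le
  obtain ⟨d, hdn, hd⟩ := exists_labelClass_nonempty_iff_lt (I := I) hG id
    (H.baseProfile I f c ∪ H.touched I f c)
  obtain ⟨c', hcand, htype, hfree, hsize⟩ :=
    exists_isCandidateLeader hG hH hGN hHN hK hc ⟨x₀, hx₀A⟩ hAc hcover hd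
  have hAc' : #(H.touched I f c) ≤ H.cliqueSize N c' := by omega
  obtain ⟨f', hmove, hinj', hrank⟩ := exists_move hH hHN.le hc hcand.1 htype hfree hAc'
  have hI' := hmove.isPartialIso hG hH hHN.le hinj' hI
  have hpool : ∀ x ∈ H.touched I f c, H.InPool N K G (f' x) := fun x hx =>
    .inr ⟨(hrank x hx).trans hAK, c', hcand.1.1.1.trans hHN,
      hmove.sameClique x (mem_touched.1 hx).1 (mem_touched.1 hx).2, hcand⟩
  have heq : ∀ x ∈ I, x ∉ H.touched I f c → f' x = f x := fun x hx hxA =>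
    hmove.eq x hx fun hs => hxA (mem_touched.2 ⟨hx, hs⟩)
  refine ⟨f', hI', fun x hx => ?_, ?_, fun x hx h => ?_, hpool x₀ hx₀A⟩
  · by_cases hxA : x ∈ H.touched I f c
    · exact .inl (hcover x hxA)
    · exact heq x hx hxA ▸ hsp x hx
  · exact hmove.extensionValue_le hH hHN.le hinj (injOn_of_isPartialIso hI') ⟨x₀, hx₀A⟩ hd hdn
      hAc' hsize
  · by_cases hxA : x ∈ H.touched I f c
    · exact hpool x hxA
    · exact (heq x hx hxA).symm ▸ h

theorem exists_all_inPool (hG : G.IsTwinCovered) (hH : H.IsTwinCovered) (hGN : G.n < N)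
    (hHN : H.n < N) (hK : #I < K) (hI : IsPartialIso G H (mapGraph I f))
    (hsp : ∀ x ∈ I, Special G H (x, f x)) : ∃ f', IsPartialIso G H (mapGraph I f') ∧
      extensionValue G H I f ≤ extensionValue G H I f' ∧ ∀ x ∈ I, H.InPool N K G (f' x) := by
  classical
  induction hn : #{x ∈ I | ¬ H.InPool N K G (f x)} using Nat.strong_induction_on
    generalizing f with
  | _ n ih =>
    by_cases hall : ∀ x ∈ I, H.InPool N K G (f x)
    · exact ⟨f, hI, le_rfl, hall⟩
    push Not at hall
    obtain ⟨x₀, hx₀, hbad⟩ := hall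
    obtain ⟨f₁, hI₁, hsp₁, hle, hmono, hgood⟩ := exists_improvement hG hH hGN hHN hK hI hsp hx₀ hbad
    obtain ⟨f₂, hI₂, hle₂, hall₂⟩ := ih _ (by
      rw [← hn]
      refine card_lt_card ⟨fun x hx => ?_, fun hsub => ?_⟩
      · obtain ⟨hx, hp⟩ := mem_filter.1 hx
        exact mem_filter.2 ⟨hx, fun h => hp (hmono x hx h)⟩
      · exact (mem_filter.1 (hsub (mem_filter.2 ⟨hx₀, hbad⟩))).2 hgood) hI₁ hsp₁ rfl
    exact ⟨f₂, hI₂, hle.trans hle₂, hall₂⟩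

theorem card_le_of_special (hI : IsPartialIso G H (mapGraph I f)) (hGN : G.n ≤ N) (hHN : H.n ≤ N)
    (hsp : ∀ x ∈ I, Special G H (x, f x)) :
    #I ≤ countBelow N G.cover + countBelow N H.cover := by
  classical
  have hlt : ∀ x ∈ I, x < G.n ∧ f x < H.n := fun x hx =>
    hI.1 (x, f x) (mem_mapGraph.2 ⟨hx, rfl⟩)
  rw [← card_filter_add_card_filter_not (s := I) (fun x => G.cover x)]
  refine add_le_add (card_le_card fun x hx => ?_)
    (card_le_card_of_injOn f (fun x hx => ?_) ((injOn_of_isPartialIso hI).mono (filter_subset _ _)))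
  · obtain ⟨hx, hc⟩ := mem_filter.1 hx
    exact mem_filter.2 ⟨mem_range.2 ((hlt x hx).1.trans_le hGN), hc⟩
  · obtain ⟨hx, hc⟩ := mem_filter.1 (mem_coe.1 hx)
    exact mem_coe.2 (mem_filter.2 ⟨mem_range.2 ((hlt x hx).2.trans_le hHN),
      (hsp x hx).resolve_left hc⟩)

open Classical in
theorem IsPartialIso.exists_mapGraph_eq_special {φ : Finset (ℕ × ℕ)} (h : IsPartialIso G H φ) :
    ∃ I f, mapGraph I f = {p ∈ φ | Special G H p} := by
  have key : ∀ x ∈ ({p ∈ φ | Special G H p} : Finset (ℕ × ℕ)).image Prod.fst,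
      ∃ y, (x, y) ∈ φ ∧ Special G H (x, y) := by
    intro x hx
    obtain ⟨p, hp, rfl⟩ := mem_image.1 hx
    exact ⟨p.2, (mem_filter.1 hp).1, (mem_filter.1 hp).2⟩
  choose! f hf hs using key
  refine ⟨({p ∈ φ | Special G H p} : Finset (ℕ × ℕ)).image Prod.fst, f, ext fun p => ?_⟩
  rw [mem_mapGraph]
  constructor
  · rintro ⟨h₁, h₂⟩
    rw [show p = (p.1, f p.1) from Prod.ext rfl h₂]
    exact mem_filter.2 ⟨hf _ h₁, hs _ h₁⟩
  · intro hp
    have h₁ := mem_image_of_mem Prod.fst hp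
    exact ⟨h₁, (h.2 p (mem_filter.1 hp).1 _ (hf _ h₁)).1.1 rfl⟩

theorem IsPartialIso.exists_special {φ : Finset (ℕ × ℕ)} (hG : G.IsTwinCovered)
    (hH : H.IsTwinCovered) (h : IsPartialIso G H φ) : ∃ I f, IsPartialIso G H (mapGraph I f) ∧
      (∀ x ∈ I, (x, f x) ∈ φ ∧ Special G H (x, f x)) ∧ #φ ≤ #I + extensionValue G H I f := by
  classical
  obtain ⟨I, f, hIf⟩ := h.exists_mapGraph_eq_special
  have hmem : ∀ x ∈ I, (x, f x) ∈ φ ∧ Special G H (x, f x) := fun x hx =>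
    mem_filter.1 (hIf ▸ mem_mapGraph.2 ⟨hx, rfl⟩ : (x, f x) ∈ {p ∈ φ | Special G H p})
  have hφ : mapGraph I f ∪ {p ∈ φ | ¬ Special G H p} = φ := by
    rw [hIf, filter_union_filter_not_eq]
  refine ⟨I, f, h.mono (hIf ▸ filter_subset _ _), hmem, ?_⟩
  have hext := card_extension_le (ψ := {p ∈ φ | ¬ Special G H p}) hG hH (fun p hp => ?_)
    (hφ.symm ▸ h)
  · calc #φ = #(mapGraph I f ∪ {p ∈ φ | ¬ Special G H p}) := by rw [hφ]
      _ ≤ #(mapGraph I f) + #{p ∈ φ | ¬ Special G H p} := card_union_le _ _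
      _ ≤ #I + extensionValue G H I f := by rw [card_mapGraph]; gcongr
  · obtain ⟨hp, hns⟩ := mem_filter.1 hp
    obtain ⟨h₁, h₂⟩ := not_or.1 hns
    refine ⟨mem_residual.2 ⟨(h.1 p hp).1, h₁, fun x hx he => ?_⟩,
      mem_residual.2 ⟨(h.1 p hp).2, h₂, fun x hx he => ?_⟩⟩
    · have : p = (x, f x) := h.injOn_fst hp (hmem x hx).1 he.symm
      exact hns (this ▸ (hmem x hx).2)
    · have : p = (x, f x) := h.injOn_snd hp (hmem x hx).1 he.symm
      exact hns (this ▸ (hmem x hx).2)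

theorem exists_inPool_right (hG : G.IsTwinCovered) (hH : H.IsTwinCovered) (hGN : G.n < N)
    (hHN : H.n < N) (hK : countBelow N G.cover + countBelow N H.cover < K) {φ : Finset (ℕ × ℕ)}
    (h : IsPartialIso G H φ) : ∃ φ', IsPartialIso G H φ' ∧ #φ ≤ #φ' ∧ ∀ p ∈ φ', Special G H p →
      H.InPool N K G p.2 ∧ ∃ q ∈ φ, Special G H q ∧ q.1 = p.1 := by
  classical
  obtain ⟨I, f, hI, hmem, hle⟩ := h.exists_special hG hH
  have hsp : ∀ x ∈ I, Special G H (x, f x) := fun x hx => (hmem x hx).2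
  have hIK : #I < K := (card_le_of_special hI hGN.le hHN.le hsp).trans_lt hK
  obtain ⟨f', hI', hle', hpool⟩ := exists_all_inPool hG hH hGN hHN hIK hI hsp
  obtain ⟨ψ, hψ, hpi, hcard⟩ := exists_extension hG hH hI'
  refine ⟨_, hpi, by omega, fun p hp hs => ?_⟩
  rcases mem_union.1 hp with hp | hp
  · obtain ⟨hx, hy⟩ := mem_mapGraph.1 hp
    exact ⟨hy ▸ hpool _ hx, _, (hmem _ hx).1, (hmem _ hx).2, rfl⟩
  · obtain ⟨h₁, h₂⟩ := hψ p hp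
    rcases hs with hs | hs
    · exact absurd hs (mem_residual.1 h₁).2.1
    · exact absurd hs (mem_residual.1 h₂).2.1

theorem IsPartialIso.swap {φ : Finset (ℕ × ℕ)} (h : IsPartialIso G H φ) :
    IsPartialIso H G (φ.image Prod.swap) := by
  refine ⟨fun p hp => ?_, fun p hp q hq => ?_⟩
  · obtain ⟨p', hp', rfl⟩ := mem_image.1 hp
    exact (h.1 p' hp').symm
  · obtain ⟨p', hp', rfl⟩ := mem_image.1 hp
    obtain ⟨q', hq', rfl⟩ := mem_image.1 hq
    exact ⟨(h.2 p' hp' q' hq').1.symm, (h.2 p' hp' q' hq').2.symm⟩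

theorem exists_inPool_map (hG : G.IsTwinCovered) (hH : H.IsTwinCovered) (hGN : G.n < N)
    (hHN : H.n < N) (hK : countBelow N G.cover + countBelow N H.cover < K) {φ : Finset (ℕ × ℕ)}
    (h : IsPartialIso G H φ) : ∃ I f, IsPartialIso G H (mapGraph I f) ∧
      (∀ x ∈ I, G.InPool N K H x ∧ H.InPool N K G (f x)) ∧ #φ ≤ #I + extensionValue G H I f := by
  obtain ⟨φ₁, hφ₁, hcard₁, hpool₁⟩ := exists_inPool_right hG hH hGN hHN hK h
  obtain ⟨φ₂, hφ₂, hcard₂, hpool₂⟩ := exists_inPool_right hH hG hHN hGN (K := K)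
    (by rwa [add_comm]) hφ₁.swap
  rw [card_image_of_injective _ Prod.swap_injective] at hcard₂
  obtain ⟨I, f, hI, hmem, hle⟩ := hφ₂.swap.exists_special hG hH
  rw [card_image_of_injective _ Prod.swap_injective] at hle
  refine ⟨I, f, hI, fun x hx => ?_, by omega⟩
  obtain ⟨hx, hs⟩ := hmem x hx
  obtain ⟨q, hq, hqx⟩ := mem_image.1 hx
  obtain rfl : q = (f x, x) := by rw [← Prod.swap_swap q, hqx, Prod.swap_prod_mk]
  obtain ⟨hxpool, r, hr, hrs, hrq⟩ := hpool₂ _ hq hs.symm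
  obtain ⟨r', hr', rfl⟩ := mem_image.1 hr
  refine ⟨hxpool, ?_⟩
  have := (hpool₁ r' hr' hrs.symm).1
  rwa [show r'.2 = f x from hrq] at this

end pools

/-! ### The value in terms of bounded counting -/

section value

section defs

variable (G H : CoverGraph) (N : ℕ) (D : ℕ → Prop) (R : ℕ → ℕ → Prop)

/-- `u` is outside the twin cover and does not satisfy `D`. If `D` describes the vertices taken out,
this is membership in `residual`. -/
def InResidual (u : ℕ) : Prop := u < G.n ∧ ¬ G.cover u ∧ ¬ D u

/-- The position of `u` in the remaining part of its clique. -/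
noncomputable def relResidualRank (u : ℕ) : ℕ :=
  countBelow N fun v => (G.InResidual D v ∧ G.SameClique u v) ∧ v < u

/-- `x` is in the domain of the relation. -/
def InDomain (x : ℕ) : Prop := SomeBelow N fun y => R x y

/-- `y` is in the range of the relation. -/
def InRange (y : ℕ) : Prop := SomeBelow N fun x => R x y

/-- The relation is a partial isomorphism. -/
def IsPartialIsoRel : Prop :=
  AllBelow N fun x => AllBelow N fun y => AllBelow N fun u => AllBelow N fun v =>
    R x y ∧ R u v → (x = u ↔ y = v) ∧ (G.Adj x u ↔ H.Adj y v)

/-- Two vertices of the first graph have the same label. -/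
def SameLabel (u v : ℕ) : Prop :=
  (AllBelow N fun x => InDomain N R x → (G.Adj u x ↔ G.Adj v x)) ∧
    G.relResidualRank N (InDomain N R) u = G.relResidualRank N (InDomain N R) v

/-- A vertex of the first graph and one of the second have the same label. -/
def MatchingLabels (u v : ℕ) : Prop :=
  (AllBelow N fun x => AllBelow N fun y => R x y → (G.Adj u x ↔ H.Adj v y)) ∧
    G.relResidualRank N (InDomain N R) u = H.relResidualRank N (InRange N R) v

/-- The vertex `u` is matched in a largest extension, when the vertices with the same label are
matched in their order. -/
def IsMatched (u : ℕ) : Prop :=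
  G.InResidual (InDomain N R) u ∧
    countBelow N (fun v => (G.InResidual (InDomain N R) v ∧ G.SameLabel N R v u) ∧ v < u) <
      countBelow N fun v => H.InResidual (InRange N R) v ∧ MatchingLabels G H N R u v

/-- The size of a largest extension of the relation, in the form in which the machine computes
it. -/
noncomputable def relValue : ℕ := countBelow N (InDomain N R) + countBelow N (IsMatched G H N R)

end defs

variable {G H : CoverGraph} {N : ℕ} {I : Finset ℕ} {e f : ℕ → ℕ} {D : ℕ → Prop} {R : ℕ → ℕ → Prop}

theorem inResidual_iff (hD : ∀ u < N, D u ↔ ∃ x ∈ I, e x = u) (hN : G.n ≤ N) {u : ℕ} :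
    G.InResidual D u ↔ u ∈ G.residual I e := by
  rw [InResidual, mem_residual]
  refine and_congr_right fun h => and_congr_right fun _ => ?_
  rw [hD u (h.trans_le hN)]
  push Not
  rfl

theorem relResidualRank_eq (hD : ∀ u < N, D u ↔ ∃ x ∈ I, e x = u) (hN : G.n ≤ N) (u : ℕ) :
    G.relResidualRank N D u = G.residualRank I e u := by
  classical
  rw [relResidualRank, residualRank, countBelow, keyPos, residualClique, filter_filter]
  congr 1
  ext v
  simp only [mem_filter, mem_range, id, inResidual_iff hD hN]
  constructor
  · rintro ⟨-, ⟨h₁, h₂⟩, h₃⟩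
    exact ⟨h₁, h₂, h₃⟩
  · rintro ⟨h₁, h₂, h₃⟩
    exact ⟨h₂.2.1.trans_le hN, ⟨h₁, h₂⟩, h₃⟩

open Classical in
theorem extensionValue_eq_card : extensionValue G H I f =
    #{u ∈ G.residual I id | keyPos (G.labelClass I id (G.label I id u)) id u <
      #(H.labelClass I f (G.label I id u))} := by
  rw [extensionValue, card_eq_sum_card_fiberwise (f := G.label I id) (t := I.powerset ×ˢ range G.n)
    fun u hu => mem_coe.2 (label_mem (mem_filter.1 (mem_coe.1 hu)).1)]
  refine sum_congr rfl fun l _ => ?_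
  rw [← card_keyPos_lt (X := G.labelClass I id l) (key := id) Function.injective_id.injOn]
  congr 1
  ext u
  simp only [mem_filter, mem_labelClass]
  constructor
  · rintro ⟨⟨h₁, rfl⟩, h₂⟩
    exact ⟨⟨h₁, h₂⟩, rfl⟩
  · rintro ⟨⟨h₁, h₂⟩, rfl⟩
    exact ⟨⟨h₁, rfl⟩, h₂⟩

/-- Below `N`, the relation `R` is the graph of the function `f` on `I`. -/
structure IsGraphBelow (N : ℕ) (R : ℕ → ℕ → Prop) (I : Finset ℕ) (f : ℕ → ℕ) : Prop where
  lt : ∀ x ∈ I, x < N ∧ f x < N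
  iff : ∀ x < N, ∀ y < N, R x y ↔ x ∈ I ∧ y = f x

namespace IsGraphBelow

theorem rel (h : IsGraphBelow N R I f) {x : ℕ} (hx : x ∈ I) : R x (f x) :=
  (h.iff x (h.lt x hx).1 (f x) (h.lt x hx).2).2 ⟨hx, rfl⟩

theorem inDomain_iff (h : IsGraphBelow N R I f) {x : ℕ} (hx : x < N) :
    InDomain N R x ↔ x ∈ I :=
  ⟨fun ⟨y, hy, hr⟩ => ((h.iff x hx y hy).1 hr).1, fun hxI => ⟨f x, (h.lt x hxI).2, h.rel hxI⟩⟩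

theorem inDomain_iff_exists (h : IsGraphBelow N R I f) (x : ℕ) (hx : x < N) :
    InDomain N R x ↔ ∃ y ∈ I, id y = x := by
  simp [h.inDomain_iff hx]

theorem inRange_iff_exists (h : IsGraphBelow N R I f) (y : ℕ) (hy : y < N) :
    InRange N R y ↔ ∃ x ∈ I, f x = y := by
  constructor
  · rintro ⟨x, hx, hr⟩
    exact ⟨x, ((h.iff x hx y hy).1 hr).1, ((h.iff x hx y hy).1 hr).2.symm⟩
  · rintro ⟨x, hx, rfl⟩
    exact ⟨x, (h.lt x hx).1, h.rel hx⟩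

theorem sameLabel_iff (h : IsGraphBelow N R I f) (hGN : G.n ≤ N) {u v : ℕ} :
    G.SameLabel N R v u ↔ G.label I id v = G.label I id u := by
  rw [SameLabel, relResidualRank_eq h.inDomain_iff_exists hGN,
    relResidualRank_eq h.inDomain_iff_exists hGN, label, label, Prod.mk.injEq]
  refine and_congr_left fun _ => ?_
  simp only [Finset.ext_iff, mem_profile, id]
  constructor
  · exact fun hN x => and_congr_right fun hx =>
      hN x (h.lt x hx).1 ((h.inDomain_iff (h.lt x hx).1).2 hx)
  · exact fun hI x hx hd => by simpa [(h.inDomain_iff hx).1 hd] using hI x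

theorem matchingLabels_iff (h : IsGraphBelow N R I f) (hGN : G.n ≤ N) (hHN : H.n ≤ N) {u v : ℕ} :
    MatchingLabels G H N R u v ↔ H.label I f v = G.label I id u := by
  rw [MatchingLabels, relResidualRank_eq h.inDomain_iff_exists hGN,
    relResidualRank_eq h.inRange_iff_exists hHN, eq_comm (a := H.label I f v), label, label,
    Prod.mk.injEq]
  refine and_congr_left fun _ => ?_
  simp only [Finset.ext_iff, mem_profile, id]
  constructor
  · exact fun hN x => and_congr_right fun hx =>
      hN x (h.lt x hx).1 (f x) (h.lt x hx).2 (h.rel hx)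
  · intro hI x hx y hy hr
    obtain ⟨hxI, rfl⟩ := (h.iff x hx y hy).1 hr
    simpa [hxI] using hI x

theorem isMatched_iff (h : IsGraphBelow N R I f) (hGN : G.n ≤ N) (hHN : H.n ≤ N) {u : ℕ} :
    IsMatched G H N R u ↔ u ∈ G.residual I id ∧
      keyPos (G.labelClass I id (G.label I id u)) id u <
        #(H.labelClass I f (G.label I id u)) := by
  classical
  have hpos : countBelow N (fun v => (v ∈ G.residual I id ∧ G.SameLabel N R v u) ∧ v < u) =
      keyPos (G.labelClass I id (G.label I id u)) id u := by
    rw [countBelow, keyPos, labelClass, filter_filter]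
    congr 1
    ext v
    simp only [mem_filter, mem_range, id, h.sameLabel_iff hGN]
    constructor
    · rintro ⟨-, ⟨hv, hl⟩, hlt⟩
      exact ⟨hv, hl, hlt⟩
    · rintro ⟨hv, hl, hlt⟩
      exact ⟨(mem_residual.1 hv).1.trans_le hGN, ⟨hv, hl⟩, hlt⟩
  have hcard : countBelow N (fun v => v ∈ H.residual I f ∧ MatchingLabels G H N R u v) =
      #(H.labelClass I f (G.label I id u)) := by
    rw [countBelow]
    congr 1
    ext v
    simp only [mem_filter, mem_range, mem_labelClass, h.matchingLabels_iff hGN hHN]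
    exact ⟨fun hv => hv.2, fun hv => ⟨(mem_residual.1 hv.1).1.trans_le hHN, hv⟩⟩
  simp only [IsMatched, inResidual_iff h.inDomain_iff_exists hGN,
    inResidual_iff h.inRange_iff_exists hHN, hpos, hcard]

theorem relValue_eq (h : IsGraphBelow N R I f) (hGN : G.n ≤ N) (hHN : H.n ≤ N) :
    relValue G H N R = #I + extensionValue G H I f := by
  classical
  rw [relValue, extensionValue_eq_card]
  congr 1
  · rw [countBelow]
    congr 1
    ext x
    simp only [mem_filter, mem_range]
    exact ⟨fun hx => (h.inDomain_iff hx.1).1 hx.2,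
      fun hx => ⟨(h.lt x hx).1, (h.inDomain_iff (h.lt x hx).1).2 hx⟩⟩
  · rw [countBelow]
    congr 1
    ext u
    simp only [mem_filter, mem_range, h.isMatched_iff hGN hHN]
    exact ⟨fun hu => hu.2, fun hu => ⟨(mem_residual.1 hu.1).1.trans_le hGN, hu⟩⟩

theorem isPartialIso (h : IsGraphBelow N R I f) (hlt : ∀ x y, R x y → x < G.n ∧ y < H.n)
    (hpi : IsPartialIsoRel G H N R) : IsPartialIso G H (mapGraph I f) := by
  refine ⟨fun p hp => ?_, fun p hp q hq => ?_⟩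
  · obtain ⟨hx, hy⟩ := mem_mapGraph.1 hp
    rw [hy]
    exact hlt _ _ (h.rel hx)
  · obtain ⟨hx, hy⟩ := mem_mapGraph.1 hp
    obtain ⟨hx', hy'⟩ := mem_mapGraph.1 hq
    rw [hy, hy']
    exact hpi _ (h.lt _ hx).1 _ (h.lt _ hx).2 _ (h.lt _ hx').1 _ (h.lt _ hx').2
      ⟨h.rel hx, h.rel hx'⟩

theorem isPartialIsoRel (h : IsGraphBelow N R I f) (hI : IsPartialIso G H (mapGraph I f)) :
    IsPartialIsoRel G H N R := by
  rintro x hx y hy x' hx' y' hy' ⟨hr, hr'⟩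
  exact hI.2 (x, y) (mem_mapGraph.2 ((h.iff x hx y hy).1 hr)) (x', y')
    (mem_mapGraph.2 ((h.iff x' hx' y' hy').1 hr'))

end IsGraphBelow

theorem exists_isGraphBelow (hpi : IsPartialIsoRel G H N R) : ∃ I f, IsGraphBelow N R I f := by
  classical
  have hex : ∀ x, InDomain N R x → ∃ y < N, R x y := fun x h => h
  choose! f hfN hf using hex
  refine ⟨{x ∈ range N | InDomain N R x}, f, fun x hx => ?_, fun x hx y hy => ⟨fun h => ?_, ?_⟩⟩
  · obtain ⟨hxN, hd⟩ := mem_filter.1 hx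
    exact ⟨mem_range.1 hxN, hfN x hd⟩
  · have hd : InDomain N R x := ⟨y, hy, h⟩
    exact ⟨mem_filter.2 ⟨mem_range.2 hx, hd⟩,
      (hpi x hx y hy x hx (f x) (hfN x hd) ⟨h, hf x hd⟩).1.1 rfl⟩
  · rintro ⟨h, rfl⟩
    exact hf x (mem_filter.1 h).2

theorem exists_isPartialIso_of_isPartialIsoRel (hG : G.IsTwinCovered) (hH : H.IsTwinCovered)
    (hGN : G.n ≤ N) (hHN : H.n ≤ N) (hlt : ∀ x y, R x y → x < G.n ∧ y < H.n)
    (hpi : IsPartialIsoRel G H N R) : ∃ φ, IsPartialIso G H φ ∧ relValue G H N R ≤ #φ := by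
  obtain ⟨I, f, hR⟩ := exists_isGraphBelow hpi
  obtain ⟨ψ, -, h, hcard⟩ := exists_extension hG hH (hR.isPartialIso hlt hpi)
  exact ⟨_, h, (hR.relValue_eq hGN hHN).trans_le hcard⟩

end value

/-! ### The pools are small -/

section poolSize

/-- A bound for the number of cliques near a threshold on one side. -/
def classBound (K : ℕ) : ℕ := 2 ^ K * K

/-- A bound for the number of thresholds. -/
def thresholdBound (K : ℕ) : ℕ := 1 + K + classBound K * K

/-- A bound for the sizes of the pools. -/
def poolBound (K : ℕ) : ℕ := K + thresholdBound K * (classBound K + classBound K) * K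

theorem card_image_le_of_inj {α : Type*} {X : Finset ℕ} {T : Finset α} {K : ℕ} {g r : ℕ → ℕ}
    {τ : ℕ → α} (hT : ∀ u ∈ X, τ u ∈ T) (hr : ∀ u ∈ X, r u < K)
    (h : ∀ u ∈ X, ∀ v ∈ X, τ u = τ v → r u = r v → g u = g v) :
    #(X.image g) ≤ #T * K := by
  classical
  have key : ∀ s ∈ X.image g, ∃ u ∈ X, g u = s := fun s hs => by simpa using hs
  choose! m hm hg using key
  rw [← card_range K, ← card_product]
  refine card_le_card_of_injOn (fun s => (τ (m s), r (m s))) (fun s hs => ?_)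
    fun s hs t ht he => ?_
  · have := hm s (mem_coe.1 hs)
    exact mem_coe.2 (mem_product.2 ⟨hT _ this, mem_range.2 (hr _ this)⟩)
  · rw [← hg s (mem_coe.1 hs), ← hg t (mem_coe.1 ht)]
    exact h _ (hm s (mem_coe.1 hs)) _ (hm t (mem_coe.1 ht)) (congrArg Prod.fst he)
      (congrArg Prod.snd he)

variable {G H : CoverGraph} {N K : ℕ}

open Classical in
/-- The neighbors in the twin cover. -/
noncomputable def coverType (G : CoverGraph) (N u : ℕ) : Finset ℕ :=
  {s ∈ range N | G.cover s ∧ G.Adj u s}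

theorem sameType_of_coverType_eq {u v : ℕ} (h : G.coverType N u = G.coverType N v) :
    G.SameType N u v := by
  intro s hs hS
  have := Finset.ext_iff.1 h s
  simpa [coverType, hs, hS] using this

open Classical in
theorem coverType_mem_powerset (u : ℕ) :
    G.coverType N u ∈ ({s ∈ range N | G.cover s} : Finset ℕ).powerset := by
  refine mem_powerset.2 fun s hs => ?_
  obtain ⟨h₁, h₂⟩ := mem_filter.1 hs
  exact mem_filter.2 ⟨h₁, h₂.1⟩

theorem sizeBefore_trans {u v w : ℕ} (h : G.SizeBefore N u v) (h' : G.SizeBefore N v w) :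
    G.SizeBefore N u w := by
  unfold SizeBefore at *
  omega

theorem sizeBefore_irrefl (u : ℕ) : ¬ G.SizeBefore N u u := by
  unfold SizeBefore
  omega

theorem sizeBefore_total {u v : ℕ} (h : u ≠ v) : G.SizeBefore N u v ∨ G.SizeBefore N v u := by
  unfold SizeBefore
  omega

theorem SameType.symm {u v : ℕ} (h : G.SameType N u v) : G.SameType N v u :=
  fun s hs hS => (h s hs hS).symm

theorem IsLeader.lt (hN : G.n ≤ N) {u : ℕ} (h : G.IsLeader N u) : u < N := h.1.1.trans_le hN

open Classical in
theorem card_powerset_cover_mul_le (hS : countBelow N G.cover ≤ K) :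
    #({s ∈ range N | G.cover s} : Finset ℕ).powerset * K ≤ classBound K := by
  rw [card_powerset]
  exact Nat.mul_le_mul_right _ (Nat.pow_le_pow_right (by omega) hS)

theorem card_image_le_of_countBelow_lt (hN : G.n ≤ N) (hS : countBelow N G.cover ≤ K)
    {X : Finset ℕ} {P : ℕ → Prop} {B : ℕ → ℕ → Prop} {g : ℕ → ℕ} (hirrefl : ∀ u, ¬ B u u)
    (htrans : ∀ u v w, B u v → B v w → B u w)
    (htotal : ∀ u w, P u → P w → g u ≠ g w → B u w ∨ B w u)
    (hX : ∀ u ∈ X, G.IsLeader N u ∧ P u ∧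
      countBelow N (fun v => G.IsLeader N v ∧ G.SameType N u v ∧ B v u) < K) :
    #(X.image g) ≤ classBound K := by
  classical
  refine le_trans ?_ (card_powerset_cover_mul_le hS)
  refine card_image_le_of_inj (τ := G.coverType N)
    (r := fun u => countBelow N (fun v => G.IsLeader N v ∧ G.SameType N u v ∧ B v u))
    (fun u _ => coverType_mem_powerset u) (fun u hu => (hX u hu).2.2) fun u hu w hw ht hr => ?_
  have hlt : ∀ u w, G.IsLeader N u → G.SameType N u w → B u w →
      countBelow N (fun v => G.IsLeader N v ∧ G.SameType N u v ∧ B v u) <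
        countBelow N (fun v => G.IsLeader N v ∧ G.SameType N w v ∧ B v w) :=
    fun u w hu hs hb => countBelow_lt_countBelow (w := u)
      (fun v hv => ⟨hv.1, hs.symm.trans hv.2.1, htrans _ _ _ hv.2.2 hb⟩) (hu.lt hN)
      ⟨hu, hs.symm, hb⟩ fun h => hirrefl u h.2.2
  obtain ⟨hu, hPu, -⟩ := hX u hu
  obtain ⟨hw, hPw, -⟩ := hX w hw
  by_contra hne
  rcases htotal u w hPu hPw hne with hb | hb
  · exact (hlt u w hu (sameType_of_coverType_eq ht) hb).ne hr
  · exact (hlt w u hw (sameType_of_coverType_eq ht.symm) hb).ne' hr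

open Classical in
theorem card_nearAbove_le (hN : G.n ≤ N) (hS : countBelow N G.cover ≤ K) (θ : ℕ) :
    #{u ∈ range N | G.IsLeader N u ∧ G.NearAbove N K θ u} ≤ classBound K := by
  rw [← image_id (s := {u ∈ range N | G.IsLeader N u ∧ G.NearAbove N K θ u})]
  exact card_image_le_of_countBelow_lt hN hS (g := id) (P := fun u => θ ≤ G.cliqueSize N u)
    (B := fun v u => θ ≤ G.cliqueSize N v ∧ G.SizeBefore N v u)
    (fun u h => sizeBefore_irrefl u h.2)
    (fun _ _ _ h h' => ⟨h.1, sizeBefore_trans h.2 h'.2⟩)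
    (fun _ _ hu hw hne => (sizeBefore_total hne).imp (⟨hu, ·⟩) (⟨hw, ·⟩))
    fun _ hu => (mem_filter.1 hu).2

open Classical in
theorem card_nearBelow_le (hN : G.n ≤ N) (hS : countBelow N G.cover ≤ K) (θ : ℕ) :
    #{u ∈ range N | G.IsLeader N u ∧ G.NearBelow N K θ u} ≤ classBound K := by
  rw [← image_id (s := {u ∈ range N | G.IsLeader N u ∧ G.NearBelow N K θ u})]
  exact card_image_le_of_countBelow_lt hN hS (g := id) (P := fun u => G.cliqueSize N u ≤ θ)
    (B := fun v u => G.cliqueSize N v ≤ θ ∧ G.SizeBefore N u v)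
    (fun u h => sizeBefore_irrefl u h.2)
    (fun _ _ _ h h' => ⟨h.1, sizeBefore_trans h'.2 h.2⟩)
    (fun _ _ hu hw hne => (sizeBefore_total hne).symm.imp (⟨hu, ·⟩) (⟨hw, ·⟩))
    fun _ hu => (mem_filter.1 hu).2

open Classical in
theorem card_isTop_cliqueSize_le (hN : G.n ≤ N) (hS : countBelow N G.cover ≤ K) :
    #(({u ∈ range N | G.IsTop N K u} : Finset ℕ).image (G.cliqueSize N)) ≤ classBound K :=
  card_image_le_of_countBelow_lt hN hS (P := fun _ => True)
    (B := fun v u => G.cliqueSize N u < G.cliqueSize N v) (fun _ => lt_irrefl _)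
    (fun _ _ _ h h' => h'.trans h) (fun _ _ _ _ hne => hne.lt_or_gt.symm)
    fun _ hu => ⟨(mem_filter.1 hu).2.1, trivial, (mem_filter.1 hu).2.2⟩

open Classical in
/-- The thresholds that occur in `IsCandidateLeader`. -/
noncomputable def thresholds (H : CoverGraph) (N K : ℕ) : Finset ℕ :=
  ({N} ∪ range K) ∪
    (({u ∈ range N | H.IsTop N K u} : Finset ℕ).image (H.cliqueSize N) ×ˢ range K).image
      fun p => p.1 + p.2

theorem card_thresholds_le (hN : H.n ≤ N) (hS : countBelow N H.cover ≤ K) :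
    #(H.thresholds N K) ≤ thresholdBound K := by
  classical
  refine (card_union_le _ _).trans (add_le_add ?_ ?_)
  · refine (card_union_le _ _).trans ?_
    simp
  · refine card_image_le.trans ?_
    rw [card_product, card_range]
    exact Nat.mul_le_mul_right _ (card_isTop_cliqueSize_le hN hS)

theorem IsCandidateLeader.exists_threshold {u : ℕ} (h : G.IsCandidateLeader N K H u) :
    ∃ θ ∈ H.thresholds N K, G.Near N K θ u := by
  classical
  rcases h.2 with h | ⟨a, -, ha, h⟩ | ⟨d, hd, a, -, ht, ha, h⟩
  · exact ⟨N, by simp [thresholds], h⟩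
  · exact ⟨a, by simp [thresholds, ha], h⟩
  · refine ⟨_, mem_union_right _ (mem_image.2 ⟨(H.cliqueSize N d, a), mem_product.2 ⟨?_, ?_⟩, rfl⟩),
      h⟩
    · exact mem_image_of_mem _ (mem_filter.2 ⟨mem_range.2 hd, ht⟩)
    · exact mem_range.2 ha

open Classical in
theorem card_isCandidateLeader_le (hGN : G.n ≤ N) (hHN : H.n ≤ N) (hG : countBelow N G.cover ≤ K)
    (hH : countBelow N H.cover ≤ K) :
    #{u ∈ range N | G.IsCandidateLeader N K H u} ≤
      thresholdBound K * (classBound K + classBound K) := by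
  have hsub : ({u ∈ range N | G.IsCandidateLeader N K H u} : Finset ℕ) ⊆
      (H.thresholds N K).biUnion fun θ => {u ∈ range N | G.IsLeader N u ∧ G.NearAbove N K θ u} ∪
        {u ∈ range N | G.IsLeader N u ∧ G.NearBelow N K θ u} := by
    intro u hu
    obtain ⟨hu, hc⟩ := mem_filter.1 hu
    obtain ⟨θ, hθ, hn⟩ := hc.exists_threshold
    refine mem_biUnion.2 ⟨θ, hθ, ?_⟩
    rcases hn with hn | hn
    · exact mem_union_left _ (mem_filter.2 ⟨hu, hc.1, hn⟩)
    · exact mem_union_right _ (mem_filter.2 ⟨hu, hc.1, hn⟩)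
  refine (card_le_card hsub).trans ((card_biUnion_le_card_mul _ _ _ fun θ _ =>
    (card_union_le _ _).trans (add_le_add (card_nearAbove_le hGN hG θ)
      (card_nearBelow_le hGN hG θ))).trans ?_)
  exact Nat.mul_le_mul_right _ (card_thresholds_le hHN hH)

theorem countBelow_isCandidate_le (hV : G.IsTwinCovered) (hGN : G.n ≤ N) (hHN : H.n ≤ N)
    (hG : countBelow N G.cover ≤ K) (hH : countBelow N H.cover ≤ K) :
    countBelow N (G.IsCandidate N K H) ≤ thresholdBound K * (classBound K + classBound K) * K := by
  classical
  refine le_trans ?_ (Nat.mul_le_mul_right K (card_isCandidateLeader_le hGN hHN hG hH))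
  rw [← card_range K, ← card_product, card_range K]
  have key : ∀ v, G.IsCandidate N K H v →
      ∃ u < N, G.SameClique u v ∧ G.IsCandidateLeader N K H u := fun v hv => hv.2
  choose! m h₁ h₂ h₃ using key
  refine card_le_card_of_injOn (fun v => (m v, G.cliqueRank N v)) (fun v hv => ?_)
    fun v hv w hw he => ?_
  · have hv := (mem_filter.1 (mem_coe.1 hv)).2
    refine mem_coe.2 (mem_product.2 ⟨mem_filter.2 ⟨mem_range.2 (h₁ v hv), h₃ v hv⟩, ?_⟩)
    exact mem_range.2 hv.1
  · have hv := (mem_filter.1 (mem_coe.1 hv)).2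
    have hw := (mem_filter.1 (mem_coe.1 hw)).2
    have hm : m v = m w := congrArg Prod.fst he
    have hr : G.cliqueRank N v = G.cliqueRank N w := congrArg Prod.snd he
    have hs := h₂ w hw
    rw [← hm] at hs
    rw [cliqueRank_eq_keyPos hV hGN (h₂ v hv), cliqueRank_eq_keyPos hV hGN hs] at hr
    refine keyPos_injOn Function.injective_id.injOn ?_ ?_ hr
    · exact mem_coe.2 (mem_filter.2 ⟨mem_range.2 (h₂ v hv).2.1, h₂ v hv⟩)
    · exact mem_coe.2 (mem_filter.2 ⟨mem_range.2 hs.2.1, hs⟩)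

theorem countBelow_inPool_le (hV : G.IsTwinCovered) (hGN : G.n ≤ N) (hHN : H.n ≤ N)
    (hG : countBelow N G.cover ≤ K) (hH : countBelow N H.cover ≤ K) :
    countBelow N (G.InPool N K H) ≤ poolBound K := by
  classical
  have h : countBelow N (G.InPool N K H) ≤
      countBelow N G.cover + countBelow N (G.IsCandidate N K H) := by
    rw [countBelow, countBelow, countBelow]
    refine (card_le_card ?_).trans (card_union_le _ _)
    intro v hv
    obtain ⟨h₁, h₂⟩ := mem_filter.1 hv
    rcases h₂ with h₂ | h₂
    · exact mem_union_left _ (mem_filter.2 ⟨h₁, h₂⟩)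
    · exact mem_union_right _ (mem_filter.2 ⟨h₁, h₂⟩)
  exact h.trans (add_le_add hG (countBelow_isCandidate_le hV hGN hHN hG hH))

theorem InPool.lt (hV : G.IsTwinCovered) {v : ℕ} (h : G.InPool N K H v) : v < G.n := by
  rcases h with h | ⟨-, u, -, h, -⟩
  · exact hV.cover_lt h
  · exact h.2.1

end poolSize


end CoverGraph
/-! ### The graphs in memory

Array `0` is the input. The arrays `2` and `3` hold the matchings from which the twin covers are
obtained, the arrays `5` and `6` the pools, and array `4` the powers of the number of choices for
one vertex. -/

namespace MCIS

section defs

variable (A : Mem) (g : ℕ)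

open Classical in
/-- The product, for `x` at most the loop bound. -/
noncomputable def boundedMul (x y : ℕ) : ℕ := ∑ i ∈ range A.bound, if i < x then y else 0

/-- The number of vertices of the graph `g`. -/
def vertexCount : ℕ := A.cell 0 g

open Classical in
/-- The start of the adjacency matrix of the graph `g`. -/
noncomputable def matrixStart : ℕ :=
  if g = 0 then 3 else 3 + boundedMul A (vertexCount A 0) (vertexCount A 0)

/-- The adjacency relation of the graph `g`. -/
def StoredAdj (u v : ℕ) : Prop :=
  (u < vertexCount A g ∧ v < vertexCount A g) ∧
    A.cell 0 (matrixStart A g + boundedMul A u (vertexCount A g) + v) = 1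

/-- An edge between vertices that are not twins. -/
def NontwinEdge (u v : ℕ) : Prop :=
  StoredAdj A g u v ∧ SomeBelow A.bound fun w => (¬ w = u ∧ ¬ w = v) ∧
    ¬ (StoredAdj A g u w ↔ StoredAdj A g v w)

/-- `x` is on an edge of the matching that was chosen for a vertex before `i`. A matching is stored
by recording `w + 1` at `u` when the edge from `u` to `w` is chosen, and `0` when none is. -/
def Marked (i x : ℕ) : Prop :=
  SomeBelow A.bound fun u => (u < i ∧ ¬ A.cell (2 + g) u = 0) ∧ (x = u ∨ A.cell (2 + g) u = x + 1)

/-- The edge from `i` to `w` can be added to the matching. -/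
def Addable (i w : ℕ) : Prop := NontwinEdge A g i w ∧ ¬ Marked A g i i ∧ ¬ Marked A g i w

open Classical in
/-- The successor of the first vertex that can be matched to `i`, or `0`. -/
noncomputable def partner (i : ℕ) : ℕ :=
  if SomeBelow A.bound fun w => Addable A g i w then
    (countBelow A.bound fun w => AllBelow A.bound fun w' => w' ≤ w → ¬ Addable A g i w') + 1
  else 0

/-- The graph `g` with the twin cover obtained from the matching. -/
def storedGraph : CoverGraph where
  n := vertexCount A g
  Adj := StoredAdj A g
  cover := Marked A g (vertexCount A g)

/-- A strict upper bound for the number of vertices in the two twin covers. -/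
noncomputable def coverBound : ℕ :=
  countBelow A.bound (storedGraph A 0).cover + countBelow A.bound (storedGraph A 1).cover + 1

/-- `v` is in the pool of the graph `g`, computed from the stored graphs. -/
def InGraphPool (v : ℕ) : Prop :=
  (storedGraph A g).InPool A.bound (coverBound A) (storedGraph A (1 - g)) v

open Classical in
/-- The indicator function of the pool of the graph `g`. -/
noncomputable def poolIndicator (v : ℕ) : ℕ := if InGraphPool A g v then 1 else 0

/-- `v` is in the pool of the graph `g`, as recorded in array `5 + g`. -/
def InStoredPool (v : ℕ) : Prop := A.cell (5 + g) v = 1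

/-- The size of the pool of the graph `g`, as recorded in memory. -/
noncomputable def poolSize : ℕ := countBelow A.bound (InStoredPool A g)

/-- The index of `v` in the pool. -/
noncomputable def poolIndex (v : ℕ) : ℕ := countBelow A.bound fun w => InStoredPool A g w ∧ w < v

open Classical in
/-- The next power of the number of choices for one vertex. -/
noncomputable def nextPower (i : ℕ) : ℕ :=
  if i = 0 then 1 else boundedMul A (poolSize A 1 + 1) (A.cell 4 (i - 1))

/-- The relation between the two pools that is encoded by the number `c`: the digit of `c` at the
index of `x` is the successor of the index of `y`. The base is the size of the second pool plus
one, whose powers are in array `4`. -/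
def CodedRel (c x y : ℕ) : Prop :=
  (InStoredPool A 0 x ∧ InStoredPool A 1 y) ∧
    SomeBelow A.bound fun hi => SomeBelow A.bound fun lo => lo < A.cell 4 (poolIndex A 0 x) ∧
      c = boundedMul A hi (A.cell 4 (poolIndex A 0 x + 1)) +
        boundedMul A (poolIndex A 1 y + 1) (A.cell 4 (poolIndex A 0 x)) + lo

/-- Some relation between the pools is a partial isomorphism of the value required. -/
def Accepts : Prop := SomeBelow A.bound fun c =>
  CoverGraph.IsPartialIsoRel (storedGraph A 0) (storedGraph A 1) A.bound (CodedRel A c) ∧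
    A.cell 0 2 ≤ CoverGraph.relValue (storedGraph A 0) (storedGraph A 1) A.bound (CodedRel A c)

end defs

section computability

variable {Γ : Type} [Storable Γ] {A : Γ → Mem} {u v c : Γ → ℕ} (g : ℕ)

@[fun_prop]
theorem polyTime_boundedMul (hA : PolyTime A) (hu : PolyTime u) (hv : PolyTime v) :
    PolyTime fun x => boundedMul (A x) (u x) (v x) := by
  unfold boundedMul
  exact PolyTime.sum hA (by fun_prop)

@[fun_prop]
theorem polyTime_vertexCount (hA : PolyTime A) : PolyTime fun x => vertexCount (A x) g := by
  unfold vertexCount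
  fun_prop

@[fun_prop]
theorem polyTime_matrixStart (hA : PolyTime A) : PolyTime fun x => matrixStart (A x) g := by
  unfold matrixStart
  fun_prop

@[fun_prop]
theorem polyTime_storedAdj (hA : PolyTime A) (hu : PolyTime u) (hv : PolyTime v) :
    PolyTime fun x => StoredAdj (A x) g (u x) (v x) := by
  unfold StoredAdj
  fun_prop

@[fun_prop]
theorem polyTime_nontwinEdge (hA : PolyTime A) (hu : PolyTime u) (hv : PolyTime v) :
    PolyTime fun x => NontwinEdge (A x) g (u x) (v x) := by
  unfold NontwinEdge
  fun_prop

@[fun_prop]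
theorem polyTime_marked (hA : PolyTime A) (hu : PolyTime u) (hv : PolyTime v) :
    PolyTime fun x => Marked (A x) g (u x) (v x) := by
  unfold Marked
  fun_prop

@[fun_prop]
theorem polyTime_addable (hA : PolyTime A) (hu : PolyTime u) (hv : PolyTime v) :
    PolyTime fun x => Addable (A x) g (u x) (v x) := by
  unfold Addable
  fun_prop

@[fun_prop]
theorem polyTime_partner (hA : PolyTime A) (hu : PolyTime u) :
    PolyTime fun x => partner (A x) g (u x) := by
  unfold partner
  simp only [imp_iff_not_or]
  fun_prop

@[fun_prop]
theorem polyTime_sameClique (hA : PolyTime A) (hu : PolyTime u) (hv : PolyTime v) :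
    PolyTime fun x => (storedGraph (A x) g).SameClique (u x) (v x) := by
  simp only [CoverGraph.SameClique, storedGraph]
  fun_prop

@[fun_prop]
theorem polyTime_cliqueSize (hA : PolyTime A) (hu : PolyTime u) :
    PolyTime fun x => (storedGraph (A x) g).cliqueSize (A x).bound (u x) := by
  unfold CoverGraph.cliqueSize
  fun_prop

@[fun_prop]
theorem polyTime_cliqueRank (hA : PolyTime A) (hu : PolyTime u) :
    PolyTime fun x => (storedGraph (A x) g).cliqueRank (A x).bound (u x) := by
  unfold CoverGraph.cliqueRank
  fun_prop

@[fun_prop]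
theorem polyTime_isLeader (hA : PolyTime A) (hu : PolyTime u) :
    PolyTime fun x => (storedGraph (A x) g).IsLeader (A x).bound (u x) := by
  unfold CoverGraph.IsLeader
  fun_prop

@[fun_prop]
theorem polyTime_sameType (hA : PolyTime A) (hu : PolyTime u) (hv : PolyTime v) :
    PolyTime fun x => (storedGraph (A x) g).SameType (A x).bound (u x) (v x) := by
  simp only [CoverGraph.SameType, storedGraph, imp_iff_not_or]
  fun_prop

@[fun_prop]
theorem polyTime_sizeBefore (hA : PolyTime A) (hu : PolyTime u) (hv : PolyTime v) :
    PolyTime fun x => (storedGraph (A x) g).SizeBefore (A x).bound (u x) (v x) := by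
  unfold CoverGraph.SizeBefore
  fun_prop

@[fun_prop]
theorem polyTime_isTop (hA : PolyTime A) (hu : PolyTime u) (hc : PolyTime c) :
    PolyTime fun x => (storedGraph (A x) g).IsTop (A x).bound (c x) (u x) := by
  unfold CoverGraph.IsTop
  fun_prop

@[fun_prop]
theorem polyTime_near (hA : PolyTime A) (hu : PolyTime u) (hv : PolyTime v) (hc : PolyTime c) :
    PolyTime fun x => (storedGraph (A x) g).Near (A x).bound (c x) (v x) (u x) := by
  unfold CoverGraph.Near CoverGraph.NearAbove CoverGraph.NearBelow
  fun_prop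

@[fun_prop]
theorem polyTime_isCandidateLeader (g' : ℕ) (hA : PolyTime A) (hu : PolyTime u)
    (hc : PolyTime c) : PolyTime fun x =>
      (storedGraph (A x) g).IsCandidateLeader (A x).bound (c x) (storedGraph (A x) g') (u x) := by
  unfold CoverGraph.IsCandidateLeader
  fun_prop

@[fun_prop]
theorem polyTime_isCandidate (g' : ℕ) (hA : PolyTime A) (hu : PolyTime u) (hc : PolyTime c) :
    PolyTime fun x =>
      (storedGraph (A x) g).IsCandidate (A x).bound (c x) (storedGraph (A x) g') (u x) := by
  unfold CoverGraph.IsCandidate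
  fun_prop

@[fun_prop]
theorem polyTime_coverBound (hA : PolyTime A) : PolyTime fun x => coverBound (A x) := by
  simp only [coverBound, storedGraph]
  fun_prop

@[fun_prop]
theorem polyTime_poolIndicator (hA : PolyTime A) (hu : PolyTime u) :
    PolyTime fun x => poolIndicator (A x) g (u x) := by
  have _ : PolyTime fun x => (storedGraph (A x) g).cover (u x) := by
    simp only [storedGraph]
    fun_prop
  unfold poolIndicator InGraphPool CoverGraph.InPool
  fun_prop

@[fun_prop]
theorem polyTime_inStoredPool (hA : PolyTime A) (hu : PolyTime u) :
    PolyTime fun x => InStoredPool (A x) g (u x) := by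
  unfold InStoredPool
  fun_prop

@[fun_prop]
theorem polyTime_poolSize (hA : PolyTime A) : PolyTime fun x => poolSize (A x) g := by
  unfold poolSize
  fun_prop

@[fun_prop]
theorem polyTime_poolIndex (hA : PolyTime A) (hu : PolyTime u) :
    PolyTime fun x => poolIndex (A x) g (u x) := by
  unfold poolIndex
  fun_prop

@[fun_prop]
theorem polyTime_nextPower (hA : PolyTime A) (hu : PolyTime u) :
    PolyTime fun x => nextPower (A x) (u x) := by
  unfold nextPower
  fun_prop

@[fun_prop]
theorem polyTime_codedRel (hA : PolyTime A) (hu : PolyTime u) (hv : PolyTime v) (hc : PolyTime c) :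
    PolyTime fun x => CodedRel (A x) (c x) (u x) (v x) := by
  unfold CodedRel
  fun_prop

@[fun_prop]
theorem polyTime_inDomain (hA : PolyTime A) (hu : PolyTime u) (hc : PolyTime c) :
    PolyTime fun x => CoverGraph.InDomain (A x).bound (CodedRel (A x) (c x)) (u x) := by
  unfold CoverGraph.InDomain
  fun_prop

@[fun_prop]
theorem polyTime_inRange (hA : PolyTime A) (hu : PolyTime u) (hc : PolyTime c) :
    PolyTime fun x => CoverGraph.InRange (A x).bound (CodedRel (A x) (c x)) (u x) := by
  unfold CoverGraph.InRange
  fun_prop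

theorem polyTime_accepts : PolyTime Accepts := by
  unfold Accepts CoverGraph.relValue CoverGraph.IsMatched CoverGraph.SameLabel
    CoverGraph.MatchingLabels CoverGraph.relResidualRank CoverGraph.InResidual
    CoverGraph.IsPartialIsoRel
  simp only [imp_iff_not_or, storedGraph]
  fun_prop

end computability

/-! ### Maximal matchings cover -/

/-- `x` is on an edge of the matching `P` that was chosen for a vertex before `i`. Here `P u` is
`0` or the successor of the vertex matched to `u`. -/
def Covered (P : ℕ → ℕ) (i x : ℕ) : Prop := ∃ u < i, P u ≠ 0 ∧ (x = u ∨ P u = x + 1)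

/-- `P` is a maximal matching of the relation `T` on the vertices below `n`, obtained greedily by
going through the vertices in increasing order. -/
structure IsGreedyMatching (n : ℕ) (T : ℕ → ℕ → Prop) (P : ℕ → ℕ) : Prop where
  edge : ∀ i < n, P i ≠ 0 → ∃ w, P i = w + 1 ∧ T i w ∧ ¬ Covered P i i ∧ ¬ Covered P i w
  maximal : ∀ i < n, P i = 0 → ∀ w, T i w → Covered P i i ∨ Covered P i w

theorem Covered.mono {P : ℕ → ℕ} {i j x : ℕ} (h : Covered P i x) (hij : i ≤ j) :
    Covered P j x := by
  obtain ⟨u, hu, h⟩ := h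
  exact ⟨u, hu.trans_le hij, h⟩

namespace IsGreedyMatching

variable {n : ℕ} {T : ℕ → ℕ → Prop} {P : ℕ → ℕ}

theorem covered_or_covered (h : IsGreedyMatching n T P) {u w : ℕ} (hu : u < n) (hT : T u w) :
    Covered P n u ∨ Covered P n w := by
  by_cases h0 : P u = 0
  · exact (h.maximal u hu h0 w hT).imp (fun h => h.mono hu.le) fun h => h.mono hu.le
  · exact .inl ⟨u, hu, h0, .inl rfl⟩

theorem card_ne_zero_le (h : IsGreedyMatching n T P) {C : Finset ℕ}
    (hC : ∀ u w, T u w → u ∈ C ∨ w ∈ C) : #{u ∈ range n | P u ≠ 0} ≤ #C := by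
  have hcover : ∀ u < n, P u ≠ 0 → ∃ z ∈ C, (z = u ∨ P u = z + 1) ∧ ¬ Covered P u z := by
    intro u hu h0
    obtain ⟨w, hw, hT, h₁, h₂⟩ := h.edge u hu h0
    rcases hC u w hT with hz | hz
    · exact ⟨u, hz, .inl rfl, h₁⟩
    · exact ⟨w, hz, .inr hw, h₂⟩
  choose! z hzC hz hnew using hcover
  have hne : ∀ u v, u < n → P u ≠ 0 → v < n → P v ≠ 0 → u < v → z u ≠ z v :=
    fun u v hu hu0 hv hv0 hlt he => hnew v hv hv0 ⟨u, hlt, hu0, he ▸ hz u hu hu0⟩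
  refine card_le_card_of_injOn z (fun u hu => ?_) fun u hu v hv he => ?_
  · obtain ⟨hu, hu0⟩ := mem_filter.1 hu
    exact hzC u (mem_range.1 hu) hu0
  · obtain ⟨hu, hu0⟩ := mem_filter.1 hu
    obtain ⟨hv, hv0⟩ := mem_filter.1 hv
    rw [mem_range] at hu hv
    exact le_antisymm (not_lt.1 fun hlt => hne v u hv hv0 hu hu0 hlt he.symm)
      (not_lt.1 fun hlt => hne u v hu hu0 hv hv0 hlt he)

theorem countBelow_covered_le (h : IsGreedyMatching n T P) {C : Finset ℕ}
    (hC : ∀ u w, T u w → u ∈ C ∨ w ∈ C) (N : ℕ) : countBelow N (Covered P n) ≤ 2 * #C := by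
  classical
  set M : Finset ℕ := {u ∈ range n | P u ≠ 0}
  have hsub : {x ∈ range N | Covered P n x} ⊆ M ∪ M.image fun u => P u - 1 := by
    intro x hx
    obtain ⟨u, hu, h0, rfl | hux⟩ := (mem_filter.1 hx).2
    · exact mem_union_left _ (mem_filter.2 ⟨mem_range.2 hu, h0⟩)
    · exact mem_union_right _
        (mem_image.2 ⟨u, mem_filter.2 ⟨mem_range.2 hu, h0⟩, by rw [hux, Nat.add_sub_cancel]⟩)
  calc countBelow N (Covered P n) ≤ #(M ∪ M.image fun u => P u - 1) := by
        rw [countBelow]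
        convert card_le_card hsub
    _ ≤ #M + #(M.image fun u => P u - 1) := card_union_le _ _
    _ ≤ #C + #C := add_le_add (h.card_ne_zero_le hC) (card_image_le.trans (h.card_ne_zero_le hC))
    _ = 2 * #C := (two_mul _).symm

end IsGreedyMatching

/-! ### The graphs of an instance -/

section naturalNumbers

variable {n : ℕ} {G : SimpleGraph (Fin n)} {P : ℕ → ℕ} {u v : ℕ}

/-- The adjacency relation, extended to all natural numbers. -/
def NatAdj (G : SimpleGraph (Fin n)) (u v : ℕ) : Prop :=
  ∃ (hu : u < n) (hv : v < n), G.Adj ⟨u, hu⟩ ⟨v, hv⟩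

/-- The edges between vertices that are not twins, as a relation on the natural numbers. -/
def NatNontwin (G : SimpleGraph (Fin n)) (u v : ℕ) : Prop :=
  NatAdj G u v ∧ ∃ w < n, (¬ w = u ∧ ¬ w = v) ∧ ¬ (NatAdj G u w ↔ NatAdj G v w)

/-- The graph with the twin cover obtained from a matching. -/
def toCoverGraph (G : SimpleGraph (Fin n)) (P : ℕ → ℕ) : CoverGraph :=
  ⟨n, NatAdj G, Covered P n⟩

theorem NatAdj.symm (h : NatAdj G u v) : NatAdj G v u := by
  obtain ⟨hu, hv, h⟩ := h
  exact ⟨hv, hu, h.symm⟩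

theorem natAdj_val {u v : Fin n} : NatAdj G u v ↔ G.Adj u v :=
  ⟨fun ⟨_, _, h⟩ => h, fun h => ⟨u.2, v.2, h⟩⟩

theorem lt_of_not_natAdj_iff {w : ℕ} (h : ¬ (NatAdj G u w ↔ NatAdj G v w)) : w < n := by
  by_contra hw
  exact h (iff_of_false (fun h => hw h.2.1) fun h => hw h.2.1)

theorem NatNontwin.not_twins {u v : Fin n} (h : NatNontwin G u v) : ¬ G.Twins u v := by
  obtain ⟨-, w, hw, ⟨hwu, hwv⟩, h⟩ := h
  refine fun htwins => h ?_
  have := Set.ext_iff.1 htwins ⟨w, hw⟩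
  simp only [Set.mem_sdiff, SimpleGraph.mem_neighborSet, Set.mem_singleton_iff, Fin.ext_iff, hwu,
    hwv, not_false_eq_true, and_true] at this
  rwa [← natAdj_val, ← natAdj_val] at this

theorem isTwinCovered_toCoverGraph (h : IsGreedyMatching n (NatNontwin G) P) :
    (toCoverGraph G P).IsTwinCovered where
  symm := NatAdj.symm
  irrefl := fun _ ⟨_, _, h⟩ => G.irrefl h
  lt := fun ⟨h, _⟩ => h
  cover_lt := by
    rintro x ⟨u, hu, h0, rfl | hx⟩
    · exact hu
    · obtain ⟨w, hw, ⟨⟨-, hwn, -⟩, -⟩, -⟩ := h.edge u hu h0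
      obtain rfl : w = x := Nat.succ_injective (hw.symm.trans hx)
      exact hwn
  twin := by
    intro u v w hu hv huv hwu hwv
    by_contra hw
    exact (h.covered_or_covered huv.1
      ⟨huv, w, lt_of_not_natAdj_iff hw, ⟨hwu, hwv⟩, hw⟩).elim hu hv

theorem countBelow_covered_le_twinCoverNumber (h : IsGreedyMatching n (NatNontwin G) P) (N : ℕ) :
    countBelow N (Covered P n) ≤ 2 * G.twinCoverNumber := by
  obtain ⟨S, hS, hcard⟩ : G.twinCoverNumber ∈
      {k | ∃ S : Finset (Fin n), G.IsTwinCover S ∧ #S = k} :=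
    Nat.sInf_mem ⟨_, univ, fun u _ _ _ => .inl (mem_univ u), rfl⟩
  rw [← hcard, ← card_map Fin.valEmbedding]
  refine h.countBelow_covered_le (fun u w hT => ?_) N
  obtain ⟨⟨hu, hw, hadj⟩, -⟩ := id hT
  exact (hS ⟨u, hu⟩ ⟨w, hw⟩ hadj hT.not_twins).imp
    (fun h => mem_map_of_mem Fin.valEmbedding h) fun h => mem_map_of_mem Fin.valEmbedding h

end naturalNumbers

section isYes

variable {m n₁ n₂ : ℕ} {H : SimpleGraph (Fin m)} {G₁ : SimpleGraph (Fin n₁)}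
  {G₂ : SimpleGraph (Fin n₂)}

theorem exists_isPartialIso_of_isIndContained (h₁ : H.IsIndContained G₁)
    (h₂ : H.IsIndContained G₂) (P Q : ℕ → ℕ) : ∃ φ,
      CoverGraph.IsPartialIso (toCoverGraph G₁ P) (toCoverGraph G₂ Q) φ ∧ #φ = m := by
  obtain ⟨e₁⟩ := h₁
  obtain ⟨e₂⟩ := h₂
  let pair : Fin m ↪ ℕ × ℕ :=
    ⟨fun i => (e₁ i, e₂ i), fun i j h => e₁.injective (Fin.ext (congrArg Prod.fst h))⟩
  refine ⟨univ.map pair, ⟨fun p hp => ?_, fun p hp q hq => ?_⟩, by simp⟩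
  · obtain ⟨i, -, rfl⟩ := mem_map.1 hp
    exact ⟨(e₁ i).2, (e₂ i).2⟩
  · obtain ⟨i, -, rfl⟩ := mem_map.1 hp
    obtain ⟨j, -, rfl⟩ := mem_map.1 hq
    refine ⟨?_, natAdj_val.trans ((e₁.map_adj_iff.trans e₂.map_adj_iff.symm).trans
      natAdj_val.symm)⟩
    change ((e₁ i : ℕ) = e₁ j ↔ (e₂ i : ℕ) = e₂ j)
    rw [← Fin.ext_iff, ← Fin.ext_iff, e₁.injective.eq_iff, e₂.injective.eq_iff]

theorem exists_isIndContained_of_isPartialIso {P Q : ℕ → ℕ} {φ : Finset (ℕ × ℕ)}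
    (hφ : CoverGraph.IsPartialIso (toCoverGraph G₁ P) (toCoverGraph G₂ Q) φ) :
    ∃ H : SimpleGraph (Fin #φ), H.IsIndContained G₁ ∧ H.IsIndContained G₂ := by
  obtain ⟨hlt, hiso⟩ := hφ
  let e := φ.equivFin.symm
  let a : Fin #φ → Fin n₁ := fun i => ⟨(e i).1.1, (hlt _ (e i).2).1⟩
  let b : Fin #φ → Fin n₂ := fun i => ⟨(e i).1.2, (hlt _ (e i).2).2⟩
  have heq : ∀ i j, a i = a j ↔ b i = b j := fun i j => by
    rw [Fin.ext_iff, Fin.ext_iff]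
    exact (hiso _ (e i).2 _ (e j).2).1
  have hadj : ∀ i j, G₁.Adj (a i) (a j) ↔ G₂.Adj (b i) (b j) := fun i j => by
    rw [← natAdj_val, ← natAdj_val]
    exact (hiso _ (e i).2 _ (e j).2).2
  have ha : a.Injective := fun i j h => e.injective
    (Subtype.ext (Prod.ext (congrArg Fin.val h) (congrArg Fin.val ((heq i j).1 h))))
  have hb : b.Injective := fun i j h => ha ((heq i j).2 h)
  exact ⟨G₁.comap a, ⟨⟨a, ha⟩, Iff.rfl⟩, ⟨⟨b, hb⟩, (hadj _ _).symm⟩⟩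

theorem isYes_iff (x : MCISInstance) (P Q : ℕ → ℕ) : x.IsYes ↔ ∃ φ,
    CoverGraph.IsPartialIso (toCoverGraph x.G₁ P) (toCoverGraph x.G₂ Q) φ ∧ x.h ≤ #φ := by
  constructor
  · rintro ⟨m, H, hm, h₁, h₂⟩
    obtain ⟨φ, hφ, hcard⟩ := exists_isPartialIso_of_isIndContained h₁ h₂ P Q
    exact ⟨φ, hφ, hcard ▸ hm⟩
  · rintro ⟨φ, hφ, hcard⟩
    obtain ⟨H, h₁, h₂⟩ := exists_isIndContained_of_isPartialIso hφ
    exact ⟨#φ, H, hcard, h₁, h₂⟩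

end isYes

/-! ### The contents of the memory -/

section encoding

theorem getD_flatMap_append {α : Type*} {m : ℕ} (l : List α) (F : α → List ℕ)
    (hF : ∀ a, (F a).length = m) {i j : ℕ} (hi : i < l.length) (hj : j < m) (t : List ℕ) :
    (l.flatMap F ++ t).getD (i * m + j) 0 = (F l[i]).getD j 0 := by
  induction l generalizing i with
  | nil => simp at hi
  | cons a l ih =>
    rw [List.flatMap_cons, List.append_assoc]
    cases i with
    | zero =>
      rw [List.getD_append _ _ _ _ (by rw [hF]; omega)]
      simp
    | succ i =>
      rw [List.getD_append_right _ _ _ _ (by rw [hF]; nlinarith), hF,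
        show (i + 1) * m + j - m = i * m + j by rw [add_mul]; omega]
      exact ih (by simpa using hi)

theorem length_adjList {n : ℕ} (G : SimpleGraph (Fin n)) :
    (MCISInstance.adjList G).length = n * n := by
  simp [MCISInstance.adjList]

theorem length_encode (x : MCISInstance) :
    x.encode.length = 3 + x.n₁ * x.n₁ + x.n₂ * x.n₂ := by
  simp only [MCISInstance.encode, List.length_append, length_adjList, List.length_cons,
    List.length_nil]

open Classical in
theorem getD_adjList_append {n : ℕ} (G : SimpleGraph (Fin n)) {u v : ℕ} (hu : u < n) (hv : v < n)
    (t : List ℕ) : (MCISInstance.adjList G ++ t).getD (u * n + v) 0 =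
      if NatAdj G u v then 1 else 0 := by
  rw [MCISInstance.adjList, getD_flatMap_append (m := n) _ _ (by simp) (by simpa using hu) hv]
  simp [NatAdj, hu, hv, List.getD_eq_getElem?_getD]

/-- The number of vertices of the first graph of the instance for `g = 0`, of the second one
otherwise. -/
def inputOrder (x : MCISInstance) : ℕ → ℕ
  | 0 => x.n₁
  | _ + 1 => x.n₂

/-- The first graph of the instance for `g = 0`, the second one otherwise. -/
def inputGraph (x : MCISInstance) : (g : ℕ) → SimpleGraph (Fin (inputOrder x g))
  | 0 => x.G₁
  | _ + 1 => x.G₂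

open Classical in
theorem getD_encode (x : MCISInstance) {g u v : ℕ} (hu : u < inputOrder x g)
    (hv : v < inputOrder x g) :
    x.encode.getD ((if g = 0 then 3 else 3 + x.n₁ * x.n₁) + u * inputOrder x g + v) 0 =
      if NatAdj (inputGraph x g) u v then 1 else 0 := by
  have hskip (i : ℕ) : x.encode.getD (3 + i) 0 =
      (MCISInstance.adjList x.G₁ ++ MCISInstance.adjList x.G₂).getD i 0 := by
    rw [MCISInstance.encode, List.append_assoc, List.getD_append_right _ _ _ _ (by simp)]
    simp
  cases g with
  | zero =>
    rw [if_pos rfl, add_assoc, hskip]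
    exact getD_adjList_append x.G₁ hu hv _
  | succ g =>
    rw [if_neg g.succ_ne_zero, add_assoc, add_assoc, hskip,
      List.getD_append_right _ _ _ _ (by rw [length_adjList]; omega), length_adjList,
      Nat.add_sub_cancel_left, ← List.append_nil (MCISInstance.adjList x.G₂)]
    exact getD_adjList_append x.G₂ hu hv _

end encoding

theorem boundedMul_eq {A : Mem} {a : ℕ} (h : a ≤ A.bound) (b : ℕ) : boundedMul A a b = a * b := by
  have hrange : {i ∈ range A.bound | i < a} = range a := by
    ext i
    simp only [mem_filter, mem_range]
    omega
  rw [boundedMul, ← sum_filter, sum_const, smul_eq_mul]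
  convert congrArg (· * b) (card_range a)

/-- Array `0` holds the instance, and the loop bound is large enough for its vertices. -/
structure HasInput (x : MCISInstance) (A : Mem) : Prop where
  input : A.cell 0 = fun i => x.encode.getD i 0
  lt : ∀ g ≤ 1, inputOrder x g < A.bound

theorem vertexCount_eq {x : MCISInstance} {A : Mem} {g : ℕ}
    (h : A.cell 0 = fun i => x.encode.getD i 0) (hg : g ≤ 1) :
    vertexCount A g = inputOrder x g := by
  rw [vertexCount, h]
  interval_cases g <;> rfl

theorem marked_iff {A : Mem} {g i y : ℕ} (hi : i ≤ A.bound) :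
    Marked A g i y ↔ Covered (A.cell (2 + g)) i y := by
  constructor
  · rintro ⟨u, -, ⟨h₁, h₂⟩, h₃⟩
    exact ⟨u, h₁, h₂, h₃⟩
  · rintro ⟨u, h₁, h₂, h₃⟩
    exact ⟨u, h₁.trans_le hi, ⟨h₁, h₂⟩, h₃⟩

namespace HasInput

variable {x : MCISInstance} {A B : Mem} {g : ℕ}

theorem of_cell_eq (h : HasInput x A) (hc : B.cell 0 = A.cell 0) (hb : A.bound ≤ B.bound) :
    HasInput x B :=
  ⟨hc.trans h.input, fun g hg => (h.lt g hg).trans_le hb⟩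

theorem fillTo (h : HasInput x A) {a : ℕ} (ha : 1 < a) (F : Mem × ℕ → ℕ) (n : ℕ) :
    HasInput x (fillTo a F A n) :=
  h.of_cell_eq (fillTo_cell_of_ne (by omega)) (fillTo_bound (by omega)).ge

theorem cell_two (h : HasInput x A) : A.cell 0 2 = x.h := by
  rw [h.input]
  rfl

theorem storedAdj_eq (h : HasInput x A) (hg : g ≤ 1) : StoredAdj A g = NatAdj (inputGraph x g) := by
  funext u v
  have hstart : matrixStart A g = if g = 0 then 3 else 3 + x.n₁ * x.n₁ := by
    rw [matrixStart, vertexCount_eq h.input zero_le_one, boundedMul_eq (h.lt 0 zero_le_one).le]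
    rfl
  rw [StoredAdj, vertexCount_eq h.input hg, hstart, h.input]
  by_cases huv : u < inputOrder x g ∧ v < inputOrder x g
  · rw [boundedMul_eq (huv.1.trans (h.lt g hg)).le]
    simp only [getD_encode x huv.1 huv.2]
    simp [huv]
  · exact propext (iff_of_false (fun h => huv h.1) fun h => huv ⟨h.1, h.2.1⟩)

theorem nontwinEdge_iff (h : HasInput x A) (hg : g ≤ 1) {u v : ℕ} :
    NontwinEdge A g u v ↔ NatNontwin (inputGraph x g) u v := by
  rw [NontwinEdge, NatNontwin, h.storedAdj_eq hg]
  refine and_congr_right fun _ => exists_congr fun w => and_congr_left fun hw => ?_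
  have hlt := lt_of_not_natAdj_iff hw.2
  exact iff_of_true (hlt.trans (h.lt g hg)) hlt

theorem storedGraph_eq (h : HasInput x A) (hg : g ≤ 1) :
    storedGraph A g = toCoverGraph (inputGraph x g) (A.cell (2 + g)) := by
  have hcover : Marked A g (vertexCount A g) = Covered (A.cell (2 + g)) (inputOrder x g) := by
    funext y
    rw [vertexCount_eq h.input hg]
    exact propext (marked_iff (h.lt g hg).le)
  rw [storedGraph, toCoverGraph, hcover, vertexCount_eq h.input hg, h.storedAdj_eq hg]

theorem storedGraph_congr (hA : HasInput x A) (hB : HasInput x B) (hg : g ≤ 1)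
    (h : A.cell (2 + g) = B.cell (2 + g)) : storedGraph A g = storedGraph B g := by
  rw [hA.storedGraph_eq hg, hB.storedGraph_eq hg, h]

end HasInput

/-! ### Computing a maximal matching -/

section matching

variable {x : MCISInstance} {A : Mem} {g i w : ℕ}

/-- Store a maximal matching of the edges of the graph `g` between vertices that are not twins. -/
noncomputable def storeMatching (g : ℕ) (A : Mem) : Mem :=
  fill (2 + g) (fun p => partner p.1 g p.2) A

theorem exists_countBelow_eq {N : ℕ} {Q : ℕ → Prop} (h : ∃ w < N, Q w) :
    ∃ w < N, Q w ∧ countBelow N (fun w => AllBelow N fun w' => w' ≤ w → ¬ Q w') = w := by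
  classical
  obtain ⟨hlt, hQ⟩ := Nat.find_spec h
  have hbefore : {w ∈ range N | AllBelow N fun w' => w' ≤ w → ¬ Q w'} = range (Nat.find h) := by
    ext w
    simp only [mem_filter, mem_range]
    refine ⟨fun ⟨_, hw⟩ => not_le.1 fun hle => hw _ hlt hle hQ, fun hw => ?_⟩
    exact ⟨hw.trans hlt, fun w' hw' hle hQ => Nat.find_min h (hle.trans_lt hw) ⟨hw', hQ⟩⟩
  refine ⟨Nat.find h, hlt, hQ, ?_⟩
  rw [countBelow]
  convert card_range (Nat.find h)

theorem exists_addable_of_partner_ne_zero (h : partner A g i ≠ 0) :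
    ∃ w, partner A g i = w + 1 ∧ Addable A g i w := by
  rw [partner] at h ⊢
  split_ifs at h ⊢ with hex
  · obtain ⟨w, -, hw, hcount⟩ := exists_countBelow_eq hex
    exact ⟨w, congrArg (· + 1) hcount, hw⟩
  · exact absurd rfl h

theorem not_addable_of_partner_eq_zero (h : partner A g i = 0) (hw : w < A.bound) :
    ¬ Addable A g i w := by
  rw [partner] at h
  split_ifs at h with hex
  exact fun hadd => hex ⟨w, hw, hadd⟩

theorem addable_fillTo_iff (h : HasInput x A) (hg : g ≤ 1) (hi : i ≤ A.bound) :
    Addable (fillTo (2 + g) (fun p => partner p.1 g p.2) A i) g i w ↔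
      NatNontwin (inputGraph x g) i w ∧ ¬ Covered ((storeMatching g A).cell (2 + g)) i i ∧
        ¬ Covered ((storeMatching g A).cell (2 + g)) i w := by
  have hmarked (y : ℕ) : Marked (fillTo (2 + g) (fun p => partner p.1 g p.2) A i) g i y ↔
      Covered ((storeMatching g A).cell (2 + g)) i y := by
    rw [marked_iff (by rwa [fillTo_bound (by omega)])]
    refine exists_congr fun u => and_congr_right fun hu => ?_
    rw [storeMatching, fill, fillTo_cell_of_lt_of_le hu hi]
  rw [Addable, (h.fillTo (by omega) _ i).nontwinEdge_iff hg, hmarked, hmarked]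

theorem isGreedyMatching_storeMatching (h : HasInput x A) (hg : g ≤ 1) :
    IsGreedyMatching (inputOrder x g) (NatNontwin (inputGraph x g))
      ((storeMatching g A).cell (2 + g)) := by
  have hlt := h.lt g hg
  have hcell (i : ℕ) (hi : i < inputOrder x g) : (storeMatching g A).cell (2 + g) i =
      partner (fillTo (2 + g) (fun p => partner p.1 g p.2) A i) g i := fillTo_cell (hi.trans hlt)
  refine ⟨fun i hi h0 => ?_, fun i hi h0 w hT => ?_⟩
  · rw [hcell i hi] at h0 ⊢
    obtain ⟨w, hw, hadd⟩ := exists_addable_of_partner_ne_zero h0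
    exact ⟨w, hw, (addable_fillTo_iff h hg (hi.trans hlt).le).1 hadd⟩
  · rw [hcell i hi] at h0
    by_contra hcov
    refine not_addable_of_partner_eq_zero h0 ?_
      ((addable_fillTo_iff h hg (hi.trans hlt).le).2 ⟨hT, not_or.1 hcov⟩)
    rw [fillTo_bound (by omega)]
    exact hT.1.2.1.trans hlt

end matching

/-! ### Coding partial functions by numbers -/

theorem exists_digits {ι κ : ℕ → ℕ} {I : Finset ℕ} {m q : ℕ} (hι : Set.InjOn ι I)
    (hq : ∀ u ∈ I, ι u < q) (hκ : ∀ u ∈ I, κ u < m) (hm : 0 < m) :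
    ∃ c < m ^ q, (∀ u ∈ I, c / m ^ ι u % m = κ u) ∧
      ∀ i < q, (∀ u ∈ I, ι u ≠ i) → c / m ^ i % m = 0 := by
  classical
  let digit (i : Fin q) : Fin m :=
    if h : ∃ u ∈ I, ι u = i then ⟨κ h.choose, hκ _ h.choose_spec.1⟩ else ⟨0, hm⟩
  have hdigit (i : Fin q) : (finFunctionFinEquiv digit : ℕ) / m ^ (i : ℕ) % m = digit i :=
    congrArg Fin.val (congrFun (finFunctionFinEquiv.symm_apply_apply digit) i)
  refine ⟨finFunctionFinEquiv digit, (finFunctionFinEquiv digit).2, fun u hu => ?_,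
    fun i hi hu => ?_⟩
  · have hex : ∃ v ∈ I, ι v = ι u := ⟨u, hu, rfl⟩
    have hval : (digit ⟨ι u, hq u hu⟩ : ℕ) = κ u := by
      rw [show digit ⟨ι u, hq u hu⟩ = _ from dif_pos hex]
      exact congrArg κ (hι hex.choose_spec.1 hu hex.choose_spec.2)
    exact (hdigit ⟨ι u, hq u hu⟩).trans hval
  · have h := hdigit ⟨i, hi⟩
    rwa [show digit ⟨i, hi⟩ = _ from dif_neg fun ⟨u, huI, h⟩ => hu u huI h] at h

theorem digit_iff {m i c d N : ℕ} (hd : d < m) (hc : c < N) :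
    (∃ hi < N, ∃ lo < N, lo < m ^ i ∧ c = hi * m ^ (i + 1) + d * m ^ i + lo) ↔
      c / m ^ i % m = d := by
  have hm : 0 < m := by omega
  have hp : 0 < m ^ i := Nat.pow_pos hm
  constructor
  · rintro ⟨hi, -, lo, -, hlo, rfl⟩
    rw [show hi * m ^ (i + 1) + d * m ^ i + lo = lo + m ^ i * (d + m * hi) by ring,
      Nat.add_mul_div_left _ _ hp, Nat.div_eq_of_lt hlo, zero_add, Nat.add_mul_mod_self_left,
      Nat.mod_eq_of_lt hd]
  · rintro rfl
    refine ⟨c / m ^ i / m, (Nat.div_le_self _ _).trans_lt ((Nat.div_le_self _ _).trans_lt hc),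
      c % m ^ i, (Nat.mod_le _ _).trans_lt hc, Nat.mod_lt _ hp, ?_⟩
    calc c = m ^ i * (c / m ^ i) + c % m ^ i := (Nat.div_add_mod c (m ^ i)).symm
      _ = m ^ i * (m * (c / m ^ i / m) + c / m ^ i % m) + c % m ^ i := by
        rw [Nat.div_add_mod (c / m ^ i) m]
      _ = _ := by ring


/-! ### The algorithm -/

/-- Store the pool of the graph `g`. -/
noncomputable def storePool (g : ℕ) (A : Mem) : Mem :=
  fill (5 + g) (fun p => poolIndicator p.1 g p.2) A

/-- Store the powers of the number of choices for one vertex. -/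
noncomputable def storePowers (A : Mem) : Mem := fill 4 (fun p => nextPower p.1 p.2) A

/-- Compute the twin covers, the pools, and the powers of the number of choices. -/
noncomputable def prepare (A : Mem) : Mem :=
  storePowers (storePool 1 (storePool 0 (storeMatching 1 (storeMatching 0 A))))

/-- Allow loops over the vertices of both graphs. -/
def vertexRange (A : Mem) : Mem := raiseBound (fun A => vertexCount A 0 + vertexCount A 1 + 3) A

/-- Allow loops over the codes of the relations between the pools. -/
noncomputable def codeRange (A : Mem) : Mem := raiseBound (fun A => A.cell 4 (poolSize A 0)) A

theorem polyTimeTransform_algorithm :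
    PolyTimeTransform fun A => codeRange (prepare (vertexRange A)) := by
  have hmatching (g : ℕ) : PolyTimeTransform (storeMatching g) :=
    .fill (by omega) (by fun_prop)
  have hpool (g : ℕ) : PolyTimeTransform (storePool g) := .fill (by omega) (by fun_prop)
  have hpowers : PolyTimeTransform storePowers := .fill (by decide) (by fun_prop)
  have hprepare : PolyTimeTransform prepare :=
    hpowers.comp ((hpool 1).comp ((hpool 0).comp ((hmatching 1).comp (hmatching 0))))
  exact (PolyTimeTransform.raiseBound (by fun_prop)).comp
    (hprepare.comp (.raiseBound (by fun_prop)))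

/-- Arrays `2` and `3` hold maximal matchings of the edges between vertices that are not twins. -/
structure HasMatchings (x : MCISInstance) (A : Mem) : Prop extends HasInput x A where
  greedy : ∀ g ≤ 1,
    IsGreedyMatching (inputOrder x g) (NatNontwin (inputGraph x g)) (A.cell (2 + g))

theorem hasMatchings_storeMatching {x : MCISInstance} {A : Mem} (h : HasInput x A) :
    HasMatchings x (storeMatching 1 (storeMatching 0 A)) := by
  have h₀ : HasInput x (storeMatching 0 A) := h.fillTo (by decide) _ _
  refine ⟨h₀.fillTo (by decide) _ _, fun g hg => ?_⟩
  interval_cases g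
  · rw [storeMatching, fill_cell_of_ne (by decide)]
    exact isGreedyMatching_storeMatching h hg
  · exact isGreedyMatching_storeMatching h₀ hg

namespace HasMatchings

variable {x : MCISInstance} {A : Mem} {a g v : ℕ}

theorem isTwinCovered (h : HasMatchings x A) (hg : g ≤ 1) : (storedGraph A g).IsTwinCovered := by
  rw [h.storedGraph_eq hg]
  exact isTwinCovered_toCoverGraph (h.greedy g hg)

theorem order_lt (h : HasMatchings x A) (hg : g ≤ 1) : (storedGraph A g).n < A.bound :=
  (vertexCount_eq h.input hg).trans_lt (h.lt g hg)

theorem lt_of_inGraphPool (h : HasMatchings x A) (hg : g ≤ 1) (hv : InGraphPool A g v) :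
    v < (storedGraph A g).n :=
  CoverGraph.InPool.lt (h.isTwinCovered hg) hv

theorem fillTo (h : HasMatchings x A) (ha : 3 < a) (F : Mem × ℕ → ℕ) (n : ℕ) :
    HasMatchings x (fillTo a F A n) where
  toHasInput := h.toHasInput.fillTo (by omega) F n
  greedy g hg := by
    rw [fillTo_cell_of_ne (by omega)]
    exact h.greedy g hg

theorem inGraphPool_fillTo (h : HasMatchings x A) (ha : 3 < a) (hg : g ≤ 1) (F : Mem × ℕ → ℕ)
    (n : ℕ) : InGraphPool (RAM.fillTo a F A n) g = InGraphPool A g := by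
  have hgraph (g : ℕ) (hg : g ≤ 1) : storedGraph (RAM.fillTo a F A n) g = storedGraph A g :=
    (h.fillTo ha F n).storedGraph_congr h.toHasInput hg (fillTo_cell_of_ne (by omega))
  funext v
  rw [InGraphPool, InGraphPool, coverBound, coverBound, fillTo_bound (by omega), hgraph g hg,
    hgraph 0 (by omega), hgraph 1 (by omega), hgraph (1 - g) (by omega)]

theorem inStoredPool_storePool (h : HasMatchings x A) (hg : g ≤ 1) (hz : A.cell (5 + g) = 0) :
    InStoredPool (storePool g A) g = InGraphPool (storePool g A) g := by
  rw [storePool, fill, h.inGraphPool_fillTo (by omega) hg]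
  funext v
  rw [InStoredPool]
  by_cases hv : v < A.bound
  · rw [fillTo_cell hv, poolIndicator, h.inGraphPool_fillTo (by omega) hg]
    simp
  · rw [fillTo_cell_of_le (not_lt.1 hv), hz]
    exact propext (iff_of_false (by simp) fun hp =>
      hv ((h.lt_of_inGraphPool hg hp).trans (h.order_lt hg)))

end HasMatchings

theorem inStoredPool_fillTo {A : Mem} {a g : ℕ} (h : a ≠ 5 + g) (F : Mem × ℕ → ℕ) (n : ℕ) :
    InStoredPool (fillTo a F A n) g = InStoredPool A g := by
  funext v
  rw [InStoredPool, InStoredPool, fillTo_cell_of_ne h.symm]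

theorem countBelow_le_of_lt {N n : ℕ} {P : ℕ → Prop} (h : ∀ v, P v → v < n) :
    countBelow N P ≤ n := by
  classical
  calc countBelow N P ≤ #(range n) :=
        card_le_card fun v hv => mem_range.2 (h v (mem_filter.1 hv).2)
    _ = n := card_range n

theorem cell_storePowers {A : Mem} (hm : poolSize A 1 < A.bound) {i : ℕ} (hi : i < A.bound) :
    (storePowers A).cell 4 i = (poolSize A 1 + 1) ^ i := by
  rw [storePowers, fill, fillTo_cell hi]
  clear hi
  induction i with
  | zero => rw [nextPower, if_pos rfl, pow_zero]
  | succ i ih =>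
    rw [nextPower, if_neg i.succ_ne_zero, Nat.add_sub_cancel, fillTo_cell i.lt_succ_self, ih,
      boundedMul_eq, poolSize, poolSize, fillTo_bound (by decide), inStoredPool_fillTo (by decide),
      pow_succ']
    rw [poolSize, fillTo_bound (by decide), inStoredPool_fillTo (by decide)]
    exact hm

/-- The twin covers, the pools and the powers have been computed. -/
structure Ready (x : MCISInstance) (A : Mem) : Prop extends HasMatchings x A where
  pool : ∀ g ≤ 1, InStoredPool A g = InGraphPool A g
  pow : ∀ i < A.bound, A.cell 4 i = (poolSize A 1 + 1) ^ i

theorem ready_prepare {x : MCISInstance} {A : Mem} (h : HasInput x A)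
    (hz : ∀ a > 1, A.cell a = 0) : Ready x (prepare A) := by
  set A₂ := storeMatching 1 (storeMatching 0 A) with hA₂
  have h₂ : HasMatchings x A₂ := hasMatchings_storeMatching h
  have hz₂ (a : ℕ) (ha : 3 < a) : A₂.cell a = 0 := by
    rw [hA₂, storeMatching, fill_cell_of_ne (by omega), storeMatching, fill_cell_of_ne (by omega)]
    exact hz a (by omega)
  set A₃ := storePool 0 A₂ with hA₃
  have h₃ : HasMatchings x A₃ := h₂.fillTo (by decide) _ _
  set A₄ := storePool 1 A₃ with hA₄
  have h₄ : HasMatchings x A₄ := h₃.fillTo (by decide) _ _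
  have hpool₄ (g : ℕ) (hg : g ≤ 1) : InStoredPool A₄ g = InGraphPool A₄ g := by
    interval_cases g
    · rw [hA₄, storePool, fill, inStoredPool_fillTo (by decide),
        h₃.inGraphPool_fillTo (by decide) hg]
      exact h₂.inStoredPool_storePool hg (hz₂ _ (by decide))
    · refine h₃.inStoredPool_storePool hg ?_
      rw [hA₃, storePool, fill_cell_of_ne (by decide)]
      exact hz₂ _ (by decide)
  have hsize : poolSize A₄ 1 < A₄.bound :=
    (countBelow_le_of_lt fun v hv => h₄.lt_of_inGraphPool le_rfl (hpool₄ 1 le_rfl ▸ hv)).trans_lt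
      (h₄.order_lt le_rfl)
  refine ⟨h₄.fillTo (by decide) _ _, fun g hg => ?_, fun i hi => ?_⟩
  · rw [prepare, storePowers, fill, inStoredPool_fillTo (by omega),
      h₄.inGraphPool_fillTo (by decide) hg]
    exact hpool₄ g hg
  · rw [prepare, storePowers, fill_bound (by decide)] at hi
    rw [prepare, cell_storePowers hsize hi, poolSize, poolSize, storePowers,
      fill_bound (by decide), fill, inStoredPool_fillTo (by decide)]

theorem prepare_bound (A : Mem) : (prepare A).bound = A.bound := by
  simp only [prepare, storePowers, storePool, storeMatching, fill_bound, ne_eq,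
    Nat.reduceAdd, Nat.reduceEqDiff, not_false_eq_true]

/-! ### The search -/

section coding

variable {A : Mem} {g c v w x y : ℕ}

theorem poolIndex_lt_poolIndex (hv : InStoredPool A g v) (hvA : v < A.bound) (h : v < w) :
    poolIndex A g v < poolIndex A g w :=
  countBelow_lt_countBelow (fun _ hu => ⟨hu.1, hu.2.trans h⟩) hvA ⟨hv, h⟩ fun h => lt_irrefl v h.2

theorem poolIndex_lt (hv : InStoredPool A g v) (hvA : v < A.bound) :
    poolIndex A g v < poolSize A g :=
  countBelow_lt_countBelow (fun _ hu => hu.1) hvA hv fun h => lt_irrefl v h.2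

theorem poolIndex_inj (hv : InStoredPool A g v) (hw : InStoredPool A g w) (hvA : v < A.bound)
    (hwA : w < A.bound) : poolIndex A g v = poolIndex A g w ↔ v = w := by
  refine ⟨fun h => ?_, fun h => h ▸ rfl⟩
  rcases lt_trichotomy v w with hlt | heq | hlt
  · exact absurd h (poolIndex_lt_poolIndex hv hvA hlt).ne
  · exact heq
  · exact absurd h (poolIndex_lt_poolIndex hw hwA hlt).ne'

/-- The pools lie below the loop bound, and array `4` holds the powers of the number of choices that
occur in codes. -/
structure HasPowers (A : Mem) : Prop where
  lt : ∀ g ≤ 1, ∀ v, InStoredPool A g v → v < A.bound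
  pow : ∀ i ≤ poolSize A 0, A.cell 4 i = (poolSize A 1 + 1) ^ i

namespace HasPowers

theorem codedRel_iff (h : HasPowers A) (hc : c < A.bound) :
    CodedRel A c x y ↔ (InStoredPool A 0 x ∧ InStoredPool A 1 y) ∧
      c / (poolSize A 1 + 1) ^ poolIndex A 0 x % (poolSize A 1 + 1) = poolIndex A 1 y + 1 := by
  refine and_congr_right fun ⟨hx, hy⟩ => ?_
  have hx' := poolIndex_lt hx (h.lt 0 zero_le_one x hx)
  have hy' := poolIndex_lt hy (h.lt 1 le_rfl y hy)
  have hsize : poolSize A 1 ≤ A.bound := countBelow_le_of_lt (h.lt 1 le_rfl)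
  rw [← digit_iff (Nat.succ_lt_succ hy') hc, h.pow _ hx'.le, h.pow _ hx',
    boundedMul_eq (hy'.trans_le hsize)]
  refine exists_congr fun hi => and_congr_right fun hlt => ?_
  simp only [boundedMul_eq hlt.le]
  rfl

theorem exists_codedRel (h : HasPowers A) (hA : (poolSize A 1 + 1) ^ poolSize A 0 ≤ A.bound)
    {I : Finset ℕ} {f : ℕ → ℕ} (hI : ∀ x ∈ I, InStoredPool A 0 x ∧ InStoredPool A 1 (f x)) :
    ∃ c < A.bound, CoverGraph.IsGraphBelow A.bound (CodedRel A c) I f := by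
  have hlt (x : ℕ) (hx : x ∈ I) : x < A.bound ∧ f x < A.bound :=
    ⟨h.lt 0 zero_le_one x (hI x hx).1, h.lt 1 le_rfl (f x) (hI x hx).2⟩
  obtain ⟨c, hc, hmem, hnot⟩ := exists_digits (I := I) (ι := poolIndex A 0)
    (κ := fun x => poolIndex A 1 (f x) + 1) (m := poolSize A 1 + 1)
    (fun u hu v hv => (poolIndex_inj (hI u hu).1 (hI v hv).1 (hlt u hu).1 (hlt v hv).1).1)
    (fun x hx => poolIndex_lt (hI x hx).1 (hlt x hx).1)
    (fun x hx => Nat.succ_lt_succ (poolIndex_lt (hI x hx).2 (hlt x hx).2)) (Nat.succ_pos _)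
  refine ⟨c, hc.trans_le hA, hlt, fun x hxA y hyA => ?_⟩
  rw [h.codedRel_iff (hc.trans_le hA)]
  constructor
  · rintro ⟨⟨hx, hy⟩, hdigit⟩
    have hxI : x ∈ I := by
      by_contra hxI
      rw [hnot _ (poolIndex_lt hx hxA) fun u hu he =>
        hxI ((poolIndex_inj (hI u hu).1 hx (hlt u hu).1 hxA).1 he ▸ hu)] at hdigit
      exact Nat.succ_ne_zero _ hdigit.symm
    rw [hmem x hxI] at hdigit
    exact ⟨hxI, ((poolIndex_inj (hI x hxI).2 hy (hlt x hxI).2 hyA).1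
      (Nat.succ_injective hdigit)).symm⟩
  · rintro ⟨hxI, rfl⟩
    exact ⟨hI x hxI, hmem x hxI⟩

end HasPowers

end coding

theorem countBelow_eq_of_lt {N M : ℕ} {P : ℕ → Prop} (hN : ∀ v, P v → v < N)
    (hM : ∀ v, P v → v < M) : countBelow N P = countBelow M P := by
  rw [countBelow, countBelow]
  congr 1
  ext v
  simp only [mem_filter, mem_range]
  exact and_congr_left fun hv => iff_of_true (hN v hv) (hM v hv)

namespace Ready

variable {x : MCISInstance} {A : Mem} {g v : ℕ}

theorem lt_of_inStoredPool (h : Ready x A) (hg : g ≤ 1) (hv : InStoredPool A g v) :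
    v < (storedGraph A g).n :=
  h.lt_of_inGraphPool hg (h.pool g hg ▸ hv)

theorem poolSize_lt (h : Ready x A) (hg : g ≤ 1) : poolSize A g < A.bound :=
  (countBelow_le_of_lt fun _ hv => h.lt_of_inStoredPool hg hv).trans_lt (h.order_lt hg)

theorem codeRange_bound (h : Ready x A) :
    (codeRange A).bound = A.bound + (poolSize A 1 + 1) ^ poolSize A 0 := by
  rw [codeRange, raiseBound_bound, h.pow _ (h.poolSize_lt zero_le_one)]

theorem bound_le_codeRange_bound (h : Ready x A) : A.bound ≤ (codeRange A).bound :=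
  h.codeRange_bound ▸ Nat.le_add_right _ _

theorem storedGraph_codeRange (h : Ready x A) (hg : g ≤ 1) :
    storedGraph (codeRange A) g = storedGraph A g :=
  (h.of_cell_eq (raiseBound_cell_of_ne (by decide) _ _)
    h.bound_le_codeRange_bound).storedGraph_congr h.toHasInput hg
      (raiseBound_cell_of_ne (by omega) _ _)

theorem inStoredPool_codeRange (g : ℕ) : InStoredPool (codeRange A) g = InStoredPool A g := by
  funext v
  rw [InStoredPool, InStoredPool, codeRange, raiseBound_cell_of_ne (by omega)]

theorem lt_codeRange_bound (h : Ready x A) (hg : g ≤ 1) (hv : InStoredPool A g v) :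
    v < (codeRange A).bound :=
  ((h.lt_of_inStoredPool hg hv).trans (h.order_lt hg)).trans_le h.bound_le_codeRange_bound

theorem poolSize_codeRange (h : Ready x A) (hg : g ≤ 1) :
    poolSize (codeRange A) g = poolSize A g := by
  rw [poolSize, inStoredPool_codeRange]
  exact countBelow_eq_of_lt (fun v hv => h.lt_codeRange_bound hg hv) fun v hv =>
    (h.lt_of_inStoredPool hg hv).trans (h.order_lt hg)

theorem hasPowers_codeRange (h : Ready x A) : HasPowers (codeRange A) where
  lt g hg v hv := h.lt_codeRange_bound hg (inStoredPool_codeRange g ▸ hv)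
  pow i hi := by
    rw [h.poolSize_codeRange zero_le_one] at hi
    rw [h.poolSize_codeRange le_rfl, codeRange, raiseBound_cell_of_ne (by decide)]
    exact h.pow i (hi.trans_lt (h.poolSize_lt zero_le_one))

theorem isYes_iff (h : Ready x A) : x.IsYes ↔
    ∃ φ, CoverGraph.IsPartialIso (storedGraph A 0) (storedGraph A 1) φ ∧ x.h ≤ #φ := by
  rw [h.storedGraph_eq zero_le_one, h.storedGraph_eq le_rfl]
  exact MCIS.isYes_iff x _ _

theorem accepts_iff (h : Ready x A) : Accepts (codeRange A) ↔ x.IsYes := by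
  have hG := h.isTwinCovered zero_le_one
  have hH := h.isTwinCovered le_rfl
  have hGN := h.order_lt zero_le_one
  have hHN := h.order_lt le_rfl
  have hGN' := hGN.le.trans h.bound_le_codeRange_bound
  have hHN' := hHN.le.trans h.bound_le_codeRange_bound
  have hcell : (codeRange A).cell 0 = A.cell 0 := raiseBound_cell_of_ne (by decide) _ _
  rw [h.isYes_iff, Accepts, h.storedGraph_codeRange zero_le_one, h.storedGraph_codeRange le_rfl,
    hcell, h.cell_two]
  constructor
  · rintro ⟨c, -, hpi, hval⟩
    have hlt (u v : ℕ) (huv : CodedRel (codeRange A) c u v) :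
        u < (storedGraph A 0).n ∧ v < (storedGraph A 1).n :=
      ⟨h.lt_of_inStoredPool zero_le_one (inStoredPool_codeRange 0 ▸ huv.1.1),
        h.lt_of_inStoredPool le_rfl (inStoredPool_codeRange 1 ▸ huv.1.2)⟩
    obtain ⟨φ, hφ, hle⟩ :=
      CoverGraph.exists_isPartialIso_of_isPartialIsoRel hG hH hGN' hHN' hlt hpi
    exact ⟨φ, hφ, hval.trans hle⟩
  · rintro ⟨φ, hφ, hle⟩
    obtain ⟨I, f, hI, hpool, hval⟩ :=
      CoverGraph.exists_inPool_map hG hH hGN hHN (Nat.lt_succ_self _) hφ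
    have hIpool (u : ℕ) (hu : u ∈ I) :
        InStoredPool (codeRange A) 0 u ∧ InStoredPool (codeRange A) 1 (f u) := by
      rw [inStoredPool_codeRange, inStoredPool_codeRange, h.pool 0 zero_le_one, h.pool 1 le_rfl]
      exact hpool u hu
    obtain ⟨c, hc, hcode⟩ := h.hasPowers_codeRange.exists_codedRel (by
      rw [h.poolSize_codeRange zero_le_one, h.poolSize_codeRange le_rfl, h.codeRange_bound]
      exact Nat.le_add_left _ _) hIpool
    refine ⟨c, hc, hcode.isPartialIsoRel hI, ?_⟩
    rw [hcode.relValue_eq hGN' hHN']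
    exact hle.trans hval

end Ready

/-! ### The running time -/

/-- A bound for the number of maps between the pools in terms of the parameter. -/
def mapBound (t : ℕ) : ℕ :=
  (CoverGraph.poolBound (2 * t + 1) + 1) ^ CoverGraph.poolBound (2 * t + 1)

theorem mapBound_pos (t : ℕ) : 0 < mapBound t := Nat.pow_pos (Nat.succ_pos _)

theorem poolBound_mono : Monotone CoverGraph.poolBound := by
  intro a b h
  unfold CoverGraph.poolBound CoverGraph.thresholdBound CoverGraph.classBound
  gcongr <;> omega

section bounds

variable {x : MCISInstance} {A : Mem} {g : ℕ}

theorem HasMatchings.coverBound_le (h : HasMatchings x A) : coverBound A ≤ 2 * x.tcSum + 1 := by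
  have h₀ : countBelow A.bound (storedGraph A 0).cover ≤ 2 * x.G₁.twinCoverNumber := by
    rw [h.storedGraph_eq zero_le_one]
    exact countBelow_covered_le_twinCoverNumber (h.greedy 0 zero_le_one) _
  have h₁ : countBelow A.bound (storedGraph A 1).cover ≤ 2 * x.G₂.twinCoverNumber := by
    rw [h.storedGraph_eq le_rfl]
    exact countBelow_covered_le_twinCoverNumber (h.greedy 1 le_rfl) _
  rw [coverBound, MCISInstance.tcSum]
  omega

theorem countBelow_cover_le (hg : g ≤ 1) :
    countBelow A.bound (storedGraph A g).cover ≤ coverBound A := by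
  rw [coverBound]
  interval_cases g <;> omega

theorem Ready.poolSize_le (h : Ready x A) (hg : g ≤ 1) :
    poolSize A g ≤ CoverGraph.poolBound (2 * x.tcSum + 1) := by
  have hg' : 1 - g ≤ 1 := Nat.sub_le 1 g
  rw [poolSize, h.pool g hg]
  exact (CoverGraph.countBelow_inPool_le (h.isTwinCovered hg) (h.order_lt hg).le
    (h.order_lt hg').le (countBelow_cover_le hg) (countBelow_cover_le hg')).trans
      (poolBound_mono h.coverBound_le)

theorem Ready.codeRange_bound_le (h : Ready x A) :
    (codeRange A).bound ≤ A.bound + mapBound x.tcSum := by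
  rw [h.codeRange_bound, mapBound]
  gcongr
  · exact Nat.succ_pos _
  · exact h.poolSize_le le_rfl
  · exact h.poolSize_le zero_le_one

end bounds

theorem cell_zero_initState (x : MCISInstance) :
    (initState x.encode).mem.cell 0 = fun i => x.encode.getD i 0 := by
  funext i
  simp [State.mem, initState]

theorem vertexRange_bound (x : MCISInstance) :
    (vertexRange (initState x.encode).mem).bound = x.n₁ + x.n₂ + 3 := by
  have hbound : (initState x.encode).mem.bound = 0 := by
    simp [Mem.bound, State.mem, initState]
  rw [vertexRange, raiseBound_bound, hbound, vertexCount_eq (cell_zero_initState x) zero_le_one,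
    vertexCount_eq (cell_zero_initState x) le_rfl, zero_add]
  rfl

theorem ready_initState (x : MCISInstance) :
    Ready x (prepare (vertexRange (initState x.encode).mem)) := by
  refine ready_prepare ⟨?_, fun g hg => ?_⟩ fun a ha => ?_
  · rw [vertexRange, raiseBound_cell_of_ne (by decide), cell_zero_initState]
  · rw [vertexRange_bound]
    interval_cases g <;> simp only [inputOrder] <;> omega
  · rw [vertexRange, raiseBound_cell_of_ne (by omega)]
    funext i
    simp [State.mem, initState, show a ≠ 0 by omega]

theorem bound_le (x : MCISInstance) :
    (codeRange (prepare (vertexRange (initState x.encode).mem))).bound + 1 ≤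
      3 * mapBound x.tcSum * x.encode.length := by
  have hbound := (ready_initState x).codeRange_bound_le
  rw [prepare_bound, vertexRange_bound] at hbound
  have hmap := mapBound_pos x.tcSum
  have hlen : x.n₁ + x.n₂ + 3 ≤ x.encode.length := by
    rw [length_encode]
    nlinarith [Nat.le_mul_self x.n₁, Nat.le_mul_self x.n₂]
  nlinarith

theorem primrec_mapBound : Primrec mapBound := by
  have hadd := Primrec.nat_add
  have hmul := Primrec.nat_mul
  have hpow : Primrec₂ ((· ^ ·) : ℕ → ℕ → ℕ) := Primrec₂.unpaired'.1 Nat.Primrec.pow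
  have hclass : Primrec CoverGraph.classBound :=
    hmul.comp (hpow.comp (.const 2) .id) .id
  have hthreshold : Primrec CoverGraph.thresholdBound :=
    hadd.comp (hadd.comp (.const 1) .id) (hmul.comp hclass .id)
  have hpool : Primrec CoverGraph.poolBound :=
    hadd.comp .id (hmul.comp (hmul.comp hthreshold (hadd.comp hclass hclass)) .id)
  have hpool' : Primrec fun t : ℕ => CoverGraph.poolBound (2 * t + 1) :=
    hpool.comp (hadd.comp (hmul.comp (.const 2) .id) (.const 1))
  exact hpow.comp (hadd.comp hpool' (.const 1)) hpool'

theorem computable_timeBound (C k : ℕ) : Computable fun t => C * (3 * mapBound t) ^ k := by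
  have hpow : Primrec₂ ((· ^ ·) : ℕ → ℕ → ℕ) := Primrec₂.unpaired'.1 Nat.Primrec.pow
  exact (Primrec.nat_mul.comp (.const C)
    (hpow.comp (Primrec.nat_mul.comp (.const 3) primrec_mapBound) (.const k))).to_comp

end MCIS

/-- Maximum Common Induced Subgraph is fixed-parameter tractable parameterized by
`tc(G₁) + tc(G₂)`. -/
theorem mainTheorem1 :
    IsFPT MCISInstance.encode MCISInstance.tcSum MCISInstance.IsYes := by
  obtain ⟨C, k, p, hp⟩ :=
    MCIS.polyTimeTransform_algorithm.exists_decider MCIS.polyTime_accepts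
  refine ⟨p, fun t => C * (3 * MCIS.mapBound t) ^ k, k, MCIS.computable_timeBound C k, fun x => ?_⟩
  obtain ⟨s, ⟨t, ht, hexec⟩, hyes, hno⟩ := hp (initState x.encode)
  have hacc := (MCIS.ready_initState x).accepts_iff
  refine ⟨t, s, hexec, ht.trans ?_, fun h => hyes (hacc.2 h), fun h => hno fun h' => h (hacc.1 h')⟩
  rw [mul_assoc, ← mul_pow]
  exact Nat.mul_le_mul_left C (Nat.pow_le_pow_left (MCIS.bound_le x) k)
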